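/- Let $\mathbb D$ be a Dedekind domain and $H$ a Hopf algebra over $\mathbb D$ (product, unit $1$, coproduct $\Delta(x)=\sum x'\otimes x''$, counit $\epsilon$, antipode $S$) that is finitely generated and projective as a $\mathbb D$-module. Write $H^*=\mathrm{Hom}_{\mathbb D}(H,\mathbb D)$ for the dual Hopf algebra, with product $(pq)(x)=\sum p(x')q(x'')$; its group-like elements are the algebra maps $H\to\mathbb D$. For $f\in H^*$ and $x\in H$ put $f\rightharpoonup x=\sum f(x'')x'$ and $x\leftharpoonup f=\sum f(x')x''$. A left (right) cointegral of a Hopf algebra is an element $\Lambda$ with $x\Lambda=\epsilon(x)\Lambda$ (resp. $\Lambda x=\epsilon(x)\Lambda$) for all $x$; a two-sided cointegral is both; a right integral is a linear form $\lambda$ with $\lambda f=f(1)\lambda$ for all linear forms $f$. Suppose that $H$ is *double balanced*: there are group-like elements $\alpha,\beta\in H^*$ and $g,l\in H$ such that $\Lambda x=\alpha(x)\Lambda$ for every left cointegral $\Lambda$ of $H$ and all $x\in H$; $f\lambda=f(g)\lambda$ for every right integral $\lambda$ of $H$ and all $f\in H^*$; $\beta^2=\alpha$; $l^2=g$; and $$S^2(x)=l\,(\beta\rightharpoonup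 x\leftharpoonup\beta^{-1})\,l^{-1}\qquad\text{for all }x\in H.$$ Then $S$ is bijective. Let $D(H)$ be the quantum double of $H$: as a coalgebra $D(H)=H^{*\mathrm{cop}}\otimes H$; its product is $$(p\otimes x)(q\otimes y)=\sum p\,\bigl(x'\rightharpoonup q\leftharpoonup S^{-1}(x''')\bigr)\otimes x''y,\qquad (a\rightharpoonup q\leftharpoonup c)(z)=q(cza),$$ with unit $\epsilon\otimes 1$; its antipode is $S_D(p\otimes x)=(\epsilon\otimes S(x))(p\circ S^{-1}\otimes 1)$; and let $R=\sum_i(\epsilon\otimes h_i)\otimes(h^i\otimes 1)$, where $\sum_i h^i(x)h_i=x$ for all $x\in H$. Then $D(H)$ with $R$ is *topogenic*. That is, $D(H)$ is a finitely generated $\mathbb D$-module with bijective antipode, and: 0. (quasi-triangular) $R$ is invertible, $(\Delta\otimes\mathrm{id})R=R_{13}R_{23}$, $(\mathrm{id}\otimes\Delta)R=R_{13}R_{12}$, and $R\,\Delta(a)=\Delta^{\mathrm{op}}(a)\,R$ for all $a\in D(H)$; 1. (ribbon and balanced) with $R=\sum_i e_i\otimes f_i$ and $u=\sum_i S_D(f_i)e_i$,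 the element $u$ is invertible, and there are a group-like element $\kappa$ with $\kappa^2=uS_D(u)^{-1}=S_D(u)^{-1}u$ and $S_D^2(a)=\kappa a\kappa^{-1}$ for all $a\in D(H)$, and an invertible central element $r=u\kappa^{-1}$ with $S_D(r)=r$ and $R_{21}R=(r\otimes r)\Delta(r^{-1})$; 2. (modular) the map $D(H)^*\to D(H)$, $f\mapsto(f\otimes\mathrm{id})(R_{21}R)$, is bijective; 3. there is a right integral $\lambda\in D(H)^*$ with $\lambda(r)\lambda(r^{-1})=1$, for the element $r$ of 1; 4. there is a two-sided cointegral $\Lambda\in D(H)$ with $\lambda(\Lambda)=\lambda(S_D(\Lambda))=1$, for the form $\lambda$ of 3. -/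

import Mathlib

open TensorProduct Coalgebra HopfAlgebra Bialgebra

namespace DrinfeldDouble
noncomputable section
universe u v
section Aux
variable {D : Type u} {H : Type v} [CommRing D] [Ring H] [HopfAlgebra D H]

open Module (Dual)

variable (D H) in
/-- The product of the dual algebra: `(p * q)(x) = ∑ p(x') q(x'')`. -/
def convL : Dual D H →ₗ[D] Dual D H →ₗ[D] Dual D H :=
  TensorProduct.curry ((comul (R := D) (A := H)).dualMap ∘ₗ TensorProduct.dualDistrib D H H)

lemma convL_apply (p q : Dual D H) (x : H) :
    convL D H p q x = TensorProduct.dualDistrib D H H (p ⊗ₜ q) (comul x) := rfl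

lemma convL_eq (p q : Dual D H) :
    convL D H p q = ((WithConv.toConv p * WithConv.toConv q : WithConv (H →ₗ[D] D))).ofConv := by
  ext x
  rw [convL_apply, WithConv.ofConv]
  simp [LinearMap.convMul_def]
  induction comul (R := D) x with
  | zero => simp
  | add a b ha hb => simp [ha, hb]
  | tmul a b => simp

lemma convL_assoc (p q r : Dual D H) :
    convL D H (convL D H p q) r = convL D H p (convL D H q r) := by
  simp only [convL_eq, WithConv.toConv_ofConv, mul_assoc]

lemma counit_convL (p : Dual D H) : convL D H counit p = p := by
  have : (WithConv.toConv (counit (R := D) (A := H)) : WithConv (H →ₗ[D] D)) = 1 := rfl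
  rw [convL_eq, this, one_mul]

lemma convL_counit (p : Dual D H) : convL D H p counit = p := by
  have : (WithConv.toConv (counit (R := D) (A := H)) : WithConv (H →ₗ[D] D)) = 1 := rfl
  rw [convL_eq, this, mul_one]

variable (D H) in
/-- `(a ⇀ q)(z) = q(z a)`. -/
def lactHom : H →ₐ[D] Module.End D (Dual D H) :=
  AlgHom.ofLinearMap (LinearMap.mk₂ D (fun (a : H) (q : Dual D H) => q ∘ₗ LinearMap.mulRight D a)
    (by intros; ext; simp [mul_add]) (by intros; ext; simp) (by intros; ext; simp)
    (by intros; ext; simp)) (by ext; simp) (by intros; ext; simp [mul_assoc])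

variable (D H) in
/-- `(q ↼ c)(z) = q(c z)`. -/
def ractHom : Hᵐᵒᵖ →ₐ[D] Module.End D (Dual D H) :=
  AlgHom.ofLinearMap (LinearMap.mk₂ D
    (fun (a : Hᵐᵒᵖ) (q : Dual D H) => q ∘ₗ LinearMap.mulLeft D a.unop)
    (by intros; ext; simp [add_mul]) (by intros; ext; simp) (by intros; ext; simp)
    (by intros; ext; simp)) (by ext; simp) (by intros; ext; simp)

@[simp] lemma lactHom_apply (a : H) (q : Dual D H) (z : H) : lactHom D H a q z = q (z * a) := rfl
@[simp] lemma ractHom_apply (a : Hᵐᵒᵖ) (q : Dual D H) (z : H) :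
    ractHom D H a q z = q (a.unop * z) := rfl

lemma lact_ract_commute (a : H) (c : Hᵐᵒᵖ) : Commute (lactHom D H a) (ractHom D H c) := by
  rw [commute_iff_eq]
  ext q z
  simp [mul_assoc]

variable (D H) in
/-- `a ⊗ c` acts as `q ↦ a ⇀ q ↼ c`, with `(a ⇀ q ↼ c)(z) = q(c z a)`. -/
def actA : H ⊗[D] Hᵐᵒᵖ →ₐ[D] Module.End D (Dual D H) :=
  Algebra.TensorProduct.lift (lactHom D H) (ractHom D H) lact_ract_commute

@[simp] lemma actA_tmul (a : H) (c : Hᵐᵒᵖ) (q : Dual D H) (z : H) :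
    actA D H (a ⊗ₜ c) q z = q (c.unop * z * a) := by
  rw [actA, Algebra.TensorProduct.lift_tmul]
  simp [mul_assoc]

lemma comul_comp_comul :
    TensorProduct.map comul comul ∘ₗ comul (R := D) (A := H) =
    (TensorProduct.assoc D H H (H ⊗[D] H)).symm.toLinearMap ∘ₗ
    (TensorProduct.assoc D H H H).toLinearMap.lTensor H ∘ₗ
      (comul.rTensor H).lTensor H ∘ₗ comul.lTensor H ∘ₗ comul (R := D) (A := H) := by
  simp only [coassoc_simps]

lemma comul_antipode_lin :
    comul ∘ₗ antipode D (A := H) =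
      TensorProduct.map (antipode D) (antipode D) ∘ₗ (TensorProduct.comm D H H).toLinearMap ∘ₗ
        comul := by
  apply WithConv.toConv_injective
  refine (left_inv_eq_right_inv (a := WithConv.toConv (comul (R := D) (A := H))) ?_
    LinearMap.comul_right_inv).symm
  apply WithConv.ext
  simp only [LinearMap.convMul_def, LinearMap.convOne_def, WithConv.ofConv_toConv]
  have h1 : TensorProduct.map (TensorProduct.map (antipode D (A := H)) (antipode D (A := H)) ∘ₗ
      (TensorProduct.comm D H H).toLinearMap ∘ₗ comul) (comul (R := D) (A := H)) ∘ₗ comul =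
      TensorProduct.map (TensorProduct.map (antipode D (A := H)) (antipode D (A := H)) ∘ₗ
      (TensorProduct.comm D H H).toLinearMap) .id ∘ₗ TensorProduct.map comul comul ∘ₗ comul := by
    simp only [coassoc_simps]
  rw [h1, comul_comp_comul]
  have h2 : LinearMap.mul' D (H ⊗[D] H) ∘ₗ TensorProduct.map (TensorProduct.map (antipode D (A := H)) (antipode D (A := H)) ∘ₗ
      (TensorProduct.comm D H H).toLinearMap) .id ∘ₗ
        (TensorProduct.assoc D H H (H ⊗[D] H)).symm.toLinearMap ∘ₗ
    (TensorProduct.assoc D H H H).toLinearMap.lTensor H ∘ₗ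
      (comul.rTensor H).lTensor H =
      TensorProduct.mk D H H 1 ∘ₗ LinearMap.mul' D H ∘ₗ (antipode D).rTensor H ∘ₗ
        (TensorProduct.lid D H).toLinearMap.lTensor H ∘ₗ (counit.rTensor H).lTensor H := by
    ext a b c
    have : ∀ t : H ⊗[D] H, LinearMap.mul' D (H ⊗[D] H) (TensorProduct.map (TensorProduct.map (antipode D (A := H)) (antipode D (A := H)) ∘ₗ
      (TensorProduct.comm D H H).toLinearMap) .id
        ((TensorProduct.assoc D H H (H ⊗[D] H)).symm
    ((TensorProduct.assoc D H H H).toLinearMap.lTensor H (a ⊗ₜ (t ⊗ₜ c))))) =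
      LinearMap.mul' D H ((antipode D).rTensor H t) ⊗ₜ (antipode D a * c) := by
      intro t
      induction t with
      | zero => simp
      | add x y hx hy => simp only [tmul_add, add_tmul, map_add, hx, hy]
      | tmul x y => simp
    simpa [Algebra.algebraMap_eq_smul_one, TensorProduct.smul_tmul] using this (comul b)
  calc _ = (LinearMap.mul' D (H ⊗[D] H) ∘ₗ TensorProduct.map (TensorProduct.map (antipode D (A := H)) (antipode D (A := H)) ∘ₗ
      (TensorProduct.comm D H H).toLinearMap) .id ∘ₗ
        (TensorProduct.assoc D H H (H ⊗[D] H)).symm.toLinearMap ∘ₗ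
    (TensorProduct.assoc D H H H).toLinearMap.lTensor H ∘ₗ
      (comul.rTensor H).lTensor H) ∘ₗ comul.lTensor H ∘ₗ comul (R := D) (A := H) := rfl
    _ = _ := by
      rw [h2]
      have : (TensorProduct.lid D H).toLinearMap ∘ₗ counit.rTensor H ∘ₗ comul = .id := by
        ext; simp
      have this' : ∀ t : H ⊗[D] H, (TensorProduct.lid D H).toLinearMap.lTensor H
          ((counit.rTensor H).lTensor H (comul.lTensor H t)) = t := by
        intro t
        rw [← LinearMap.comp_apply, ← LinearMap.comp_apply, ← LinearMap.lTensor_comp,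
          ← LinearMap.lTensor_comp, LinearMap.comp_assoc, this, LinearMap.lTensor_id,
          LinearMap.id_apply]
      ext x
      simp [this', Algebra.algebraMap_eq_smul_one, Algebra.TensorProduct.one_def]

lemma comul_antipode (x : H) : comul (antipode D x) =
    TensorProduct.map (antipode D) (antipode D) (TensorProduct.comm D H H (comul x)) :=
  LinearMap.congr_fun comul_antipode_lin x

variable (hS : Function.Bijective (antipode D : H →ₗ[D] H))

/-- The inverse of the antipode. -/
def antipodeInv : H →ₗ[D] H := (LinearEquiv.ofBijective (antipode D) hS).symm.toLinearMap

@[simp] lemma antipode_antipodeInv (x : H) : antipode D (antipodeInv hS x) = x :=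
  (LinearEquiv.ofBijective (antipode D) hS).apply_symm_apply x

@[simp] lemma antipodeInv_antipode (x : H) : antipodeInv hS (antipode D x) = x :=
  (LinearEquiv.ofBijective (antipode D) hS).symm_apply_apply x

lemma antipodeInv_one : antipodeInv hS 1 = 1 := by
  apply hS.1; simp

lemma antipodeInv_mul (x y : H) :
    antipodeInv hS (x * y) = antipodeInv hS y * antipodeInv hS x := by
  apply hS.1; simp [antipode_mul_antidistrib]

lemma comul_antipodeInv (x : H) : comul (antipodeInv hS x) =
    TensorProduct.map (antipodeInv hS) (antipodeInv hS) (TensorProduct.comm D H H (comul x)) := by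
  obtain ⟨y, rfl⟩ := hS.2 x
  rw [antipodeInv_antipode, comul_antipode]
  induction comul (R := D) y with
  | zero => simp
  | add a b ha hb => simp only [map_add, ← ha, ← hb]
  | tmul a b => simp

/-- The inverse of the antipode as an algebra map to the opposite algebra. -/
def antipodeInvOp : H →ₐ[D] Hᵐᵒᵖ :=
  AlgHom.ofLinearMap ((MulOpposite.opLinearEquiv D).toLinearMap ∘ₗ antipodeInv hS)
    (by simp [antipodeInv_one]) (by simp [antipodeInv_mul])

@[simp] lemma antipodeInvOp_apply (x : H) :
    antipodeInvOp hS x = MulOpposite.op (antipodeInv hS x) := rfl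

variable (D H) in
/-- `x ↦ ∑ x' ⊗ (x'' ⊗ x''')`. -/
def comul₃ : H →ₐ[D] H ⊗[D] (H ⊗[D] H) :=
  (Algebra.TensorProduct.map (.id D H) (comulAlgHom D H)).comp (comulAlgHom D H)

lemma comul₃_apply (x : H) : comul₃ D H x = comul.lTensor H (comul x) := rfl

/-- `a ⊗ b ⊗ c ↦ (a ⊗ S⁻¹(c)) ⊗ b`. -/
def stir : H ⊗[D] (H ⊗[D] H) →ₐ[D] (H ⊗[D] Hᵐᵒᵖ) ⊗[D] H :=
  (Algebra.TensorProduct.assoc D D D H Hᵐᵒᵖ H).symm.toAlgHom.comp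
    (Algebra.TensorProduct.map (.id D H)
      ((Algebra.TensorProduct.comm D H Hᵐᵒᵖ).toAlgHom.comp
        (Algebra.TensorProduct.map (.id D H) (antipodeInvOp hS))))

@[simp] lemma stir_tmul (a b c : H) : stir hS (a ⊗ₜ[D] (b ⊗ₜ[D] c)) =
    (a ⊗ₜ MulOpposite.op (antipodeInv hS c)) ⊗ₜ b := rfl

/-- `a ⊗ b ⊗ c` acts on `H* ⊗ H` by `q ⊗ y ↦ (a ⇀ q ↼ S⁻¹(c)) ⊗ b y`. -/
def act₃ : H ⊗[D] (H ⊗[D] H) →ₐ[D] Module.End D (Dual D H ⊗[D] H) :=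
  ((Module.endTensorEndAlgHom (R := D) (S := D) (A := D) (M := Dual D H) (N := H)).comp
    (Algebra.TensorProduct.map (actA D H) (Algebra.lmul D H))).comp (stir hS)

lemma act₃_tmul (a b c : H) (q : Dual D H) (y : H) : act₃ hS (a ⊗ₜ (b ⊗ₜ c)) (q ⊗ₜ y) =
    actA D H (a ⊗ₜ MulOpposite.op (antipodeInv hS c)) q ⊗ₜ (b * y) := rfl

/-- Left multiplication by `ε ⊗ x`: `q ⊗ y ↦ ∑ (x' ⇀ q ↼ S⁻¹(x''')) ⊗ x'' y`. -/
def lmulR : H →ₐ[D] Module.End D (Dual D H ⊗[D] H) := (act₃ hS).comp (comul₃ D H)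

variable (D H) in
/-- Left multiplication by `p ⊗ 1`: `q ⊗ y ↦ p * q ⊗ y`. -/
def lmulL : Dual D H →ₗ[D] Module.End D (Dual D H ⊗[D] H) :=
  (LinearMap.rTensorHom H) ∘ₗ convL D H

@[simp] lemma lmulL_tmul (p q : Dual D H) (x : H) :
    lmulL D H p (q ⊗ₜ x) = convL D H p q ⊗ₜ x := rfl

/-- The multiplication of the double:
`(p ⊗ x)(q ⊗ y) = ∑ p * (x' ⇀ q ↼ S⁻¹(x''')) ⊗ x'' y`. -/
def mulL : Dual D H ⊗[D] H →ₗ[D] Module.End D (Dual D H ⊗[D] H) :=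
  TensorProduct.lift ((LinearMap.mul D (Module.End D (Dual D H ⊗[D] H))).compl₁₂ (lmulL D H)
    (lmulR hS).toLinearMap)

@[simp] lemma mulL_tmul (p : Dual D H) (x : H) (v : Dual D H ⊗[D] H) :
    mulL hS (p ⊗ₜ x) v = lmulL D H p (lmulR hS x v) := rfl

lemma lmulL_lmulL (p q : Dual D H) (v : Dual D H ⊗[D] H) :
    lmulL D H p (lmulL D H q v) = lmulL D H (convL D H p q) v := by
  induction v with
  | zero => simp
  | add a b ha hb => simp only [map_add, ha, hb]
  | tmul a b => simp [convL_assoc]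

lemma mulL_lmulL (p : Dual D H) (u v : Dual D H ⊗[D] H) :
    mulL hS (lmulL D H p u) v = lmulL D H p (mulL hS u v) := by
  induction u with
  | zero => simp
  | add a b ha hb => simp only [map_add, ha, hb, LinearMap.add_apply]
  | tmul a b => simp [lmulL_lmulL]

lemma lmulR_rmul (x : H) (v : Dual D H ⊗[D] H) (y : H) :
    lmulR hS x ((LinearMap.mulRight D y).lTensor _ v) =
      (LinearMap.mulRight D y).lTensor _ (lmulR hS x v) := by
  have : ∀ t : H ⊗[D] (H ⊗[D] H), act₃ hS t ((LinearMap.mulRight D y).lTensor _ v) =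
      (LinearMap.mulRight D y).lTensor _ (act₃ hS t v) := by
    intro t
    induction t with
    | zero => simp
    | add a b ha hb => simp only [map_add, ha, hb, LinearMap.add_apply]
    | tmul a t =>
    induction t with
    | zero => simp
    | add a b ha hb => simp only [tmul_add, map_add, ha, hb, LinearMap.add_apply]
    | tmul b c =>
    induction v with
    | zero => simp
    | add a b ha hb => simp only [map_add, ha, hb]
    | tmul q z => simp [act₃_tmul, mul_assoc]
  exact this _

lemma mulL_mulRight (u v : Dual D H ⊗[D] H) (x : H) :
    mulL hS ((LinearMap.mulRight D x).lTensor _ u) v = mulL hS u (lmulR hS x v) := by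
  induction u with
  | zero => simp
  | add a b ha hb => simp only [map_add, ha, hb, LinearMap.add_apply]
  | tmul a b => simp

lemma act_hexagon_lin :
    TensorProduct.map comul (comul.lTensor H) ∘ₗ comul.lTensor H ∘ₗ comul (R := D) (A := H) =
    (TensorProduct.assoc D H H (H ⊗[D] (H ⊗[D] H))).symm.toLinearMap ∘ₗ
    ((TensorProduct.assoc D H H (H ⊗[D] H)).toLinearMap ∘ₗ
     (TensorProduct.assoc D (H ⊗[D] H) H H).toLinearMap ∘ₗ
     (TensorProduct.assoc D H H H).symm.toLinearMap.rTensor H).lTensor H ∘ₗ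
    ((comul.lTensor H).rTensor H ∘ₗ comul.rTensor H).lTensor H ∘ₗ
     comul.lTensor H ∘ₗ comul (R := D) (A := H) := by
  simp only [coassoc_simps]

/-- `a ⊗ c ↦ a ⇀ q ↼ S⁻¹(c)`. -/
def actPair (q : Dual D H) : H ⊗[D] H →ₗ[D] Dual D H :=
  LinearMap.applyₗ q ∘ₗ (actA D H).toLinearMap ∘ₗ
    TensorProduct.map .id ((MulOpposite.opLinearEquiv D).toLinearMap ∘ₗ antipodeInv hS)

lemma actPair_tmul (q : Dual D H) (a c : H) :
    actPair hS q (a ⊗ₜ c) = actA D H (a ⊗ₜ MulOpposite.op (antipodeInv hS c)) q := rfl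

@[simp] lemma actPair_tmul_apply (q : Dual D H) (a c z : H) :
    actPair hS q (a ⊗ₜ c) z = q (antipodeInv hS c * z * a) := by
  simp [actPair_tmul]

lemma act₃_eq (a b c : H) (q : Dual D H) (y : H) : act₃ hS (a ⊗ₜ (b ⊗ₜ c)) (q ⊗ₜ y) =
    actPair hS q (a ⊗ₜ c) ⊗ₜ (b * y) := rfl

/-- Auxiliary multilinear map for the proof of associativity. -/
def hexG (q r : Dual D H) (y : H) :
    (H ⊗[D] H) ⊗[D] (H ⊗[D] (H ⊗[D] H)) →ₗ[D] Dual D H ⊗[D] H :=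
  (TensorProduct.comm D H (Dual D H)).toLinearMap ∘ₗ
  TensorProduct.map (LinearMap.mulRight D y)
    (TensorProduct.lift (convL D H) ∘ₗ TensorProduct.map (actPair hS q) (actPair hS r) ∘ₗ
      (TensorProduct.tensorTensorTensorComm D H H H H).toLinearMap ∘ₗ
      (TensorProduct.comm D H H).toLinearMap.lTensor _) ∘ₗ
  (TensorProduct.leftComm D (H ⊗[D] H) H (H ⊗[D] H)).toLinearMap

@[simp] lemma hexG_tmul (q r : Dual D H) (y a₁ a₂ b c₁ c₂ : H) :
    hexG hS q r y ((a₁ ⊗ₜ a₂) ⊗ₜ (b ⊗ₜ (c₁ ⊗ₜ c₂))) =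
      convL D H (actPair hS q (a₁ ⊗ₜ c₂)) (actPair hS r (a₂ ⊗ₜ c₁)) ⊗ₜ (b * y) := rfl

lemma act_convL (q r : Dual D H) (a c : H) :
    actPair hS (convL D H q r) (a ⊗ₜ c) =
    (TensorProduct.lift (convL D H) ∘ₗ TensorProduct.map (actPair hS q) (actPair hS r) ∘ₗ
      (TensorProduct.tensorTensorTensorComm D H H H H).toLinearMap ∘ₗ
      (TensorProduct.comm D H H).toLinearMap.lTensor _) (comul a ⊗ₜ comul c) := by
  ext z
  rw [actPair_tmul_apply, convL_apply, comul_mul, comul_mul, comul_antipodeInv]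
  induction comul (R := D) a with
  | zero => simp
  | add a b ha hb => simp only [add_tmul, mul_add, map_add, ha, hb, LinearMap.add_apply]
  | tmul a₁ a₂ =>
  induction comul (R := D) c with
  | zero => simp
  | add a b ha hb => simp only [tmul_add, add_mul, map_add, ha, hb, LinearMap.add_apply]
  | tmul c₁ c₂ =>
  simp only [LinearMap.comp_apply, LinearMap.lTensor_tmul, LinearEquiv.coe_coe, comm_tmul,
    tensorTensorTensorComm_tmul, map_tmul, lift.tmul, convL_apply]
  induction comul (R := D) z with
  | zero => simp
  | add a b ha hb => simp only [mul_add, add_mul, map_add, ha, hb, LinearMap.add_apply]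
  | tmul z₁ z₂ => simp

lemma hex_left (q r : Dual D H) (y : H) (t : H ⊗[D] (H ⊗[D] H)) :
    act₃ hS t (lmulL D H q (r ⊗ₜ y)) =
      hexG hS q r y (TensorProduct.map comul (comul.lTensor H) t) := by
  induction t with
  | zero => simp
  | add a b ha hb => simp only [map_add, ha, hb, LinearMap.add_apply]
  | tmul a t =>
  induction t with
  | zero => simp
  | add a b ha hb => simp only [tmul_add, map_add, ha, hb, LinearMap.add_apply]
  | tmul b c =>
  rw [lmulL_tmul, act₃_eq, act_convL]
  rfl

lemma hex_right (q r : Dual D H) (y : H) (t : H ⊗[D] (H ⊗[D] H)) :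
    mulL hS (act₃ hS t (q ⊗ₜ 1)) (r ⊗ₜ y) =
      hexG hS q r y ((TensorProduct.assoc D H H (H ⊗[D] (H ⊗[D] H))).symm
    (((TensorProduct.assoc D H H (H ⊗[D] H)).toLinearMap ∘ₗ
     (TensorProduct.assoc D (H ⊗[D] H) H H).toLinearMap ∘ₗ
     (TensorProduct.assoc D H H H).symm.toLinearMap.rTensor H).lTensor H
    (((comul.lTensor H).rTensor H ∘ₗ comul.rTensor H).lTensor H t))) := by
  induction t with
  | zero => simp
  | add a b ha hb => simp only [map_add, ha, hb, LinearMap.add_apply]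
  | tmul a t =>
  induction t with
  | zero => simp
  | add a b ha hb => simp only [tmul_add, map_add, ha, hb, LinearMap.add_apply]
  | tmul b c =>
  rw [act₃_eq, mul_one, mulL_tmul]
  change lmulL D H _ (act₃ hS (comul.lTensor H (comul b)) _) =
    hexG hS q r y ((TensorProduct.assoc D H H (H ⊗[D] (H ⊗[D] H))).symm
    (((TensorProduct.assoc D H H (H ⊗[D] H)).toLinearMap ∘ₗ
     (TensorProduct.assoc D (H ⊗[D] H) H H).toLinearMap ∘ₗ
     (TensorProduct.assoc D H H H).symm.toLinearMap.rTensor H).lTensor H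
     (a ⊗ₜ ((comul.lTensor H (comul b)) ⊗ₜ c))))
  induction comul.lTensor H (comul (R := D) b) with
  | zero => simp
  | add a b ha hb => simp only [tmul_add, add_tmul, map_add, ha, hb, LinearMap.add_apply]
  | tmul a' t =>
  induction t with
  | zero => simp
  | add a b ha hb => simp only [tmul_add, add_tmul, map_add, ha, hb, LinearMap.add_apply]
  | tmul b' c' => rfl

lemma lmulR_lmulL (w : H) (q : Dual D H) (u : Dual D H ⊗[D] H) :
    lmulR hS w (lmulL D H q u) = mulL hS (lmulR hS w (q ⊗ₜ 1)) u := by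
  induction u with
  | zero => simp
  | add a b ha hb => simp only [map_add, ha, hb]
  | tmul r y =>
  change act₃ hS (comul.lTensor H (comul w)) _ = mulL hS (act₃ hS (comul.lTensor H (comul w)) _) _
  rw [hex_left, hex_right]
  exact congrArg _ (LinearMap.congr_fun act_hexagon_lin w)

lemma mulL_lmulR (x : H) (u v : Dual D H ⊗[D] H) :
    mulL hS (lmulR hS x u) v = lmulR hS x (mulL hS u v) := by
  induction u with
  | zero => simp
  | add a b ha hb => simp only [map_add, ha, hb, LinearMap.add_apply]
  | tmul q y =>
  have : q ⊗ₜ[D] y = (LinearMap.mulRight D y).lTensor _ (q ⊗ₜ 1) := by simp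
  rw [mulL_tmul, lmulR_lmulL, ← mulL_mulRight, this, lmulR_rmul]

lemma mulL_assoc (u v w : Dual D H ⊗[D] H) :
    mulL hS (mulL hS u v) w = mulL hS u (mulL hS v w) := by
  induction u with
  | zero => simp
  | add a b ha hb => simp only [map_add, ha, hb, LinearMap.add_apply]
  | tmul p x => rw [mulL_tmul, mulL_lmulL, mulL_lmulR, mulL_tmul]

lemma one_mulL (u : Dual D H ⊗[D] H) : mulL hS (counit ⊗ₜ 1) u = u := by
  rw [mulL_tmul, map_one]
  induction u with
  | zero => simp
  | add a b ha hb => simp only [map_add, ha, hb]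
  | tmul p x => simp [counit_convL]

lemma actPair_counit (t : H ⊗[D] (H ⊗[D] H)) :
    act₃ hS t (counit ⊗ₜ 1) = counit ⊗ₜ (TensorProduct.lid D H (counit.rTensor H
      ((TensorProduct.rid D H).toLinearMap.lTensor H ((counit.lTensor H).lTensor H t)))) := by
  have hc : ∀ c : H, counit (R := D) (antipodeInv hS c) = counit c := fun c => by
    conv_rhs => rw [← antipode_antipodeInv hS c, counit_antipode]
  induction t with
  | zero => simp
  | add a b ha hb => simp only [tmul_add, map_add, ha, hb, LinearMap.add_apply]
  | tmul a t =>
  induction t with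
  | zero => simp
  | add a b ha hb => simp only [tmul_add, map_add, ha, hb, LinearMap.add_apply]
  | tmul b c =>
  have : actPair hS (counit (R := D) (A := H)) (a ⊗ₜ c) = (counit a * counit c : D) • counit := by
    ext z; simp [hc]; ring
  rw [act₃_eq, this]
  simp [smul_smul, TensorProduct.smul_tmul, mul_comm]

lemma lmulR_one (x : H) : lmulR hS x (counit ⊗ₜ 1) = counit ⊗ₜ x := by
  change act₃ hS (comul.lTensor H (comul x)) _ = _
  have : ∀ t : H ⊗[D] H, (TensorProduct.rid D H).toLinearMap.lTensor H
          ((counit.lTensor H).lTensor H (comul.lTensor H t)) = t := by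
    intro t
    have : (TensorProduct.rid D H).toLinearMap ∘ₗ counit.lTensor H ∘ₗ comul = .id := by
      ext; simp
    rw [← LinearMap.comp_apply, ← LinearMap.comp_apply, ← LinearMap.lTensor_comp,
      ← LinearMap.lTensor_comp, LinearMap.comp_assoc, this, LinearMap.lTensor_id,
      LinearMap.id_apply]
  rw [actPair_counit, this]
  simp

lemma mulL_one (u : Dual D H ⊗[D] H) : mulL hS u (counit ⊗ₜ 1) = u := by
  induction u with
  | zero => simp
  | add a b ha hb => simp only [map_add, ha, hb, LinearMap.add_apply]
  | tmul p x => simp [lmulR_one, convL_counit]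

variable [Module.Finite D H] [Module.Projective D H]

lemma dualTensor_ext {M : Type*} [AddCommGroup M] [Module D M] {w w' : Dual D H ⊗[D] M}
    (h : ∀ s, dualTensorHom D H M w s = dualTensorHom D H M w' s) : w = w' :=
  (dualTensorHom_bijective (R := D) (M := H) (N := M)).1 (LinearMap.ext h)

variable (D H) in
/-- The opposite of the coproduct of `H*`: `q ↦ ∑ q₁ ⊗ q₂` with `∑ q₁(s) q₂(t) = q(t s)`
(see `dualTensorHom_dualComul`). -/
def dualComul : Dual D H →ₗ[D] Dual D H ⊗[D] Dual D H :=
  (dualTensorHomEquiv D H (Dual D H)).symm.toLinearMap ∘ₗ (lactHom D H).toLinearMap.flip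

lemma dualTensorHom_dualComul (q : Dual D H) (s : H) :
    dualTensorHom D H (Dual D H) (dualComul D H q) s = lactHom D H s q := by
  have := (dualTensorHomEquiv D H (Dual D H)).apply_symm_apply ((lactHom D H).toLinearMap.flip q)
  exact LinearMap.congr_fun this s

variable (D H) in
/-- The coalgebra `H*` with the opposite coproduct; its counit is evaluation at `1`. -/
@[reducible] def dualCopCoalgebra : Coalgebra D (Dual D H) where
  comul := dualComul D H
  counit := Module.Dual.eval D H 1
  coassoc := by
    ext1 q
    refine dualTensor_ext (M := Dual D H ⊗[D] Dual D H) fun s => ?_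
    refine dualTensor_ext (M := Dual D H) fun t => ?_
    have h1 : ∀ w : Dual D H ⊗[D] Dual D H, dualTensorHom D H _ ((dualComul D H).lTensor _ w) s =
        dualComul D H (dualTensorHom D H _ w s) := by
      intro w
      induction w with
      | zero => simp
      | add a b ha hb => simp only [map_add, ha, hb, LinearMap.add_apply]
      | tmul a b => simp
    have h3 : ∀ (b : Dual D H) (w : Dual D H ⊗[D] Dual D H), dualTensorHom D H _
        (dualTensorHom D H _ (TensorProduct.assoc D _ _ _ (w ⊗ₜ[D] b)) s) t =
          dualTensorHom D H _ w s t • b := by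
      intro b w
      induction w with
      | zero => simp
      | add a b ha hb => simp only [map_add, ha, hb, LinearMap.add_apply, add_tmul, add_smul]
      | tmul a b => simp [mul_smul]
    have h2 : ∀ w : Dual D H ⊗[D] Dual D H, dualTensorHom D H _ (dualTensorHom D H _
        (TensorProduct.assoc D _ _ _ ((dualComul D H).rTensor _ w)) s) t =
        dualTensorHom D H _ w (t * s) := by
      intro w
      induction w with
      | zero => simp
      | add a b ha hb => simp only [map_add, ha, hb, LinearMap.add_apply]
      | tmul a b => simp [h3, dualTensorHom_dualComul]
    simp only [LinearMap.comp_apply, LinearEquiv.coe_coe, h1, h2, dualTensorHom_dualComul]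
    simp
  rTensor_counit_comp_comul := by
    ext1 q
    have : ∀ w : Dual D H ⊗[D] Dual D H, (Module.Dual.eval D H 1).rTensor _ w =
      (1 : D) ⊗ₜ[D] dualTensorHom D H _ w 1 := by
      intro w
      induction w with
      | zero => simp
      | add a b ha hb => simp only [map_add, ha, hb, LinearMap.add_apply, tmul_add]
      | tmul a b => simp [TensorProduct.smul_tmul']
    simp [this, dualTensorHom_dualComul]
  lTensor_counit_comp_comul := by
    ext1 q
    refine dualTensor_ext fun s => ?_
    have : ∀ w : Dual D H ⊗[D] Dual D H, dualTensorHom D H _ ((Module.Dual.eval D H 1).lTensor _ w) s =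
        dualTensorHom D H _ w s 1 := by
      intro w
      induction w with
      | zero => simp
      | add a b ha hb => simp only [map_add, ha, hb, LinearMap.add_apply, tmul_add]
      | tmul a b => simp
    simp [this, dualTensorHom_dualComul]

attribute [local instance] dualCopCoalgebra

lemma dual_comul (q : Dual D H) : comul (R := D) q = dualComul D H q := rfl
lemma dual_counit (q : Dual D H) : counit (R := D) q = q 1 := rfl

lemma lift_convL_apply (A : Dual D H ⊗[D] Dual D H) (s : H) :
    TensorProduct.lift (convL D H) A s = TensorProduct.dualDistrib D H H A (comul s) := by
  induction A with
  | zero => simp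
  | add a b ha hb => simp only [map_add, ha, hb, LinearMap.add_apply]
  | tmul a b => rfl

lemma dualComul_convL (p q : Dual D H) :
    dualComul D H (convL D H p q) =
      TensorProduct.map₂ (convL D H) (convL D H) (dualComul D H p) (dualComul D H q) := by
  refine dualTensor_ext fun s => LinearMap.ext fun t => ?_
  rw [dualTensorHom_dualComul, lactHom_apply, convL_apply, comul_mul]
  have h1 : ∀ P Q : Dual D H ⊗[D] Dual D H,
    dualTensorHom D H _ (TensorProduct.map₂ (convL D H) (convL D H) P Q) s t =
      LinearMap.mul' D D (TensorProduct.map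
        (LinearMap.applyₗ (comul s) ∘ₗ TensorProduct.dualDistrib D H H)
        (LinearMap.applyₗ (comul t) ∘ₗ TensorProduct.dualDistrib D H H)
        (TensorProduct.tensorTensorTensorComm D _ _ _ _ (P ⊗ₜ Q))) := by
    intro P Q
    induction P with
    | zero => simp
    | add a b ha hb => simp only [map_add, ha, hb, LinearMap.add_apply, add_tmul]
    | tmul a b =>
    induction Q with
    | zero => simp
    | add a b ha hb => simp only [map_add, ha, hb, LinearMap.add_apply, tmul_add]
    | tmul c d => simp [convL_apply]
  have h2 : ∀ σ τ : H ⊗[D] H, TensorProduct.dualDistrib D H H (p ⊗ₜ q) (τ * σ) =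
      LinearMap.mul' D D (TensorProduct.map
        (LinearMap.applyₗ σ ∘ₗ TensorProduct.dualDistrib D H H)
        (LinearMap.applyₗ τ ∘ₗ TensorProduct.dualDistrib D H H)
        (TensorProduct.tensorTensorTensorComm D _ _ _ _
          (dualComul D H p ⊗ₜ dualComul D H q))) := by
    intro σ τ
    induction σ with
    | zero => simp
    | add a b ha hb => simp only [map_add, ha, hb, LinearMap.add_apply, mul_add, LinearMap.add_comp, TensorProduct.map_add_left]
    | tmul s₁ s₂ =>
    induction τ with
    | zero => simp
    | add a b ha hb => simp only [map_add, ha, hb, LinearMap.add_apply, add_mul, LinearMap.add_comp, TensorProduct.map_add_right]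
    | tmul t₁ t₂ =>
    have : ∀ P Q : Dual D H ⊗[D] Dual D H,
      LinearMap.mul' D D (TensorProduct.map
        (LinearMap.applyₗ (s₁ ⊗ₜ s₂) ∘ₗ TensorProduct.dualDistrib D H H)
        (LinearMap.applyₗ (t₁ ⊗ₜ t₂) ∘ₗ TensorProduct.dualDistrib D H H)
        (TensorProduct.tensorTensorTensorComm D _ _ _ _ (P ⊗ₜ Q))) =
        dualTensorHom D H _ P s₁ t₁ * dualTensorHom D H _ Q s₂ t₂ := by
      intro P Q
      induction P with
      | zero => simp
      | add a b ha hb => simp only [map_add, ha, hb, LinearMap.add_apply, add_tmul, add_mul]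
      | tmul a b =>
      induction Q with
      | zero => simp
      | add a b ha hb => simp only [map_add, ha, hb, LinearMap.add_apply, tmul_add, mul_add]
      | tmul c d => simp; ring
    rw [this]
    simp [dualTensorHom_dualComul]
  rw [h1, h2]

lemma comul_tmul' (q : Dual D H) (y : H) : comul (R := D) (q ⊗ₜ[D] y) =
    TensorProduct.tensorTensorTensorComm D _ _ _ _ (dualComul D H q ⊗ₜ comul y) := rfl

lemma comul_lmulL (p : Dual D H) (v : Dual D H ⊗[D] H) :
    comul (R := D) (lmulL D H p v) =
      TensorProduct.map₂ (lmulL D H) (lmulL D H) (dualComul D H p) (comul (R := D) v) := by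
  induction v with
  | zero => simp
  | add a b ha hb => simp only [map_add, ha, hb]
  | tmul q y =>
  rw [lmulL_tmul, comul_tmul', comul_tmul', dualComul_convL]
  induction dualComul D H p with
  | zero => simp
  | add a b ha hb => simp only [map_add, ha, hb, LinearMap.add_apply, add_tmul]
  | tmul p₁ p₂ =>
  induction dualComul D H q with
  | zero => simp
  | add a b ha hb => simp only [map_add, ha, hb, add_tmul]
  | tmul q₁ q₂ =>
  induction comul (R := D) y with
  | zero => simp
  | add a b ha hb => simp only [map_add, ha, hb, tmul_add]
  | tmul y₁ y₂ => simp

variable (hS : Function.Bijective (antipode D : H →ₗ[D] H))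

lemma dualComul_act (q : Dual D H) (a c : H) :
    dualComul D H (actPair hS q (a ⊗ₜ c)) =
      TensorProduct.map (lactHom D H a) (actA D H (1 ⊗ₜ MulOpposite.op (antipodeInv hS c)))
        (dualComul D H q) := by
  refine dualTensor_ext fun s => LinearMap.ext fun t => ?_
  have h1 : ∀ Q : Dual D H ⊗[D] Dual D H, dualTensorHom D H _ (
      TensorProduct.map (lactHom D H a) (actA D H (1 ⊗ₜ MulOpposite.op (antipodeInv hS c))) Q) s t =
      dualTensorHom D H _ Q (s * a) (antipodeInv hS c * t) := by
    intro Q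
    induction Q with
    | zero => simp
    | add a b ha hb => simp only [map_add, ha, hb, LinearMap.add_apply]
    | tmul c d => simp
  rw [h1]
  simp [dualTensorHom_dualComul, mul_assoc]

lemma map_act_dualComul (q : Dual D H) (a₁ c₁ a₂ c₂ : H) :
    TensorProduct.map (actA D H (a₁ ⊗ₜ MulOpposite.op (antipodeInv hS c₁)))
      (actA D H (a₂ ⊗ₜ MulOpposite.op (antipodeInv hS c₂))) (dualComul D H q) =
    TensorProduct.map (lactHom D H a₁)
      (actA D H ((a₂ * antipodeInv hS c₁) ⊗ₜ MulOpposite.op (antipodeInv hS c₂)))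
        (dualComul D H q) := by
  refine dualTensor_ext fun s => LinearMap.ext fun t => ?_
  have h1 : ∀ (a c a' c' : H) (Q : Dual D H ⊗[D] Dual D H), dualTensorHom D H _ (
      TensorProduct.map (actA D H (a ⊗ₜ MulOpposite.op c))
        (actA D H (a' ⊗ₜ MulOpposite.op c')) Q) s t =
      dualTensorHom D H _ Q (c * s * a) (c' * t * a') := by
    intro a c a' c' Q
    induction Q with
    | zero => simp
    | add a b ha hb => simp only [map_add, ha, hb, LinearMap.add_apply]
    | tmul c d => simp
  have h2 : lactHom D H a₁ = actA D H (a₁ ⊗ₜ MulOpposite.op 1) := by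
    ext; simp
  rw [h2, h1, h1]
  simp [dualTensorHom_dualComul, mul_assoc]

/-- Auxiliary multilinear map for the multiplicativity of the coproduct. -/
def cmpG (q : Dual D H) (y : H) : H ⊗[D] (H ⊗[D] (H ⊗[D] (H ⊗[D] H))) →ₗ[D]
    (Dual D H ⊗[D] H) ⊗[D] (Dual D H ⊗[D] H) :=
  (TensorProduct.tensorTensorTensorComm D _ _ _ _).toLinearMap ∘ₗ
  (TensorProduct.comm D _ _).toLinearMap ∘ₗ
  TensorProduct.map (LinearMap.mulRight D (comul y))
    (LinearMap.applyₗ (dualComul D H q) ∘ₗ TensorProduct.homTensorHomMap (.id D) _ _ _ _ ∘ₗ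
      TensorProduct.map (lactHom D H).toLinearMap ((actA D H).toLinearMap ∘ₗ
        TensorProduct.map .id ((MulOpposite.opLinearEquiv D).toLinearMap ∘ₗ antipodeInv hS))) ∘ₗ
  (TensorProduct.leftComm D H (H ⊗[D] H) (H ⊗[D] H)).toLinearMap ∘ₗ
  ((TensorProduct.assoc D H H (H ⊗[D] H)).symm.toLinearMap ∘ₗ
    (TensorProduct.leftComm D H H H).toLinearMap.lTensor H).lTensor H

lemma cmpG_tmul (q : Dual D H) (y a₁ b₁ m b₂ c : H) :
    cmpG hS q y (a₁ ⊗ₜ (b₁ ⊗ₜ (m ⊗ₜ (b₂ ⊗ₜ c)))) =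
    TensorProduct.tensorTensorTensorComm D _ _ _ _
      ((TensorProduct.map (lactHom D H a₁) (actA D H (m ⊗ₜ MulOpposite.op (antipodeInv hS c)))
        (dualComul D H q)) ⊗ₜ ((b₁ ⊗ₜ b₂) * comul y)) := rfl

lemma cmp_left (q : Dual D H) (y : H) (t : H ⊗[D] (H ⊗[D] H)) :
    comul (R := D) (act₃ hS t (q ⊗ₜ[D] y)) = cmpG hS q y
      (((TensorProduct.mk D H (H ⊗[D] H) 1).lTensor H).lTensor H
      ((TensorProduct.assoc D H H H).toLinearMap.lTensor H ((comul.rTensor H).lTensor H t))) := by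
  induction t with
  | zero => simp
  | add a b ha hb => simp only [map_add, ha, hb, LinearMap.add_apply]
  | tmul a t =>
  induction t with
  | zero => simp
  | add a b ha hb => simp only [tmul_add, map_add, ha, hb, LinearMap.add_apply]
  | tmul b c =>
  rw [act₃_eq, comul_tmul', dualComul_act, comul_mul]
  simp only [LinearMap.lTensor_tmul, LinearMap.rTensor_tmul]
  induction comul (R := D) b with
  | zero => simp
  | add a b ha hb => simp only [tmul_add, add_tmul, add_mul, map_add, ha, hb]
  | tmul b₁ b₂ => exact (cmpG_tmul hS q y a b₁ 1 b₂ c).symm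

/-- `c ⊗ a ↦ a S⁻¹(c)`. -/
def mulInv : H ⊗[D] H →ₗ[D] H :=
  LinearMap.mul' D H ∘ₗ (antipodeInv hS).lTensor H ∘ₗ (TensorProduct.comm D H H).toLinearMap

@[simp] lemma mulInv_tmul (c a : H) : mulInv hS (c ⊗ₜ a) = a * antipodeInv hS c := rfl

lemma mulInv_comul (x : H) : mulInv hS (comul x) = algebraMap D H (counit x) := by
  apply hS.1
  have : ∀ t : H ⊗[D] H, antipode D (mulInv hS t) =
      LinearMap.mul' D H ((antipode D).lTensor H t) := by
    intro t
    induction t with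
    | zero => simp
    | add a b ha hb => simp only [map_add, ha, hb]
    | tmul a b => simp [antipode_mul_antidistrib]
  rw [this]
  simp [Algebra.algebraMap_eq_smul_one]

lemma cmp_right (q : Dual D H) (y : H) (t t' : H ⊗[D] (H ⊗[D] H)) :
    TensorProduct.map (act₃ hS t) (act₃ hS t') (comul (R := D) (q ⊗ₜ[D] y)) = cmpG hS q y
      ((((mulInv hS).rTensor (H ⊗[D] H)).lTensor H).lTensor H
      (((TensorProduct.assoc D H H (H ⊗[D] H)).symm.toLinearMap.lTensor H).lTensor H
      ((TensorProduct.assoc D H H (H ⊗[D] (H ⊗[D] H))).toLinearMap.lTensor H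
      (TensorProduct.assoc D H (H ⊗[D] H) (H ⊗[D] (H ⊗[D] H)) (t ⊗ₜ t'))))) := by
  induction t with
  | zero => simp
  | add a b ha hb =>
    simp only [add_tmul, map_add, ha, hb, LinearMap.add_apply, TensorProduct.map_add_left]
  | tmul a₁ t =>
  induction t with
  | zero => simp
  | add a b ha hb =>
    simp only [add_tmul, tmul_add, map_add, ha, hb, LinearMap.add_apply, TensorProduct.map_add_left]
  | tmul b₁ c₁ =>
  induction t' with
  | zero => simp
  | add a b ha hb =>
    simp only [add_tmul, tmul_add, map_add, ha, hb, LinearMap.add_apply, TensorProduct.map_add_right]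
  | tmul a₂ t' =>
  induction t' with
  | zero => simp
  | add a b ha hb =>
    simp only [add_tmul, tmul_add, map_add, ha, hb, LinearMap.add_apply, TensorProduct.map_add_right]
  | tmul b₂ c₂ =>
  refine Eq.trans ?_ (cmpG_tmul hS q y a₁ b₁ (a₂ * antipodeInv hS c₁) b₂ c₂).symm
  rw [← map_act_dualComul, comul_tmul']
  induction dualComul D H q with
  | zero => simp
  | add a b ha hb => simp only [map_add, ha, hb, add_tmul]
  | tmul q₁ q₂ =>
  induction comul (R := D) y with
  | zero => simp
  | add a b ha hb => simp only [map_add, ha, hb, tmul_add, mul_add]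
  | tmul y₁ y₂ => simp [act₃_tmul]

lemma cmp_lin :
    ((TensorProduct.assoc D H H (H ⊗[D] H)).symm.toLinearMap.lTensor H).lTensor H ∘ₗ
    (TensorProduct.assoc D H H (H ⊗[D] (H ⊗[D] H))).toLinearMap.lTensor H ∘ₗ
    (TensorProduct.assoc D H (H ⊗[D] H) (H ⊗[D] (H ⊗[D] H))).toLinearMap ∘ₗ
    TensorProduct.map (comul.lTensor H ∘ₗ comul) (comul.lTensor H ∘ₗ comul) ∘ₗ
      comul (R := D) (A := H) =
    ((comul.rTensor _).lTensor H).lTensor H ∘ₗ ((comul.lTensor H).lTensor H).lTensor H ∘ₗ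
    (comul.lTensor H).lTensor H ∘ₗ comul.lTensor H ∘ₗ comul (R := D) (A := H) := by
  simp only [coassoc_simps]

lemma cmp_lin' :
    (TensorProduct.assoc D H H H).toLinearMap.lTensor H ∘ₗ (comul.rTensor H).lTensor H ∘ₗ
      comul.lTensor H ∘ₗ comul (R := D) (A := H) =
    (comul.lTensor H).lTensor H ∘ₗ comul.lTensor H ∘ₗ comul (R := D) (A := H) := by
  simp only [coassoc_simps]

lemma mulInv_collapse : (mulInv hS).rTensor (H ⊗[D] H) ∘ₗ comul.rTensor _ ∘ₗ
    comul.lTensor H ∘ₗ comul (R := D) (A := H) = TensorProduct.mk D H (H ⊗[D] H) 1 ∘ₗ comul := by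
  have : mulInv hS ∘ₗ comul = Algebra.linearMap D H ∘ₗ counit := by
    ext x; simp [mulInv_comul]
  rw [← LinearMap.comp_assoc, ← LinearMap.rTensor_comp, this]
  have h2 : (Algebra.linearMap D H ∘ₗ counit).rTensor (H ⊗[D] H) ∘ₗ comul.lTensor H =
    (Algebra.linearMap D H).rTensor (H ⊗[D] H) ∘ₗ comul.lTensor D ∘ₗ counit.rTensor H := by
    ext; simp
  rw [← LinearMap.comp_assoc, h2]
  simp only [LinearMap.comp_assoc, rTensor_counit_comp_comul]
  ext x
  simp

lemma comul_lmulR (x : H) (v : Dual D H ⊗[D] H) :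
    comul (R := D) (lmulR hS x v) =
      TensorProduct.map₂ (lmulR hS).toLinearMap (lmulR hS).toLinearMap (comul x)
        (comul (R := D) v) := by
  induction v with
  | zero => simp
  | add a b ha hb => simp only [map_add, ha, hb]
  | tmul q y =>
  have h1 : ∀ t : H ⊗[D] H, TensorProduct.map₂ (lmulR hS).toLinearMap (lmulR hS).toLinearMap t
        (comul (R := D) (q ⊗ₜ[D] y)) = cmpG hS q y
      ((((mulInv hS).rTensor (H ⊗[D] H)).lTensor H).lTensor H
      (((TensorProduct.assoc D H H (H ⊗[D] H)).symm.toLinearMap.lTensor H).lTensor H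
      ((TensorProduct.assoc D H H (H ⊗[D] (H ⊗[D] H))).toLinearMap.lTensor H
      (TensorProduct.assoc D H (H ⊗[D] H) (H ⊗[D] (H ⊗[D] H))
      (TensorProduct.map (comul.lTensor H ∘ₗ comul) (comul.lTensor H ∘ₗ comul) t))))) := by
    intro t
    induction t with
    | zero => simp
    | add a b ha hb => simp only [map_add, ha, hb, LinearMap.add_apply]
    | tmul a b => exact cmp_right hS q y _ _
  rw [h1]
  change comul (R := D) (act₃ hS (comul.lTensor H (comul x)) (q ⊗ₜ[D] y)) = _
  rw [cmp_left]
  refine congrArg _ ?_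
  have h2 := LinearMap.congr_fun (cmp_lin (D := D) (H := H)) x
  have h3 := LinearMap.congr_fun (cmp_lin' (D := D) (H := H)) x
  simp only [LinearMap.comp_apply, LinearEquiv.coe_coe] at h2 h3
  rw [h2, h3]
  have h4 := congrArg (fun f => LinearMap.lTensor H (LinearMap.lTensor H f)) (mulInv_collapse hS)
  simp only [LinearMap.lTensor_comp] at h4
  exact (LinearMap.congr_fun h4 (comul.lTensor H (comul x))).symm

lemma comul_mulL (u v : Dual D H ⊗[D] H) :
    comul (R := D) (mulL hS u v) =
      TensorProduct.map₂ (mulL hS) (mulL hS) (comul (R := D) u) (comul (R := D) v) := by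
  induction u with
  | zero => simp
  | add a b ha hb => simp only [map_add, ha, hb, LinearMap.add_apply]
  | tmul p x =>
  rw [mulL_tmul, comul_lmulL, comul_lmulR, comul_tmul']
  induction dualComul D H p with
  | zero => simp
  | add a b ha hb => simp only [map_add, ha, hb, LinearMap.add_apply, add_tmul]
  | tmul p₁ p₂ =>
  induction comul (R := D) x with
  | zero => simp
  | add a b ha hb => simp only [map_add, ha, hb, LinearMap.add_apply, tmul_add]
  | tmul x₁ x₂ =>
  induction comul (R := D) v with
  | zero => simp
  | add a b ha hb => simp only [map_add, ha, hb]
  | tmul v₁ v₂ => simp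

lemma counit_tmul' (p : Dual D H) (x : H) :
    counit (R := D) (p ⊗ₜ[D] x) = p 1 * counit x := by
  simp [mul_comm, dual_counit]

lemma counit_lmulL (p : Dual D H) (v : Dual D H ⊗[D] H) :
    counit (R := D) (lmulL D H p v) = p 1 * counit (R := D) v := by
  induction v with
  | zero => simp
  | add a b ha hb => simp only [map_add, ha, hb, mul_add]
  | tmul q y =>
    rw [lmulL_tmul, counit_tmul', counit_tmul', convL_apply]
    simp [Algebra.TensorProduct.one_def, mul_assoc]

lemma counit_collapse (t : H ⊗[D] H) : (TensorProduct.lid D H).toLinearMap.lTensor H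
    ((counit.rTensor H).lTensor H (comul.lTensor H t)) = t := by
  have : (TensorProduct.lid D H).toLinearMap ∘ₗ counit.rTensor H ∘ₗ comul = .id := by
    ext; simp
  rw [← LinearMap.comp_apply, ← LinearMap.comp_apply, ← LinearMap.lTensor_comp,
    ← LinearMap.lTensor_comp, LinearMap.comp_assoc, this, LinearMap.lTensor_id,
    LinearMap.id_apply]

/-- `a ⊗ c ↦ S⁻¹(c) a`. -/
def mulInv' : H ⊗[D] H →ₗ[D] H :=
  LinearMap.mul' D H ∘ₗ (antipodeInv hS).rTensor H ∘ₗ (TensorProduct.comm D H H).toLinearMap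

@[simp] lemma mulInv'_tmul (a c : H) : mulInv' hS (a ⊗ₜ c) = antipodeInv hS c * a := rfl

lemma mulInv'_comul (x : H) : mulInv' hS (comul x) = algebraMap D H (counit x) := by
  apply hS.1
  have : ∀ t : H ⊗[D] H, antipode D (mulInv' hS t) =
      LinearMap.mul' D H ((antipode D).rTensor H t) := by
    intro t
    induction t with
    | zero => simp
    | add a b ha hb => simp only [map_add, ha, hb]
    | tmul a b => simp [antipode_mul_antidistrib]
  rw [this]
  simp [Algebra.algebraMap_eq_smul_one]

lemma counit_lmulR (x : H) (v : Dual D H ⊗[D] H) :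
    counit (R := D) (lmulR hS x v) = counit x * counit (R := D) v := by
  induction v with
  | zero => simp
  | add a b ha hb => simp only [map_add, ha, hb, mul_add]
  | tmul q y =>
  have h1 : ∀ t, counit (R := D) (act₃ hS t (q ⊗ₜ[D] y)) =
      q (mulInv' hS ((TensorProduct.lid D H).toLinearMap.lTensor H
    ((counit.rTensor H).lTensor H t))) * counit (R := D) y := by
    intro t
    induction t with
    | zero => simp
    | add a b ha hb => simp only [map_add, ha, hb, LinearMap.add_apply, add_mul]
    | tmul a t =>
    induction t with
    | zero => simp
    | add a b ha hb => simp only [tmul_add, map_add, ha, hb, LinearMap.add_apply, add_mul]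
    | tmul b c =>
    rw [act₃_eq, counit_tmul']
    simp
    ring
  refine (h1 (comul.lTensor H (comul x))).trans ?_
  rw [counit_collapse, mulInv'_comul, counit_tmul']
  simp [Algebra.algebraMap_eq_smul_one, mul_assoc]

lemma counit_mulL (u v : Dual D H ⊗[D] H) :
    counit (R := D) (mulL hS u v) = counit (R := D) u * counit (R := D) v := by
  induction u with
  | zero => simp
  | add a b ha hb => simp only [map_add, ha, hb, LinearMap.add_apply, add_mul]
  | tmul p x => rw [mulL_tmul, counit_lmulL, counit_lmulR, counit_tmul', mul_assoc]

lemma comul_one' : comul (R := D) ((counit : Dual D H) ⊗ₜ[D] (1 : H)) =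
    (counit ⊗ₜ 1) ⊗ₜ (counit ⊗ₜ 1) := by
  have : dualComul D H counit = counit ⊗ₜ counit := by
    refine dualTensor_ext fun s => LinearMap.ext fun t => ?_
    rw [dualTensorHom_dualComul]
    simp [mul_comm]
  rw [comul_tmul', this]
  simp [Algebra.TensorProduct.one_def]

/-- The antipode of the double: `p ⊗ x ↦ (ε ⊗ S(x)) (p ∘ S⁻¹ ⊗ 1)`. -/
def antip : Dual D H ⊗[D] H →ₗ[D] Dual D H ⊗[D] H :=
  TensorProduct.lift ((lmulR hS).toLinearMap.flip ∘ₗ (TensorProduct.mk D (Dual D H) H).flip 1 ∘ₗ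
    (antipodeInv hS).dualMap).flip ∘ₗ (antipode D).rTensor _ ∘ₗ
      (TensorProduct.comm D (Dual D H) H).toLinearMap

lemma antip_tmul (p : Dual D H) (x : H) : antip hS (p ⊗ₜ x) =
    lmulR hS (antipode D x) ((p ∘ₗ antipodeInv hS) ⊗ₜ 1) := rfl

lemma convL_antipInv_left (p : Dual D H) :
    TensorProduct.lift (convL D H) ((antipodeInv hS).dualMap.rTensor _ (dualComul D H p)) =
      p 1 • counit := by
  ext z
  rw [lift_convL_apply]
  have h1 : ∀ w s t, TensorProduct.dualDistrib D H H ((antipodeInv hS).dualMap.rTensor _ w)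
      (s ⊗ₜ t) = dualTensorHom D H _ w (antipodeInv hS s) t := by
    intro w s t
    induction w with
    | zero => simp
    | add a b ha hb => simp only [map_add, ha, hb, LinearMap.add_apply]
    | tmul a b => simp
  have h2 : ∀ w, TensorProduct.dualDistrib D H H
      ((antipodeInv hS).dualMap.rTensor _ (dualComul D H p)) w = p (mulInv hS w) := by
    intro w
    induction w with
    | zero => simp
    | add a b ha hb => simp only [map_add, ha, hb]
    | tmul a b => rw [h1, dualTensorHom_dualComul]; simp
  rw [h2, mulInv_comul]
  simp [Algebra.algebraMap_eq_smul_one, mul_comm]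

lemma convL_antipInv_right (p : Dual D H) :
    TensorProduct.lift (convL D H) ((antipodeInv hS).dualMap.lTensor _ (dualComul D H p)) =
      p 1 • counit := by
  ext z
  rw [lift_convL_apply]
  have h1 : ∀ w s t, TensorProduct.dualDistrib D H H ((antipodeInv hS).dualMap.lTensor _ w)
      (s ⊗ₜ t) = dualTensorHom D H _ w s (antipodeInv hS t) := by
    intro w s t
    induction w with
    | zero => simp
    | add a b ha hb => simp only [map_add, ha, hb, LinearMap.add_apply]
    | tmul a b => simp
  have h2 : ∀ w, TensorProduct.dualDistrib D H H
      ((antipodeInv hS).dualMap.lTensor _ (dualComul D H p)) w = p (mulInv' hS w) := by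
    intro w
    induction w with
    | zero => simp
    | add a b ha hb => simp only [map_add, ha, hb]
    | tmul a b => rw [h1, dualTensorHom_dualComul]; simp
  rw [h2, mulInv'_comul]
  simp [Algebra.algebraMap_eq_smul_one, mul_comm]

lemma antip_left (u : Dual D H ⊗[D] H) :
    TensorProduct.lift (mulL hS) ((antip hS).rTensor _ (comul (R := D) u)) =
      counit (R := D) u • (counit ⊗ₜ 1) := by
  induction u with
  | zero => simp
  | add a b ha hb => simp only [map_add, ha, hb, add_smul]
  | tmul p x =>
  rw [comul_tmul', counit_tmul']
  have h1 : ∀ w : Dual D H ⊗[D] Dual D H, ∀ t : H ⊗[D] H, TensorProduct.lift (mulL hS) ((antip hS).rTensor _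
      (TensorProduct.tensorTensorTensorComm D _ _ _ _ (w ⊗ₜ t))) =
      TensorProduct.lift ((lmulR hS).toLinearMap.flip ∘ₗ
        TensorProduct.mk D _ _ (TensorProduct.lift (convL D H) ((antipodeInv hS).dualMap.rTensor _ w))).flip
          ((antipode D).rTensor _ t) := by
    intro w t
    induction t with
    | zero => simp
    | add a b ha hb => simp only [map_add, ha, hb, tmul_add]
    | tmul a b =>
    simp only [LinearMap.rTensor_tmul, lift.tmul, LinearMap.flip_apply, LinearMap.comp_apply,
      mk_apply, AlgHom.toLinearMap_apply]
    induction w with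
    | zero => simp
    | add a b ha hb => simp only [map_add, ha, hb, add_tmul]
    | tmul p₁ p₂ =>
      simp [antip_tmul, mulL_lmulR]
      rfl
  rw [h1, convL_antipInv_left]
  have h2 : ∀ t : H ⊗[D] H, TensorProduct.lift ((lmulR hS).toLinearMap.flip ∘ₗ
        TensorProduct.mk D _ _ (p 1 • counit)).flip t =
          p 1 • ((counit : Dual D H) ⊗ₜ LinearMap.mul' D H t) := by
    intro t
    induction t with
    | zero => simp
    | add a b ha hb => simp only [map_add, ha, hb, tmul_add, smul_add]
    | tmul a b =>
      have : (counit : Dual D H) ⊗ₜ[D] b = mulL hS (counit ⊗ₜ b) (counit ⊗ₜ 1) := by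
        rw [mulL_one]
      simp only [lift.tmul, LinearMap.flip_apply, LinearMap.comp_apply, map_smul, mk_apply,
        AlgHom.toLinearMap_apply, LinearMap.smul_apply, LinearMap.mul'_apply]
      rw [← lmulR_one hS b, ← Module.End.mul_apply, ← map_mul, lmulR_one]
  rw [h2]
  simp [Algebra.algebraMap_eq_smul_one, smul_smul]

lemma antip_right (u : Dual D H ⊗[D] H) :
    TensorProduct.lift (mulL hS) ((antip hS).lTensor _ (comul (R := D) u)) =
      counit (R := D) u • (counit ⊗ₜ 1) := by
  induction u with
  | zero => simp
  | add a b ha hb => simp only [map_add, ha, hb, add_smul]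
  | tmul p x =>
  rw [comul_tmul', counit_tmul']
  have h1 : ∀ w : Dual D H ⊗[D] Dual D H, ∀ t : H ⊗[D] H, TensorProduct.lift (mulL hS) ((antip hS).lTensor _
      (TensorProduct.tensorTensorTensorComm D _ _ _ _ (w ⊗ₜ t))) =
      TensorProduct.lift ((lmulL D H).compl₁₂ .id
        (lmulR hS (LinearMap.mul' D H ((antipode D).lTensor _ t)) ∘ₗ
          (TensorProduct.mk D (Dual D H) H).flip 1)) ((antipodeInv hS).dualMap.lTensor _ w) := by
    intro w t
    induction w with
    | zero => simp
    | add a b ha hb => simp only [map_add, ha, hb, add_tmul]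
    | tmul p₁ p₂ =>
    simp only [LinearMap.lTensor_tmul, lift.tmul, LinearMap.flip_apply, LinearMap.comp_apply,
      mk_apply, LinearMap.compl₁₂_apply, LinearMap.id_apply]
    induction t with
    | zero => simp
    | add a b ha hb => simp only [map_add, ha, hb, tmul_add, LinearMap.add_apply]
    | tmul a b =>
      simp [antip_tmul]
      rfl
  have h2 : ∀ w : Dual D H ⊗[D] Dual D H, TensorProduct.lift ((lmulL D H).compl₁₂ .id
        (lmulR hS (algebraMap D H (counit x)) ∘ₗ
          (TensorProduct.mk D (Dual D H) H).flip 1)) w =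
        counit (R := D) x • (TensorProduct.lift (convL D H) w ⊗ₜ 1) := by
    intro w
    induction w with
    | zero => simp
    | add a b ha hb => simp only [map_add, ha, hb, add_tmul, smul_add]
    | tmul p₁ p₂ => simp [Algebra.algebraMap_eq_smul_one]
  rw [h1, mul_antipode_lTensor_comul_apply, h2, convL_antipInv_right, ← smul_tmul', smul_smul,
    mul_comm]
end Aux
end
end DrinfeldDouble

noncomputable section

universe u v

section Double

variable (D : Type u) (H : Type v) [CommRing D] [Ring H] [HopfAlgebra D H]

/-- The quantum double `H* ⊗ H` of a Hopf algebra with bijective antipode. -/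
def DrinfeldDouble (_hS : Function.Bijective (antipode D : H →ₗ[D] H)) : Type (max u v) :=
  Module.Dual D H ⊗[D] H

namespace DrinfeldDouble

variable {D H}
variable (hS : Function.Bijective (antipode D : H →ₗ[D] H))

instance : AddCommGroup (DrinfeldDouble D H hS) :=
  inferInstanceAs (AddCommGroup (Module.Dual D H ⊗[D] H))

instance : Module D (DrinfeldDouble D H hS) :=
  inferInstanceAs (Module D (Module.Dual D H ⊗[D] H))

/-- The product is `(p ⊗ x)(q ⊗ y) = ∑ p * (x' ⇀ q ↼ S⁻¹(x''')) ⊗ x'' y`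
(see `mk_mul_mk` below), with unit `ε ⊗ 1`. -/
instance : Ring (DrinfeldDouble D H hS) where
  __ : AddCommGroup (DrinfeldDouble D H hS) := inferInstance
  mul u v := mulL hS u v
  one := (counit (R := D) (A := H)) ⊗ₜ[D] (1 : H)
  mul_assoc u v w := mulL_assoc hS u v w
  one_mul u := one_mulL hS u
  mul_one u := mulL_one hS u
  left_distrib u v w := (mulL hS u).map_add v w
  right_distrib u v w := LinearMap.congr_fun ((mulL hS).map_add u v) w
  zero_mul u := LinearMap.congr_fun (mulL hS).map_zero u
  mul_zero u := (mulL hS u).map_zero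

instance : Algebra D (DrinfeldDouble D H hS) :=
  Algebra.ofModule (fun r u v => LinearMap.congr_fun ((mulL hS).map_smul r u) v)
    (fun r u v => (mulL hS u).map_smul r v)

variable [Module.Finite D H] [Module.Projective D H]

/-- As a coalgebra the double is the tensor product of `H*`, with the opposite coproduct,
and `H`. -/
instance : Coalgebra D (DrinfeldDouble D H hS) :=
  letI := dualCopCoalgebra D H
  inferInstanceAs (Coalgebra D (Module.Dual D H ⊗[D] H))

instance : Bialgebra D (DrinfeldDouble D H hS) :=
  Bialgebra.mk' D (DrinfeldDouble D H hS)
    (by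
      let := dualCopCoalgebra D H
      exact (counit_tmul' (D := D) (counit : Module.Dual D H) 1).trans (by simp))
    (fun {u v} => counit_mulL hS u v)
    (comul_one' (D := D) (H := H))
    (fun {u v} => by
      refine (comul_mulL hS u v).trans ?_
      have : ∀ s t : DrinfeldDouble D H hS ⊗[D] DrinfeldDouble D H hS,
          s * t = TensorProduct.map₂ (mulL hS) (mulL hS) s t := by
        intro s t
        induction s with
        | zero => rw [zero_mul]; exact (LinearMap.congr_fun (map_zero (TensorProduct.map₂ (mulL hS) (mulL hS))) t).symm
        | add a b ha hb => rw [add_mul, ha, hb]; exact (LinearMap.congr_fun (map_add (TensorProduct.map₂ (mulL hS) (mulL hS)) a b) t).symm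
        | tmul a b =>
        induction t with
        | zero => rw [mul_zero]; exact (map_zero (TensorProduct.map₂ (mulL hS) (mulL hS) (a ⊗ₜ b))).symm
        | add c d hc hd => rw [mul_add, hc, hd]; exact (map_add (TensorProduct.map₂ (mulL hS) (mulL hS) (a ⊗ₜ b)) c d).symm
        | tmul c d =>
          exact Algebra.TensorProduct.tmul_mul_tmul (R := D) a c b d
      exact (this _ _).symm)

/-- The antipode is `p ⊗ x ↦ (ε ⊗ S(x)) (p ∘ S⁻¹ ⊗ 1)`. -/
instance : HopfAlgebra D (DrinfeldDouble D H hS) where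
  antipode := antip hS
  mul_antipode_rTensor_comul := LinearMap.ext fun u => by
    have h := antip_left hS u
    refine Eq.trans ?_ (h.trans (Algebra.algebraMap_eq_smul_one
      (A := DrinfeldDouble D H hS) (counit (R := D) u)).symm)
    rfl
  mul_antipode_lTensor_comul := LinearMap.ext fun u => by
    have h := antip_right hS u
    refine Eq.trans ?_ (h.trans (Algebra.algebraMap_eq_smul_one
      (A := DrinfeldDouble D H hS) (counit (R := D) u)).symm)
    rfl

end DrinfeldDouble
end Double

end

noncomputable section HopfAlgebraNotions

universe u v

variable {D : Type u} {A : Type v} [CommRing D] [Ring A] [HopfAlgebra D A]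

/-- `Λ` is a left cointegral: `x Λ = ε(x) Λ` for all `x`. -/
def IsLeftCointegral (D : Type u) {A : Type v} [CommRing D] [Ring A] [HopfAlgebra D A]
    (Λ : A) : Prop :=
  ∀ x : A, x * Λ = counit (R := D) x • Λ

/-- `Λ` is a right cointegral: `Λ x = ε(x) Λ` for all `x`. -/
def IsRightCointegral (D : Type u) {A : Type v} [CommRing D] [Ring A] [HopfAlgebra D A]
    (Λ : A) : Prop :=
  ∀ x : A, Λ * x = counit (R := D) x • Λ

/-- `lam` is a right integral: `lam f = f(1) lam` in the dual algebra, for all `f`. -/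
def IsRightIntegral (lam : Module.Dual D A) : Prop :=
  ∀ f : Module.Dual D A, DrinfeldDouble.convL D A lam f = f 1 • lam

/-- `f ⇀ a = ∑ f(a'') a'`. -/
def leftHit (f : Module.Dual D A) : A →ₗ[D] A :=
  (TensorProduct.rid D A).toLinearMap ∘ₗ f.lTensor A ∘ₗ comul

/-- `a ↼ f = ∑ f(a') a''`. -/
def rightHit (f : Module.Dual D A) : A →ₗ[D] A :=
  (TensorProduct.lid D A).toLinearMap ∘ₗ f.rTensor A ∘ₗ comul

/-- `α`, a group-like element of the dual (that is, an algebra map to the ground ring), is the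
modulus of the left cointegrals: `Λ x = α(x) Λ`. -/
def IsCointegralModulus (α : A →ₐ[D] D) : Prop :=
  ∀ Λ : A, IsLeftCointegral D Λ → ∀ x : A, Λ * x = α x • Λ

/-- The group-like element `g` is the modulus of the right integrals: `f lam = f(g) lam`. -/
def IsIntegralModulus (D : Type u) {A : Type v} [CommRing D] [Ring A] [HopfAlgebra D A]
    (g : A) : Prop :=
  IsGroupLikeElem D g ∧ ∀ lam : Module.Dual D A, IsRightIntegral lam →
    ∀ f : Module.Dual D A, DrinfeldDouble.convL D A f lam = f g • lam

/-- The moduli `α`, `g` have group-like square roots `β`, `l` such that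
`S²(x) = l (β ⇀ x ↼ β⁻¹) l⁻¹`. Inverses of group-likes are `β⁻¹ = β ∘ S` and `l⁻¹ = S(l)`. -/
def IsDoubleBalanced (D : Type u) (A : Type v) [CommRing D] [Ring A] [HopfAlgebra D A] : Prop :=
  ∃ (α β : A →ₐ[D] D) (g l : A),
    IsCointegralModulus α ∧ IsIntegralModulus D g ∧ IsGroupLikeElem D l ∧
    DrinfeldDouble.convL D A β.toLinearMap β.toLinearMap = α.toLinearMap ∧ l * l = g ∧
    ∀ x : A, antipode D (antipode D x) =
      l * rightHit (β.toLinearMap ∘ₗ antipode D) (leftHit β.toLinearMap x) * antipode D l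

/-- `R` is a universal R-matrix: it is invertible, `(Δ ⊗ id) R = R₁₃ R₂₃`,
`(id ⊗ Δ) R = R₁₃ R₁₂` (in `A ⊗ (A ⊗ A)`), and `R Δ(x) = Δᵒᵖ(x) R`. -/
structure IsUniversalRMatrix (R : A ⊗[D] A) : Prop where
  isUnit : IsUnit R
  comul_left : TensorProduct.assoc D A A A (comul.rTensor A R) =
    Algebra.TensorProduct.map (.id D A) (Algebra.TensorProduct.includeRight (R := D)) R *
      (1 : A) ⊗ₜ[D] R
  comul_right : comul.lTensor A R =
    Algebra.TensorProduct.map (.id D A) (Algebra.TensorProduct.includeRight (R := D)) R *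
      Algebra.TensorProduct.map (.id D A) (Algebra.TensorProduct.includeLeft (S := D)) R
  intertwine : ∀ x : A, R * comul x = TensorProduct.comm D A A (comul x) * R

/-- `u = ∑ S(fᵢ) eᵢ` for `R = ∑ eᵢ ⊗ fᵢ`. -/
def drinfeldElement (R : A ⊗[D] A) : A :=
  LinearMap.mul' D A ((antipode D).rTensor A (TensorProduct.comm D A A R))

/-- `R₂₁ R`. -/
def monodromy (R : A ⊗[D] A) : A ⊗[D] A :=
  TensorProduct.comm D A A R * R

/-- `r` is a ribbon element: invertible, central, `S(r) = r` and
`R₂₁ R = (r ⊗ r) Δ(r⁻¹)`. -/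
structure IsRibbonElement (R : A ⊗[D] A) (r : Aˣ) : Prop where
  central : ∀ x : A, (r : A) * x = x * r
  antipode_eq : antipode D (r : A) = r
  monodromy_eq : monodromy R = ((r : A) ⊗ₜ[D] (r : A)) * comul (↑r⁻¹ : A)

/-- `κ` is a balancing element: group-like, `κ² = u S(u)⁻¹ = S(u)⁻¹ u` and
`S²(x) = κ x κ⁻¹`. -/
structure IsBalancingElement (R : A ⊗[D] A) (κ : A) : Prop where
  isGroupLikeElem : IsGroupLikeElem D κ
  isUnit_drinfeldElement : IsUnit (drinfeldElement R)
  sq_mul : κ * κ * antipode D (drinfeldElement R) = drinfeldElement R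
  mul_sq : antipode D (drinfeldElement R) * (κ * κ) = drinfeldElement R
  antipode_sq : ∀ x : A, antipode D (antipode D x) * κ = κ * x

/-- The map `A* → A`, `f ↦ (f ⊗ id)(R₂₁ R)`. -/
def modularMap (R : A ⊗[D] A) : Module.Dual D A →ₗ[D] A where
  toFun f := TensorProduct.lid D A (f.rTensor A (monodromy R))
  map_add' f g := by rw [LinearMap.rTensor_add, LinearMap.add_apply, map_add]
  map_smul' c f := by rw [LinearMap.rTensor_smul, LinearMap.smul_apply, map_smul]; rfl

/-- The Hopf algebra `A` with the element `R` of `A ⊗ A` is topogenic: it is finitely generated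
with bijective antipode, quasi-triangular with R-matrix `R`, modular, and there are a ribbon
element `r`, the corresponding balancing element `κ` (with `r = u κ⁻¹`), a right integral `lam`
and a two-sided cointegral `Λ` with `lam(r) lam(r⁻¹) = 1` and `lam(Λ) = lam(S(Λ)) = 1`. -/
structure IsTopogenic (R : A ⊗[D] A) : Prop where
  finite : Module.Finite D A
  antipode_bijective : Function.Bijective (antipode D : A →ₗ[D] A)
  quasitriangular : IsUniversalRMatrix R
  modular : Function.Bijective (modularMap R)
  ribbon_integrals : ∃ (r : Aˣ) (κ : A) (lam : Module.Dual D A) (Λ : A),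
    IsRibbonElement R r ∧ IsBalancingElement R κ ∧ (r : A) * κ = drinfeldElement R ∧
    IsRightIntegral lam ∧ lam (r : A) * lam (↑r⁻¹ : A) = 1 ∧
    IsLeftCointegral D Λ ∧ IsRightCointegral D Λ ∧ lam Λ = 1 ∧ lam (antipode D Λ) = 1

end HopfAlgebraNotions

namespace DrinfeldDouble

noncomputable section

universe u v

variable {D : Type u} {H : Type v} [CommRing D] [Ring H] [HopfAlgebra D H]

/-- The element `p ⊗ x` of the double. -/
def mk (hS : Function.Bijective (antipode D : H →ₗ[D] H)) :
    Module.Dual D H →ₗ[D] H →ₗ[D] DrinfeldDouble D H hS :=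
  TensorProduct.mk D (Module.Dual D H) H

/-- If `∑ x' ⊗ x'' ⊗ x'''` is represented by `∑ aᵢ ⊗ bᵢ ⊗ cᵢ`, then
`(p ⊗ x)(q ⊗ y) = ∑ p * (aᵢ ⇀ q ↼ S⁻¹(cᵢ)) ⊗ bᵢ y`, where
`(a ⇀ q ↼ c)(z) = q(c z a)` and `*` is the product of the dual algebra. -/
theorem mk_mul_mk (hS : Function.Bijective (antipode D : H →ₗ[D] H)) {ι : Type*} (s : Finset ι)
    (a b c : ι → H) (p q : Module.Dual D H) (x y : H)
    (hx : comul.lTensor H (comul (R := D) x) = ∑ i ∈ s, a i ⊗ₜ[D] (b i ⊗ₜ[D] c i)) :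
    mk hS p x * mk hS q y = ∑ i ∈ s, mk hS (convL D H p
      (q ∘ₗ LinearMap.mulLeft D (antipodeInv hS (c i)) ∘ₗ LinearMap.mulRight D (a i)))
        (b i * y) := by
  change lmulL D H p (act₃ hS (comul.lTensor H (comul (R := D) x)) (q ⊗ₜ y)) = _
  rw [hx, map_sum, LinearMap.sum_apply, map_sum]
  refine Finset.sum_congr rfl fun i _ => ?_
  have : actPair hS q (a i ⊗ₜ c i) =
      q ∘ₗ LinearMap.mulLeft D (antipodeInv hS (c i)) ∘ₗ LinearMap.mulRight D (a i) := by
    ext z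
    simp [mul_assoc]
  rw [act₃_eq, lmulL_tmul, this]
  rfl

/-- The canonical element `R = ∑ (ε ⊗ hᵢ) ⊗ (hⁱ ⊗ 1)` of the double, where `∑ hⁱ ⊗ hᵢ` is the
tensor of dual bases, that is, the element of `H* ⊗ H` that corresponds to the identity of `H`. -/
def canonicalRMatrix [Module.Finite D H] [Module.Projective D H]
    (hS : Function.Bijective (antipode D : H →ₗ[D] H)) :
    DrinfeldDouble D H hS ⊗[D] DrinfeldDouble D H hS :=
  TensorProduct.map (mk hS counit) ((mk hS).flip 1)
    (TensorProduct.comm D (Module.Dual D H) H ((dualTensorHomEquiv D H H).symm LinearMap.id))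

end

end DrinfeldDouble

/-! The engine is the theory of integrals of a finitely generated projective Hopf algebra `A` over a
commutative ring. The dual `A*` is a Hopf module, hence is recovered from its right integrals `λ`
through `x ⊗ λ ↦ λ(S(x) ·)`. Splitting the counit along this map gives finitely many right integrals
`λ_k` and left cointegrals `Λ_k` with `∑ λ_k(S(Λ_k)) = 1` (`exists_integral_pairs`), and the same
isomorphism forces `S` to be bijective (`antipode_bijective`). Both results apply to `H` and to
`D(H)`. No single normalized integral of `H` is ever chosen; the family of pairs replaces it.

Over a domain, two right integrals can be compared after multiplication by a nonzero scalar. This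
yields `λ(S(x)) = λ(gx)` and the Nakayama automorphisms of `λ` and of `Λ`
(`BalancingData.apply_mul_comm`, `BalancingData.comul_comm`). The formula of Radford for `S⁴` that
they need is the square of the balancing identity for `S²`.

The double is identified with `End(H)` by sending `p ⊗ x` to `s ↦ p(s) x`. Sums over dual bases then
become endomorphisms: `u` becomes `S⁻¹`, and `u⁻¹` becomes `S²`. That `R` is an R-matrix is duality
between the product of `H*` and the coproduct of `H`, together with the cross relation in `D(H)`.
Modularity holds because `R₂₁R` pairs the basis `hⁱ ⊗ h_j` with the elements `(ε ⊗ h_i)(h^j ⊗ 1)`,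
and these products span `D(H)` as freely as the `p ⊗ x` do.

The balancing element is `κ = β ⊗ l`, with `κ² = α ⊗ g`. The hypothesis on `S²` says exactly that
`S_D²` is conjugation by `κ`. The relation `κ² S_D(u) = u` is deeper: `S_D(u)` is a sum of products
`(ε ⊗ x)(p ⊗ 1)`, which must be reordered. Multiplied by `λ(Λ)`, the dual bases can be replaced by
the legs of `Δ(Λ)`, the Nakayama automorphism does the reordering, and summing over the pairs
removes the scalar (`hat_antipode_drinfeldElement`). The ribbon element is then `r = uκ⁻¹`, and
`Δ(u⁻¹) = R₂₁R(u⁻¹ ⊗ u⁻¹)` gives the ribbon identity.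

Finally `p ⊗ x ↦ p(Λ) λ(x)` is a right integral of `D(H)`. The sum over the pairs takes the values
`β(l)⁵` at `r` and `β(l)⁻¹` at `r⁻¹`, so the factor `β(l)⁻²` normalizes it. Since its value at `r`
is invertible and it is a trace up to `S_D²`, it takes the value 1 on a two-sided cointegral
(`exists_twoSided_cointegral`). -/

namespace HopfIntegral

open Module (Dual)
open DrinfeldDouble

universe u v
-- Dual bases and the duality between product and coproduct.
section DualBasis

variable {D : Type u} {A : Type v} [CommRing D] [Ring A] [HopfAlgebra D A]

variable (D A) in
lemma exists_dualBasis [Module.Finite D A] [Module.Projective D A] :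
    ∃ (n : ℕ) (e : Fin n → A) (f : Fin n → Dual D A), ∀ x, ∑ i, f i x • e i = x := by
  obtain ⟨n, F, G, -, -, h⟩ := Module.Finite.exists_comp_eq_id_of_projective D A
  refine ⟨n, fun i => F (Pi.single i 1), fun i => LinearMap.proj i ∘ₗ G, fun x => ?_⟩
  conv_rhs => rw [← LinearMap.id_apply (R := D) x, ← h, LinearMap.comp_apply,
    pi_eq_sum_univ (G x) (R := D), map_sum]
  refine Finset.sum_congr rfl fun i _ => ?_
  rw [map_smul]
  congr 1
  change F _ = F _
  congr 1
  funext j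
  simp [Pi.single_apply, eq_comm]

variable {ι : Type*} [Fintype ι] {e : ι → A} {f : ι → Dual D A}

lemma sum_apply_smul_dual (he : ∀ x, ∑ i, f i x • e i = x) (p : Dual D A) :
    ∑ i, p (e i) • f i = p := by
  ext x
  conv_rhs => rw [← he x, map_sum]
  simp [mul_comm]

lemma sum_dualDistrib_smul (he : ∀ x, ∑ i, f i x • e i = x) (w : A ⊗[D] A) :
    ∑ a, ∑ b, TensorProduct.dualDistrib D A A (f a ⊗ₜ f b) w • (e a ⊗ₜ[D] e b) = w := by
  induction w with
  | zero => simp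
  | add x y hx hy => simp only [map_add, add_smul, Finset.sum_add_distrib, hx, hy]
  | tmul x y =>
    conv_rhs => rw [← he x, ← he y]
    simp only [dualDistrib_apply, sum_tmul, tmul_sum, smul_tmul_smul]
    exact Finset.sum_comm

/-- The coproduct of `A` and the product of `A*` are transposes of each other, so in `∑ eᵢ ⊗ fᵢ` a
coproduct on the first leg can be traded for a product on the second. `B` is an arbitrary bilinear
map, which lets the exchange take place inside any expression. -/
lemma sum_convL {M : Type*} [AddCommGroup M] [Module D M] (he : ∀ x, ∑ i, f i x • e i = x)
    (B : A ⊗[D] A →ₗ[D] Dual D A →ₗ[D] M) :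
    ∑ a, ∑ b, B (e a ⊗ₜ e b) (convL D A (f a) (f b)) = ∑ k, B (comul (e k)) (f k) := by
  have h1 : ∀ k, B (comul (e k)) (f k) =
      ∑ a, ∑ b, B (e a ⊗ₜ e b) (convL D A (f a) (f b) (e k) • f k) := by
    intro k
    conv_lhs => rw [← sum_dualDistrib_smul he (comul (e k))]
    simp [map_sum, LinearMap.sum_apply, convL_apply]
  rw [Finset.sum_congr rfl fun k _ => h1 k]
  refine Eq.trans (Finset.sum_congr rfl fun a _ => ?_) Finset.sum_comm
  refine Eq.trans (Finset.sum_congr rfl fun b _ => ?_) Finset.sum_comm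
  rw [← map_sum, sum_apply_smul_dual he]

end DualBasis

/-! ### Antipode identities in the convolution algebra of maps `A → A ⊗ A`. -/

section Convolution

variable {D : Type u} {A : Type v} [CommRing D] [Ring A] [HopfAlgebra D A]

variable (D A) in
/-- `x ↦ x ⊗ 1`, in the convolution algebra. -/
def convInclL : WithConv (A →ₗ[D] A ⊗[D] A) :=
  WithConv.toConv (Algebra.TensorProduct.includeLeft (R := D) (S := D) (A := A)
    (B := A)).toLinearMap

variable (D A) in
/-- `x ↦ 1 ⊗ x`, in the convolution algebra. -/
def convInclR : WithConv (A →ₗ[D] A ⊗[D] A) :=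
  WithConv.toConv (Algebra.TensorProduct.includeRight (R := D) (A := A) (B := A)).toLinearMap

variable (D A) in
/-- `x ↦ S(x) ⊗ 1`, in the convolution algebra. -/
def convInclLS : WithConv (A →ₗ[D] A ⊗[D] A) :=
  WithConv.toConv ((Algebra.TensorProduct.includeLeft (R := D) (S := D) (A := A)
    (B := A)).toLinearMap ∘ₗ antipode D)

variable (D A) in
/-- `x ↦ 1 ⊗ S(x)`, in the convolution algebra. -/
def convInclRS : WithConv (A →ₗ[D] A ⊗[D] A) :=
  WithConv.toConv ((Algebra.TensorProduct.includeRight (R := D) (A := A)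
    (B := A)).toLinearMap ∘ₗ antipode D)

lemma convMul_repr {B : Type*} [Ring B] [Algebra D B] {F G K : WithConv (A →ₗ[D] B)}
    (h : F * G = K) {x : A} {I : Type*} (r : Repr D x I) :
    ∑ i ∈ r.index, F.ofConv (r.left i) * G.ofConv (r.right i) = K.ofConv x := by
  rw [← h, LinearMap.convMul_def]
  simp [← r.eq]

lemma convMul_ext {B : Type*} [Ring B] [Algebra D B] {F G K : WithConv (A →ₗ[D] B)}
    (h : ∀ (x : A) (r : Repr D x (A × A)),
      ∑ i ∈ r.index, F.ofConv (r.left i) * G.ofConv (r.right i) = K.ofConv x) : F * G = K := by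
  apply WithConv.ext
  ext x
  rw [← h x (Repr.arbitrary D x), LinearMap.convMul_def]
  simp [← (Repr.arbitrary D x).eq]

lemma convInclLS_mul : convInclLS D A * convInclL D A = 1 := by
  refine convMul_ext fun x r => ?_
  have := congrArg (fun y : A => y ⊗ₜ[D] (1 : A)) (sum_antipode_mul_eq_algebraMap_counit r)
  simpa [convInclLS, convInclL, sum_tmul] using this

lemma convInclR_mul : convInclR D A * convInclRS D A = 1 := by
  refine convMul_ext fun x r => ?_
  have := congrArg (fun y : A => (1 : A) ⊗ₜ[D] y) (sum_mul_antipode_eq_algebraMap_counit r)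
  simpa [convInclRS, convInclR, tmul_sum, Algebra.algebraMap_eq_smul_one,
    Algebra.TensorProduct.one_def] using this

lemma convInclL_mul_convInclR :
    convInclL D A * convInclR D A = WithConv.toConv (comul (R := D) (A := A)) := by
  refine convMul_ext fun x r => ?_
  simpa [convInclL, convInclR] using r.eq

lemma convInclRS_mul_convInclLS : convInclRS D A * convInclLS D A =
    WithConv.toConv (comul (R := D) (A := A) ∘ₗ antipode D) := by
  refine convMul_ext fun x r => ?_
  simp only [convInclLS, convInclRS, WithConv.ofConv_toConv, LinearMap.comp_apply, comul_antipode,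
    ← r.eq]
  simp

variable {x : A} {I : Type*} (r : Repr D x I)

/-- Under convolution `Δ` is the product of `x ↦ x ⊗ 1` and `x ↦ 1 ⊗ x`, and `Δ ∘ S` is the product
of `x ↦ 1 ⊗ S(x)` and `x ↦ S(x) ⊗ 1`. This identity and the next two cancel one factor against its
inverse. -/
lemma sum_antipode_tmul_one_mul_comul :
    ∑ i ∈ r.index, (antipode D (r.left i) ⊗ₜ[D] (1 : A)) * comul (r.right i) = 1 ⊗ₜ x := by
  refine convMul_repr (F := convInclLS D A) (G := WithConv.toConv comul) (K := convInclR D A) ?_ r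
  rw [← convInclL_mul_convInclR, ← mul_assoc, convInclLS_mul, one_mul]

lemma sum_comul_antipode_mul_tmul_one :
    ∑ i ∈ r.index, comul (antipode D (r.left i)) * (r.right i ⊗ₜ[D] (1 : A)) =
      1 ⊗ₜ antipode D x := by
  refine convMul_repr (F := WithConv.toConv (comul ∘ₗ antipode D)) (G := convInclL D A)
    (K := convInclRS D A) ?_ r
  rw [← convInclRS_mul_convInclLS, mul_assoc, convInclLS_mul, mul_one]

lemma sum_one_tmul_mul_comul_antipode :
    ∑ i ∈ r.index, ((1 : A) ⊗ₜ[D] r.left i) * comul (antipode D (r.right i)) =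
      antipode D x ⊗ₜ 1 := by
  refine convMul_repr (F := convInclR D A) (G := WithConv.toConv (comul ∘ₗ antipode D))
    (K := convInclLS D A) ?_ r
  rw [← convInclRS_mul_convInclLS, ← mul_assoc, convInclR_mul, one_mul]

lemma map_antipode_comm_mul (s t : A ⊗[D] A) :
    TensorProduct.map (antipode D) (antipode D) (TensorProduct.comm D A A (s * t)) =
    TensorProduct.map (antipode D) (antipode D) (TensorProduct.comm D A A t) *
      TensorProduct.map (antipode D) (antipode D) (TensorProduct.comm D A A s) := by
  induction s with
  | zero => simp
  | add a b ha hb => simp only [add_mul, mul_add, map_add, ha, hb]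
  | tmul a b =>
  induction t with
  | zero => simp
  | add a b ha hb => simp only [add_mul, mul_add, map_add, ha, hb]
  | tmul c d => simp [antipode_mul_antidistrib]

/-- The image of `sum_comul_antipode_mul_tmul_one` under `S ⊗ S` composed with the flip, which
reverses products and turns `Δ(y)` into `Δ(S(y))`. -/
lemma sum_one_tmul_antipode_mul_comul_antipode_sq :
    ∑ i ∈ r.index, ((1 : A) ⊗ₜ[D] antipode D (r.right i)) *
      comul (antipode D (antipode D (r.left i))) = antipode D (antipode D x) ⊗ₜ 1 := by
  have := congrArg (fun t => TensorProduct.map (antipode D) (antipode D)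
    (TensorProduct.comm D A A t)) (sum_comul_antipode_mul_tmul_one r)
  simp only [map_sum, map_antipode_comm_mul, ← comul_antipode] at this
  simpa using this

end Convolution

/-! ### The Hopf module `A*`, existence of integrals, and bijectivity of the antipode. -/

section Integrals

variable {D : Type u} {A : Type v} [CommRing D] [Ring A] [HopfAlgebra D A]

variable (D A) in
/-- `c ↦ (q ↦ q(c ·))`. -/
def ract : A →ₗ[D] Module.End D (Dual D A) :=
  (ractHom D A).toLinearMap ∘ₗ (MulOpposite.opLinearEquiv D).toLinearMap

@[simp] lemma ract_apply (c : A) (q : Dual D A) (z : A) : ract D A c q z = q (c * z) := rfl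

lemma convL_repr (p q : Dual D A) {x : A} {I : Type*} (r : Repr D x I) :
    convL D A p q x = ∑ i ∈ r.index, p (r.left i) * q (r.right i) := by
  rw [convL_apply, ← r.eq]; simp

/-- The compatibility of the action of `A` on `A*` with the product of `A*`: an element acting on
the first factor is pulled out of the whole product, at the price of a correction on the second
factor. -/
lemma convL_ract_antipode_sq (p q : Dual D A) {x : A} {I : Type*} (r : Repr D x I) :
    convL D A (ract D A (antipode D (antipode D x)) p) q =
      ∑ i ∈ r.index, ract D A (antipode D (antipode D (r.left i)))
        (convL D A p (ract D A (antipode D (r.right i)) q)) := by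
  ext z
  have h1 : ∀ (a b : A) (p q : Dual D A) (t : A ⊗[D] A), dualDistrib D A A
      (ract D A a p ⊗ₜ ract D A b q) t = dualDistrib D A A (p ⊗ₜ q) ((a ⊗ₜ b) * t) := by
    intro a b p q t
    induction t with
    | zero => simp
    | add x y hx hy => simp only [mul_add, map_add, hx, hy]
    | tmul x y => simp
  have h2 : ∀ q : Dual D A, ract D A 1 q = q := fun q => by ext; simp
  simp only [LinearMap.sum_apply, ract_apply, convL_apply, comul_mul]
  conv_lhs => rw [← h2 q, h1, ← sum_one_tmul_antipode_mul_comul_antipode_sq r]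
  simp only [Finset.sum_mul, map_sum, mul_assoc]
  refine Finset.sum_congr rfl fun i _ => ?_
  conv_rhs => rw [← h2 p, h1]

/-- The translates of `lam` form a right `A*`-module whose structure is read off from the coproduct
of `x`; this is what makes `x ⊗ lam ↦ lam(S(x) ·)` a map of Hopf modules. -/
lemma _root_.IsRightIntegral.convL_ract {lam : Dual D A} (hl : IsRightIntegral lam) (q : Dual D A)
    {x : A} {I : Type*} (r : Repr D x I) :
    convL D A (ract D A (antipode D x) lam) q =
      ∑ i ∈ r.index, q (r.left i) • ract D A (antipode D (r.right i)) lam := by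
  ext z
  have h1 : ∀ (a b : A) (p q : Dual D A) (t : A ⊗[D] A), dualDistrib D A A
      (ract D A a p ⊗ₜ ract D A b q) t = dualDistrib D A A (p ⊗ₜ q) ((a ⊗ₜ b) * t) := by
    intro a b p q t
    induction t with
    | zero => simp
    | add x y hx hy => simp only [mul_add, map_add, hx, hy]
    | tmul x y => simp
  have h2 : ∀ q : Dual D A, ract D A 1 q = q := fun q => by ext; simp
  have h3 : ∀ a y : A, q a * lam y = dualDistrib D A A (lam ⊗ₜ q) ((1 ⊗ₜ a) * comul y) := by
    intro a y
    rw [← h1, h2, ← convL_apply, hl]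
    simp
  simp only [LinearMap.sum_apply, LinearMap.smul_apply, ract_apply, smul_eq_mul, h3, comul_mul]
  rw [← map_sum]
  simp only [← mul_assoc]
  rw [← Finset.sum_mul, sum_one_tmul_mul_comul_antipode r, convL_apply, ← h1, h2]

variable {ι : Type*} [Fintype ι]

/-- The projection of the dual onto the right integrals, for a dual basis `e`, `f`. -/
def integralProj (e : ι → A) (f : ι → Dual D A) : Dual D A →ₗ[D] Dual D A :=
  ∑ i, ract D A (antipode D (antipode D (e i))) ∘ₗ (convL D A).flip (f i)

variable {e : ι → A} {f : ι → Dual D A}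

lemma integralProj_apply (p : Dual D A) : integralProj e f p =
    ∑ i, ract D A (antipode D (antipode D (e i))) (convL D A p (f i)) := by
  simp [integralProj]

lemma ract_ract (a b : A) (p : Dual D A) : ract D A a (ract D A b p) = ract D A (b * a) p := by
  ext; simp [mul_assoc]

lemma ract_smul_one (d : D) (p : Dual D A) : ract D A (d • 1) p = d • p := by
  ext; simp

lemma sum_convL_ract (he : ∀ x, ∑ i, f i x • e i = x) (q : Dual D A) :
    ∑ i, convL D A (f i) (ract D A (antipode D (e i)) q) = q 1 • counit := by
  ext z
  have h : ∀ t : A ⊗[D] A, ∑ i, dualDistrib D A A (f i ⊗ₜ (ract D A (antipode D (e i)) q)) t =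
      q (LinearMap.mul' D A ((antipode D).rTensor A t)) := by
    intro t
    induction t with
    | zero => simp
    | add x y hx hy => simp only [map_add, Finset.sum_add_distrib, hx, hy]
    | tmul x y =>
      conv_rhs => rw [← he x]
      simp [sum_tmul]
  simp only [LinearMap.sum_apply, convL_apply, h]
  simp [Algebra.algebraMap_eq_smul_one, mul_comm]

/-- Multiplying by `q` on the right splits `eᵢ` into two legs. Traded through `sum_convL`, the
second leg meets `q` only in `∑ f_b * q(S(e_b) ·)`, which is `q(1) ε`. -/
lemma isRightIntegral_integralProj (he : ∀ x, ∑ i, f i x • e i = x) (p : Dual D A) :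
    IsRightIntegral (integralProj e f p) := by
  intro q
  let B : A ⊗[D] A →ₗ[D] Dual D A →ₗ[D] Dual D A :=
    (LinearMap.mul' D (Module.End D (Dual D A)) ∘ₗ
    TensorProduct.map (ract D A ∘ₗ antipode D ∘ₗ antipode D)
      ((LinearMap.lcomp D (Dual D A) (convL D A p)) ∘ₗ (convL D A).flip ∘ₗ
        (ract D A).flip q ∘ₗ antipode D))
  have hB : ∀ a b s, B (a ⊗ₜ b) s = ract D A (antipode D (antipode D a))
      (convL D A (convL D A p s) (ract D A (antipode D b) q)) := fun a b s => rfl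
  have h1 : ∀ i, convL D A (ract D A (antipode D (antipode D (e i))) (convL D A p (f i))) q =
      B (comul (e i)) (f i) := by
    intro i
    rw [convL_ract_antipode_sq _ _ (Repr.arbitrary D (e i)), ← (Repr.arbitrary D (e i)).eq]
    simp only [map_sum, LinearMap.sum_apply, hB]
  rw [integralProj_apply, map_sum, LinearMap.sum_apply]
  simp only [h1]
  rw [← sum_convL he B, Finset.smul_sum]
  refine Finset.sum_congr rfl fun a _ => ?_
  simp only [hB, convL_assoc]
  rw [← map_sum, ← map_sum, ← map_sum, sum_convL_ract he]
  simp [convL_counit]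

lemma _root_.IsRightIntegral.integralProj_ract {lam : Dual D A} (hl : IsRightIntegral lam)
    (he : ∀ x, ∑ i, f i x • e i = x) (x : A) :
    integralProj e f (ract D A (antipode D x) lam) = counit (R := D) x • lam := by
  rw [integralProj_apply]
  let r := Repr.arbitrary D x
  simp only [hl.convL_ract _ r, map_sum, map_smul]
  rw [Finset.sum_comm]
  have : ∀ i ∈ r.index, ∑ k, f k (r.left i) • ract D A (antipode D (antipode D (e k)))
      (ract D A (antipode D (r.right i)) lam) =
      ract D A (antipode D (antipode D (r.left i) * r.right i)) lam := by
    intro i _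
    rw [antipode_mul_antidistrib, ← ract_ract]
    conv_rhs => rw [← he (r.left i)]
    simp only [map_sum, map_smul, LinearMap.sum_apply, LinearMap.smul_apply]
  rw [Finset.sum_congr rfl this, ← LinearMap.sum_apply, ← map_sum, ← map_sum,
    sum_antipode_mul_eq_smul r, map_smul, antipode_one, ract_smul_one]

lemma _root_.IsRightIntegral.integralProj_self {lam : Dual D A} (hl : IsRightIntegral lam)
    (he : ∀ x, ∑ i, f i x • e i = x) : integralProj e f lam = lam := by
  have := hl.integralProj_ract he 1
  have h2 : ract D A 1 lam = lam := by ext; simp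
  simpa [h2] using this

/-- The inverse of the structure map of the Hopf module `A*`. -/
def dualSplit (e : ι → A) (f : ι → Dual D A) : Dual D A →ₗ[D] A ⊗[D] Dual D A :=
  ∑ i, TensorProduct.mk D A (Dual D A) (e i) ∘ₗ integralProj e f ∘ₗ (convL D A).flip (f i)

lemma dualSplit_apply (p : Dual D A) :
    dualSplit e f p = ∑ i, e i ⊗ₜ integralProj e f (convL D A p (f i)) := by
  simp [dualSplit]

variable (D A) in
/-- `x ⊗ p ↦ p(x ·)`. -/
def hitMap : A ⊗[D] Dual D A →ₗ[D] Dual D A := TensorProduct.lift (ract D A)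

@[simp] lemma hitMap_tmul (x : A) (p : Dual D A) : hitMap D A (x ⊗ₜ p) = ract D A x p := rfl

/-- The two dual-basis sums merge into one, where the acting element is `S(e' S(e'')) = ε(e) 1`; the
remaining `∑ ε(eᵢ) fᵢ` is the unit of `A*`. Together with `dualSplit_hitMap` this is the structure
theorem for the Hopf module `A*`. -/
lemma hitMap_dualSplit (he : ∀ x, ∑ i, f i x • e i = x) (p : Dual D A) :
    hitMap D A ((antipode D).rTensor _ (dualSplit e f p)) = p := by
  simp only [dualSplit_apply, integralProj_apply, map_sum, LinearMap.rTensor_tmul, hitMap_tmul]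
  let B : A ⊗[D] A →ₗ[D] Dual D A →ₗ[D] Dual D A :=
    LinearMap.lcomp D (Dual D A) (convL D A p) ∘ₗ
    (LinearMap.mul' D (Module.End D (Dual D A)) ∘ₗ
    TensorProduct.map (ract D A ∘ₗ antipode D) (ract D A ∘ₗ antipode D ∘ₗ antipode D))
  have hB : ∀ a b s, B (a ⊗ₜ b) s = ract D A (antipode D a)
      (ract D A (antipode D (antipode D b)) (convL D A p s)) := fun a b s => rfl
  have h1 := sum_convL he B
  simp only [hB, ← convL_assoc] at h1
  rw [h1]
  have h2 : ∀ k, B (comul (e k)) (f k) = counit (R := D) (e k) • convL D A p (f k) := by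
    intro k
    have r := Repr.arbitrary D (e k)
    rw [← r.eq]
    simp only [map_sum, LinearMap.sum_apply, hB, ract_ract, ← antipode_mul_antidistrib]
    rw [← LinearMap.sum_apply, ← map_sum, ← map_sum, sum_mul_antipode_eq_smul r, map_smul,
      antipode_one, ract_smul_one]
  simp only [h2, ← map_smul]
  rw [← map_sum, sum_apply_smul_dual he, convL_counit]

lemma _root_.IsRightIntegral.dualSplit_ract {lam : Dual D A} (hl : IsRightIntegral lam)
    (he : ∀ x, ∑ i, f i x • e i = x) (x : A) :
    dualSplit e f (ract D A (antipode D x) lam) = x ⊗ₜ lam := by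
  rw [dualSplit_apply]
  let r := Repr.arbitrary D x
  simp only [hl.convL_ract _ r, map_sum, map_smul, hl.integralProj_ract he, tmul_sum]
  rw [Finset.sum_comm]
  have : ∀ i ∈ r.index, ∑ k, e k ⊗ₜ[D] (f k (r.left i) • counit (R := D) (r.right i) • lam) =
      (counit (R := D) (r.right i) • r.left i) ⊗ₜ lam := by
    intro i _
    conv_rhs => rw [← he (r.left i)]
    simp only [Finset.smul_sum, sum_tmul, smul_tmul, smul_smul, mul_comm]
  rw [Finset.sum_congr rfl this, ← sum_tmul]
  congr 1
  have := congrArg (TensorProduct.rid D A) (sum_tmul_counit_eq r)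
  simpa only [map_sum, TensorProduct.rid_tmul, one_smul] using this

/-- The span of the `x ⊗ lam` with `lam` a right integral. -/
def integralSpan (D : Type u) (A : Type v) [CommRing D] [Ring A] [HopfAlgebra D A] :
    Submodule D (A ⊗[D] Dual D A) :=
  Submodule.span D {t | ∃ (x : A) (lam : Dual D A), IsRightIntegral lam ∧ t = x ⊗ₜ lam}

lemma tmul_mem_integralSpan {lam : Dual D A} (hl : IsRightIntegral lam) (x : A) :
    x ⊗ₜ lam ∈ integralSpan D A := Submodule.subset_span ⟨x, lam, hl, rfl⟩

lemma dualSplit_mem (he : ∀ x, ∑ i, f i x • e i = x) (p : Dual D A) :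
    dualSplit e f p ∈ integralSpan D A := by
  rw [dualSplit_apply]
  exact Submodule.sum_mem _ fun i _ => tmul_mem_integralSpan (isRightIntegral_integralProj he _) _

lemma dualSplit_hitMap (he : ∀ x, ∑ i, f i x • e i = x) {t : A ⊗[D] Dual D A}
    (ht : t ∈ integralSpan D A) :
    dualSplit e f (hitMap D A ((antipode D).rTensor _ t)) = t := by
  refine Submodule.span_induction ?_ (by simp) ?_ ?_ ht
  · rintro _ ⟨x, lam, hl, rfl⟩
    exact hl.dualSplit_ract he x
  · intro a b _ _ ha hb
    simp only [map_add, ha, hb]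
  · intro c a _ ha
    simp only [map_smul, ha]

lemma map_mem_integralSpan (T : A →ₗ[D] A) {t : A ⊗[D] Dual D A} (ht : t ∈ integralSpan D A) :
    T.rTensor _ t ∈ integralSpan D A := by
  refine Submodule.span_induction ?_ (by simp) ?_ ?_ ht
  · rintro _ ⟨x, lam, hl, rfl⟩
    exact tmul_mem_integralSpan hl _
  · intro a b _ _ ha hb
    simpa only [map_add] using Submodule.add_mem _ ha hb
  · intro c a _ ha
    simpa only [map_smul] using Submodule.smul_mem _ c ha

/-- Left multiplication on the first leg corresponds in `A*` to the translation by `S(x)`, and the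
counit is an eigenvector of that. Hence the first leg of the split counit behaves like a left
cointegral. -/
lemma mulLeft_dualSplit_counit (he : ∀ x, ∑ i, f i x • e i = x) (x : A) :
    (LinearMap.mulLeft D x).rTensor _ (dualSplit e f (counit (R := D) (A := A))) =
      counit (R := D) x • dualSplit e f (counit (R := D) (A := A)) := by
  rw [← dualSplit_hitMap he (map_mem_integralSpan _ (dualSplit_mem he _)), ← map_smul]
  congr 1
  have h : ∀ t : A ⊗[D] Dual D A, hitMap D A ((antipode D).rTensor _
      ((LinearMap.mulLeft D x).rTensor _ t)) =
        ract D A (antipode D x) (hitMap D A ((antipode D).rTensor _ t)) := by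
    intro t
    induction t with
    | zero => simp
    | add a b ha hb => simp only [map_add, ha, hb]
    | tmul a p => simp [antipode_mul_antidistrib, ract_ract]
  rw [h, hitMap_dualSplit he]
  ext; simp

/-- The pairs are the legs of the split counit `∑ eᵢ ⊗ P(fᵢ)`, where `P` is the projection onto the
right integrals. The normalization is the equation that splitting the counit and hitting back
returns the counit, evaluated at 1. -/
lemma exists_integral_pairs [Module.Finite D A] [Module.Projective D A] :
    ∃ (n : ℕ) (lam : Fin n → Dual D A) (Lam : Fin n → A), (∀ i, IsRightIntegral (lam i)) ∧
      (∀ i, IsLeftCointegral D (Lam i)) ∧ ∑ i, lam i (antipode D (Lam i)) = 1 := by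
  obtain ⟨n, e, f, he⟩ := exists_dualBasis D A
  refine ⟨n, fun k => integralProj e f (f k), fun k => ∑ i, integralProj e f (f i) (e k) • e i,
    fun k => isRightIntegral_integralProj he _, fun k x => ?_, ?_⟩
  · have := congrArg (fun t => TensorProduct.rid D A ((LinearMap.applyₗ (e k)).lTensor A t))
      (mulLeft_dualSplit_counit he x)
    simpa [dualSplit_apply, counit_convL, Finset.mul_sum] using this
  · have h1 := LinearMap.congr_fun (hitMap_dualSplit he (counit (R := D) (A := A))) 1
    simp only [dualSplit_apply, counit_convL, map_sum, LinearMap.rTensor_tmul, hitMap_tmul,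
      LinearMap.sum_apply, ract_apply, mul_one, counit_one] at h1
    rw [← h1]
    simp only [map_sum, map_smul, smul_eq_mul]
    rw [Finset.sum_comm]
    refine Finset.sum_congr rfl fun i _ => ?_
    -- `P` is idempotent, so expanding `P(fᵢ)` in the dual basis and applying `P` again produces
    -- exactly the products of values in the goal.
    have h2 := (isRightIntegral_integralProj he (f i)).integralProj_self he
    conv_rhs => rw [← h2, ← sum_apply_smul_dual he (integralProj e f (f i))]
    simp

/-- The isomorphism `x ⊗ λ ↦ λ(S(x) ·)` differs from `x ⊗ λ ↦ λ(x ·)` by `S` on the first leg. If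
the second map is also injective, then `S ⊗ id` is onto, and pairing the second leg with the
normalized cointegrals carries this over to `S`. -/
theorem antipode_bijective [Module.Finite D A] [Module.Projective D A] :
    Function.Bijective (antipode D : A →ₗ[D] A) := by
  obtain ⟨n, e, f, he⟩ := exists_dualBasis D A
  -- Surjective endomorphisms of a finitely generated module are injective, so a preimage is all
  -- that is needed; it is found by applying `S` twice on the first leg before hitting.
  have hsurj : Function.Surjective (hitMap D A ∘ₗ dualSplit e f) := by
    intro p
    refine ⟨hitMap D A ((antipode D).rTensor _ ((antipode D).rTensor _ (dualSplit e f p))), ?_⟩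
    rw [LinearMap.comp_apply, dualSplit_hitMap he (map_mem_integralSpan _ (dualSplit_mem he p)),
      hitMap_dualSplit he]
  have hinj := OrzechProperty.injective_of_surjective_endomorphism _ hsurj
  have key : ∀ t ∈ integralSpan D A, hitMap D A t = 0 → t = 0 := by
    intro t ht h0
    have h1 : hitMap D A ((antipode D).rTensor _ t) = 0 := by
      apply hinj
      rw [LinearMap.comp_apply, dualSplit_hitMap he ht, h0, map_zero]
    rw [← dualSplit_hitMap he ht, h1, map_zero]
  obtain ⟨m, lam, Lam, hlam, -, h1⟩ := exists_integral_pairs (D := D) (A := A)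
  have hS : Function.Surjective (antipode D : A →ₗ[D] A) := by
    intro y
    -- Both sides have the same image under the untwisted `hitMap`, which `key` shows to be
    -- injective on the span.
    have h2 : ∀ k, y ⊗ₜ lam k =
        (antipode D).rTensor _ (dualSplit e f (hitMap D A (y ⊗ₜ lam k))) := by
      intro k
      rw [← sub_eq_zero]
      refine key _ (Submodule.sub_mem _ (tmul_mem_integralSpan (hlam k) _)
        (map_mem_integralSpan _ (dualSplit_mem he _))) ?_
      rw [map_sub, hitMap_dualSplit he, sub_self]
    have h3 : ∀ (a : A) (t : A ⊗[D] Dual D A), TensorProduct.rid D A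
        ((LinearMap.applyₗ a).lTensor A ((antipode D).rTensor _ t)) =
          antipode D (TensorProduct.rid D A ((LinearMap.applyₗ a).lTensor A t)) := by
      intro a t
      induction t with
      | zero => simp
      | add a b ha hb => simp only [map_add, ha, hb]
      | tmul a p => simp
    refine ⟨∑ k, TensorProduct.rid D A ((LinearMap.applyₗ (antipode D (Lam k))).lTensor A
      (dualSplit e f (hitMap D A (y ⊗ₜ lam k)))), ?_⟩
    simp only [map_sum, ← h3, ← h2]
    simp [← Finset.sum_smul, h1]
  exact ⟨OrzechProperty.injective_of_surjective_endomorphism _ hS, hS⟩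

end Integrals
end HopfIntegral

namespace HopfIntegral

open Module (Dual)
open DrinfeldDouble

universe u v

/-! ### Slices of tensors and the two actions of the dual algebra. -/

section Slices

variable {D : Type u} {A : Type v} [CommRing D] [Ring A] [HopfAlgebra D A]

/-- `a ⊗ b ↦ p(a) b`. -/
def slice₁ (p : Dual D A) : A ⊗[D] A →ₗ[D] A := (TensorProduct.lid D A).toLinearMap ∘ₗ p.rTensor A

/-- `a ⊗ b ↦ p(b) a`. -/
def slice₂ (p : Dual D A) : A ⊗[D] A →ₗ[D] A := (TensorProduct.rid D A).toLinearMap ∘ₗ p.lTensor A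

@[simp] lemma slice₁_tmul (p : Dual D A) (a b : A) : slice₁ p (a ⊗ₜ b) = p a • b := rfl
@[simp] lemma slice₂_tmul (p : Dual D A) (a b : A) : slice₂ p (a ⊗ₜ b) = p b • a := rfl

lemma rightHit_eq_slice (p : Dual D A) (x : A) : rightHit p x = slice₁ p (comul x) := rfl
lemma leftHit_eq_slice (p : Dual D A) (x : A) : leftHit p x = slice₂ p (comul x) := rfl

lemma apply_slice (p q : Dual D A) (t : A ⊗[D] A) : q (slice₁ p t) = p (slice₂ q t) := by
  induction t with
  | zero => simp
  | add a b ha hb => simp only [map_add, ha, hb]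
  | tmul a b => simp [mul_comm]

lemma slice₁_one_tmul_mul (p : Dual D A) (x : A) (t : A ⊗[D] A) :
    slice₁ p ((1 ⊗ₜ x) * t) = x * slice₁ p t := by
  induction t with
  | zero => simp
  | add a b ha hb => simp only [mul_add, map_add, ha, hb]
  | tmul a b => simp

lemma slice₁_mul_one_tmul (p : Dual D A) (x : A) (t : A ⊗[D] A) :
    slice₁ p (t * (1 ⊗ₜ x)) = slice₁ p t * x := by
  induction t with
  | zero => simp
  | add a b ha hb => simp only [add_mul, map_add, ha, hb]
  | tmul a b => simp

lemma slice₁_tmul_one_mul (p : Dual D A) (x : A) (t : A ⊗[D] A) :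
    slice₁ p ((x ⊗ₜ 1) * t) = slice₁ (p ∘ₗ LinearMap.mulLeft D x) t := by
  induction t with
  | zero => simp
  | add a b ha hb => simp only [mul_add, map_add, ha, hb]
  | tmul a b => simp

lemma slice₁_mul_tmul_one (p : Dual D A) (x : A) (t : A ⊗[D] A) :
    slice₁ p (t * (x ⊗ₜ 1)) = slice₁ (p ∘ₗ LinearMap.mulRight D x) t := by
  induction t with
  | zero => simp
  | add a b ha hb => simp only [add_mul, map_add, ha, hb]
  | tmul a b => simp

lemma slice₂_tmul_one_mul (p : Dual D A) (x : A) (t : A ⊗[D] A) :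
    slice₂ p ((x ⊗ₜ 1) * t) = x * slice₂ p t := by
  induction t with
  | zero => simp
  | add a b ha hb => simp only [mul_add, map_add, ha, hb]
  | tmul a b => simp

lemma slice₂_one_tmul_mul (p : Dual D A) (x : A) (t : A ⊗[D] A) :
    slice₂ p ((1 ⊗ₜ x) * t) = slice₂ (p ∘ₗ LinearMap.mulLeft D x) t := by
  induction t with
  | zero => simp
  | add a b ha hb => simp only [mul_add, map_add, ha, hb]
  | tmul a b => simp

lemma convL_eq_rightHit (p q : Dual D A) (x : A) : convL D A p q x = q (rightHit p x) := by
  rw [convL_apply, rightHit_eq_slice]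
  induction comul (R := D) x with
  | zero => simp
  | add a b ha hb => simp only [map_add, ha, hb]
  | tmul a b => simp

lemma convL_eq_leftHit (p q : Dual D A) (x : A) : convL D A p q x = p (leftHit q x) := by
  rw [convL_eq_rightHit, rightHit_eq_slice, apply_slice, leftHit_eq_slice]

lemma rightHit_repr (p : Dual D A) {x : A} {I : Type*} (r : Repr D x I) :
    rightHit p x = ∑ i ∈ r.index, p (r.left i) • r.right i := by
  rw [rightHit_eq_slice, ← r.eq]; simp

variable [Module.Finite D A] [Module.Projective D A]

lemma ext_dual {x y : A} (h : ∀ p : Dual D A, p x = p y) : x = y := by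
  obtain ⟨n, e, f, he⟩ := exists_dualBasis D A
  rw [← he x, ← he y]
  simp only [h]

lemma rightHit_convL (p q : Dual D A) (x : A) :
    rightHit (convL D A p q) x = rightHit q (rightHit p x) := by
  refine ext_dual (D := D) fun s => ?_
  simp only [← convL_eq_rightHit, convL_assoc]

lemma leftHit_convL (p q : Dual D A) (x : A) :
    leftHit (convL D A p q) x = leftHit p (leftHit q x) := by
  refine ext_dual (D := D) fun s => ?_
  simp only [← convL_eq_leftHit, convL_assoc]

lemma leftHit_rightHit (p q : Dual D A) (x : A) :
    leftHit p (rightHit q x) = rightHit q (leftHit p x) := by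
  refine ext_dual (D := D) fun s => ?_
  rw [← convL_eq_leftHit, ← convL_eq_rightHit, ← convL_eq_rightHit, ← convL_eq_leftHit,
    convL_assoc]

lemma _root_.IsRightIntegral.rightHit_eq {lam : Dual D A} (hl : IsRightIntegral lam) (x : A) :
    rightHit lam x = lam x • 1 := by
  refine ext_dual (D := D) fun p => ?_
  rw [← convL_eq_rightHit, hl]
  simp [mul_comm]

lemma leftHit_eq_of_modulus {lam : Dual D A} {g : A}
    (hg : ∀ p : Dual D A, convL D A p lam = p g • lam) (x : A) :
    leftHit lam x = lam x • g := by
  refine ext_dual (D := D) fun p => ?_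
  rw [← convL_eq_leftHit, hg]
  simp [mul_comm]

end Slices

/-! ### The Frobenius pairing of integrals and cointegrals. -/

section Cointegrals

variable {D : Type u} {A : Type v} [CommRing D] [Ring A] [HopfAlgebra D A]

/-- Replacing `1 ⊗ x` by `∑ (S(x') ⊗ 1) Δ(x'')` makes `Δ(x'' L) = ε(x'') Δ(L)` available. -/
lemma _root_.IsLeftCointegral.one_tmul_mul_comul {L : A} (hL : IsLeftCointegral D L) (x : A) :
    (1 ⊗ₜ x) * comul (R := D) L = (antipode D x ⊗ₜ 1) * comul L := by
  let r := Repr.arbitrary D x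
  rw [← sum_antipode_tmul_one_mul_comul r, Finset.sum_mul]
  simp only [mul_assoc, ← comul_mul, hL _, map_smul, mul_smul_comm, ← smul_mul_assoc, smul_tmul']
  rw [← Finset.sum_mul]
  congr 1
  have := congrArg (TensorProduct.rid D A) (sum_tmul_counit_eq r)
  simp only [map_sum, TensorProduct.rid_tmul, one_smul] at this
  conv_rhs => rw [← this]
  simp only [map_sum, map_smul, sum_tmul]

lemma comul_mul_one_tmul_antipode {L : A} {α : Dual D A} (hL : ∀ x, L * x = α x • L) (x : A) :
    comul (R := D) L * (1 ⊗ₜ antipode D x) = comul L * (rightHit (α ∘ₗ antipode D) x ⊗ₜ 1) := by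
  let r := Repr.arbitrary D x
  rw [← sum_comul_antipode_mul_tmul_one r, Finset.mul_sum, rightHit_repr _ r, sum_tmul,
    Finset.mul_sum]
  refine Finset.sum_congr rfl fun i _ => ?_
  rw [← mul_assoc, ← comul_mul, hL, map_smul, smul_mul_assoc, ← smul_tmul', mul_smul_comm]
  rfl

lemma rightHit_counit (x : A) : rightHit (counit (R := D)) x = x := by
  rw [rightHit_eq_slice, slice₁, LinearMap.comp_apply, rTensor_counit_comul]
  simp

lemma leftHit_counit (x : A) : leftHit (counit (R := D)) x = x := by
  rw [leftHit_eq_slice, slice₂, LinearMap.comp_apply, lTensor_counit_comul]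
  simp

lemma _root_.IsRightCointegral.comul_mul_one_tmul {G : A} (hG : IsRightCointegral D G) (x : A) :
    comul (R := D) G * (1 ⊗ₜ antipode D x) = comul G * (x ⊗ₜ 1) := by
  rw [comul_mul_one_tmul_antipode hG, counit_comp_antipode, rightHit_counit]

lemma _root_.IsLeftCointegral.antipode (hS : Function.Bijective (antipode D : A →ₗ[D] A))
    {L : A} (hL : IsLeftCointegral D L) : IsRightCointegral D (antipode D L) := by
  intro x
  obtain ⟨y, rfl⟩ := hS.2 x
  rw [← antipode_mul_antidistrib, hL, map_smul, counit_antipode]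

lemma _root_.IsRightCointegral.antipodeInv (hS : Function.Bijective (antipode D : A →ₗ[D] A))
    {L : A} (hL : IsRightCointegral D L) : IsLeftCointegral D (antipodeInv hS L) := by
  intro x
  apply hS.1
  rw [antipode_mul_antidistrib, antipode_antipodeInv, hL, map_smul, counit_antipode,
    antipode_antipodeInv]

variable [Module.Finite D A] [Module.Projective D A]

/-- The Frobenius property: up to the scalar `lam G`, the legs of `Δ(G)` are dual bases for the form
`(y, x) ↦ lam(yx)`, twisted by `S`. Nondegeneracy of `lam` and the comparison of two right integrals
are read off from it. -/
lemma _root_.IsRightIntegral.smul_antipode {lam : Dual D A} (hl : IsRightIntegral lam) {G : A}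
    (hG : IsRightCointegral D G) (x : A) :
    lam G • antipode D x = slice₁ (lam ∘ₗ LinearMap.mulRight D x) (comul G) := by
  rw [← slice₁_mul_tmul_one, ← hG.comul_mul_one_tmul, slice₁_mul_one_tmul, ← rightHit_eq_slice,
    hl.rightHit_eq, smul_mul_assoc, one_mul]

lemma _root_.IsRightIntegral.smul_eq_zero {lam : Dual D A} (hl : IsRightIntegral lam) {G : A}
    (hG : IsRightCointegral D G) {x : A} (h : ∀ y, lam (y * x) = 0) : lam G • x = 0 := by
  apply (antipode_bijective (D := D) (A := A)).1
  have : lam ∘ₗ LinearMap.mulRight D x = 0 := by ext y; simpa using h y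
  rw [map_smul, hl.smul_antipode hG, this]
  simp [slice₁]

/-- Two right integrals differ by the values at a right cointegral and a twist by the antipode. -/
lemma _root_.IsRightIntegral.apply_antipode_mul {lam lam' : Dual D A} (hl : IsRightIntegral lam)
    {g : A} (hg : ∀ p : Dual D A, convL D A p lam' = p g • lam') {G : A}
    (hG : IsRightCointegral D G) (x : A) :
    lam' (antipode D x) * lam G = lam' G * lam (g * x) := by
  have h := congrArg lam' (hl.smul_antipode hG x)
  rw [map_smul, apply_slice, ← leftHit_eq_slice, leftHit_eq_of_modulus hg] at h
  simpa [mul_comm] using h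

lemma _root_.IsRightIntegral.slice₁_comul {lam : Dual D A} (hl : IsRightIntegral lam) {L : A}
    (hL : IsLeftCointegral D L) (x : A) :
    slice₁ (lam ∘ₗ LinearMap.mulLeft D (antipode D x)) (comul L) = lam L • x := by
  rw [← slice₁_tmul_one_mul, ← hL.one_tmul_mul_comul, slice₁_one_tmul_mul, ← rightHit_eq_slice,
    hl.rightHit_eq, mul_smul_comm, mul_one]

lemma slice₂_comul_of_modulus {lam : Dual D A} {g : A}
    (hg : ∀ p : Dual D A, convL D A p lam = p g • lam) {L : A}
    (hL : IsLeftCointegral D L) (x : A) :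
    slice₂ (lam ∘ₗ LinearMap.mulLeft D x) (comul L) = lam L • (antipode D x * g) := by
  rw [← slice₂_one_tmul_mul, hL.one_tmul_mul_comul, slice₂_tmul_one_mul, ← leftHit_eq_slice,
    leftHit_eq_of_modulus hg, mul_smul_comm]

/-- A first form of the Nakayama automorphism. The left side is `lam(S(y)L') lam(L'' S(x))`; the
factor `S(x)` is moved from the second leg of `Δ(L)` to the first, after which `lam(L'') L' = lam(L)
g`. -/
lemma _root_.IsRightIntegral.apply_mul_antipode {lam : Dual D A} (hl : IsRightIntegral lam)
    {g : A} (hg : ∀ p : Dual D A, convL D A p lam = p g • lam) {L : A}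
    (hL : IsLeftCointegral D L) {α : Dual D A} (hα : ∀ x, L * x = α x • L) (y x : A) :
    lam L * lam (y * antipode D x) =
      lam L * lam (antipode D y * g * rightHit (α ∘ₗ antipode D) x) := by
  have h1 := congrArg (fun z => lam (z * antipode D x)) (hl.slice₁_comul hL y)
  simp only [← slice₁_mul_one_tmul, smul_mul_assoc, map_smul, smul_eq_mul,
    ← slice₁_tmul_one_mul, mul_assoc, comul_mul_one_tmul_antipode hα] at h1
  rw [← h1, ← mul_assoc, slice₁_mul_tmul_one, slice₁_tmul_one_mul, apply_slice,
    ← leftHit_eq_slice, leftHit_eq_of_modulus hg]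
  simp [mul_assoc]

end Cointegrals

/-! ### Uniqueness of integrals over a domain, up to cancelling a nonzero scalar. -/

section Domain

variable {D : Type u} {A : Type v} [CommRing D] [IsDomain D] [Ring A] [HopfAlgebra D A]
  [Module.Finite D A] [Module.Projective D A]

lemma exists_integral_pair : ∃ (lam : Dual D A) (L : A), IsRightIntegral lam ∧
    IsLeftCointegral D L ∧ lam (antipode D L) ≠ 0 := by
  obtain ⟨n, lam, L, h1, h2, h3⟩ := exists_integral_pairs (D := D) (A := A)
  by_contra! h
  rw [Finset.sum_eq_zero fun i _ => h _ _ (h1 i) (h2 i)] at h3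
  exact zero_ne_one h3

/-- One nonzero value `lam(S(L))` is enough to compare `lam` with every right integral: identities
proved for `lam` pass to `lam'` after multiplication by that value, which can be cancelled. -/
lemma _root_.IsIntegralModulus.exists_basic {g : A} (hg : IsIntegralModulus D g) :
    ∃ (lam : Dual D A) (L : A), IsRightIntegral lam ∧
    IsLeftCointegral D L ∧ lam (antipode D L) ≠ 0 ∧
      (∀ x, lam (antipode D x) = lam (g * x)) ∧
      ∀ lam', IsRightIntegral lam' → ∀ x, lam' x * lam (antipode D L) =
        lam' (antipode D L) * lam x := by
  obtain ⟨lam, L, hl, hL, h0⟩ := exists_integral_pair (D := D) (A := A)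
  have hG := hL.antipode antipode_bijective
  have h1 : ∀ x, lam (antipode D x) = lam (g * x) := by
    intro x
    have := hl.apply_antipode_mul (hg.2 _ hl) hG x
    rw [mul_comm] at this
    exact mul_left_cancel₀ h0 this
  refine ⟨lam, L, hl, hL, h0, h1, fun lam' hl' x => ?_⟩
  obtain ⟨y, rfl⟩ := (antipode_bijective (D := D) (A := A)).2 x
  rw [hl.apply_antipode_mul (hg.2 _ hl') hG, h1]

lemma _root_.IsIntegralModulus.apply_antipode {g : A} (hg : IsIntegralModulus D g)
    {lam : Dual D A} (hl : IsRightIntegral lam) (x : A) :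
    lam (antipode D x) = lam (g * x) := by
  obtain ⟨lam0, L, -, -, h0, h1, h2⟩ := hg.exists_basic
  apply mul_right_cancel₀ h0
  rw [h2 _ hl, h2 _ hl, h1]

end Domain
end HopfIntegral

namespace HopfIntegral

open Module (Dual)
open DrinfeldDouble

universe u v

/-! ### Compatibility of the dual actions with the antipode and with products. -/

section Twists

variable {D : Type u} {A : Type v} [CommRing D] [Ring A] [HopfAlgebra D A]

lemma slice₁_map_comm (p : Dual D A) (S T : A →ₗ[D] A) (t : A ⊗[D] A) :
    slice₁ p (TensorProduct.map S T (TensorProduct.comm D A A t)) = T (slice₂ (p ∘ₗ S) t) := by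
  induction t with
  | zero => simp
  | add a b ha hb => simp only [map_add, ha, hb]
  | tmul a b => simp

lemma slice₂_map_comm (p : Dual D A) (S T : A →ₗ[D] A) (t : A ⊗[D] A) :
    slice₂ p (TensorProduct.map S T (TensorProduct.comm D A A t)) = S (slice₁ (p ∘ₗ T) t) := by
  induction t with
  | zero => simp
  | add a b ha hb => simp only [map_add, ha, hb]
  | tmul a b => simp

lemma rightHit_antipode (p : Dual D A) (x : A) :
    rightHit p (antipode D x) = antipode D (leftHit (p ∘ₗ antipode D) x) := by
  rw [rightHit_eq_slice, comul_antipode, slice₁_map_comm, leftHit_eq_slice]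

lemma leftHit_antipode (p : Dual D A) (x : A) :
    leftHit p (antipode D x) = antipode D (rightHit (p ∘ₗ antipode D) x) := by
  rw [leftHit_eq_slice, comul_antipode, slice₂_map_comm, rightHit_eq_slice]

lemma convL_algHom_antipode (β : A →ₐ[D] D) :
    convL D A β.toLinearMap (β.toLinearMap ∘ₗ antipode D) = counit := by
  ext x
  rw [convL_repr _ _ (Repr.arbitrary D x)]
  simp only [AlgHom.toLinearMap_apply, LinearMap.comp_apply, ← map_mul, ← map_sum,
    sum_mul_antipode_eq_smul, map_smul, map_one, smul_eq_mul, mul_one]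

lemma convL_algHom_antipode' (β : A →ₐ[D] D) :
    convL D A (β.toLinearMap ∘ₗ antipode D) β.toLinearMap = counit := by
  ext x
  rw [convL_repr _ _ (Repr.arbitrary D x)]
  simp only [AlgHom.toLinearMap_apply, LinearMap.comp_apply, ← map_mul, ← map_sum,
    sum_antipode_mul_eq_smul, map_smul, map_one, smul_eq_mul, mul_one]

lemma slice₂_algHom_mul (β : A →ₐ[D] D) (s t : A ⊗[D] A) :
    slice₂ β.toLinearMap (s * t) = slice₂ β.toLinearMap s * slice₂ β.toLinearMap t := by
  induction s with
  | zero => simp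
  | add a b ha hb => simp only [add_mul, map_add, ha, hb]
  | tmul a b =>
  induction t with
  | zero => simp
  | add a b ha hb => simp only [mul_add, map_add, ha, hb]
  | tmul c d => simp [smul_smul, mul_comm (β d)]

lemma leftHit_algHom_mul (β : A →ₐ[D] D) (x y : A) : leftHit β.toLinearMap (x * y) =
    leftHit β.toLinearMap x * leftHit β.toLinearMap y := by
  simp only [leftHit_eq_slice, comul_mul, slice₂_algHom_mul]

lemma _root_.IsGroupLikeElem.rightHit_eq {g : A} (hg : IsGroupLikeElem D g) (p : Dual D A) :
    rightHit p g = p g • g := by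
  rw [rightHit_eq_slice, hg.comul_eq_tmul_self, slice₁_tmul]

lemma _root_.IsGroupLikeElem.leftHit_eq {g : A} (hg : IsGroupLikeElem D g) (p : Dual D A) :
    leftHit p g = p g • g := by
  rw [leftHit_eq_slice, hg.comul_eq_tmul_self, slice₂_tmul]

end Twists

/-! ### Consequences of double balancedness: the formula for `S⁴` and the Nakayama automorphisms. -/

section DoubleBalanced

variable {D : Type u} {A : Type v} [CommRing D] [Ring A] [HopfAlgebra D A]

/-- The data of a double balanced Hopf algebra. -/
structure BalancingData (α β : A →ₐ[D] D) (g l : A) : Prop where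
  cointegralModulus : IsCointegralModulus α
  integralModulus : IsIntegralModulus D g
  isGroupLikeElem : IsGroupLikeElem D l
  sq_left : convL D A β.toLinearMap β.toLinearMap = α.toLinearMap
  sq_right : l * l = g
  antipode_sq : ∀ x : A, antipode D (antipode D x) =
      l * rightHit (β.toLinearMap ∘ₗ antipode D) (leftHit β.toLinearMap x) * antipode D l

variable {α β : A →ₐ[D] D} {g l : A}

/-- `β` takes values in a commutative ring, so it does not see conjugation by `l`, and the two
opposite twists by `β` cancel under `β`. -/
lemma BalancingData.apply_antipode_sq (h : BalancingData α β g l) (x : A) :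
    β (antipode D (antipode D x)) = β x := by
  have h1 : ∀ y, β (rightHit (β.toLinearMap ∘ₗ antipode D) (leftHit β.toLinearMap y)) =
      β y := by
    intro y
    have h2 := convL_eq_rightHit (β.toLinearMap ∘ₗ antipode D) β.toLinearMap
      (leftHit β.toLinearMap y)
    rw [convL_algHom_antipode', ← convL_eq_leftHit, counit_convL] at h2
    exact h2.symm
  have h3 : β l * β (antipode D l) = 1 := by
    rw [← map_mul, h.isGroupLikeElem.mul_antipode_cancel, map_one]
  rw [h.antipode_sq, map_mul, map_mul, h1, mul_right_comm, h3, one_mul]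

lemma BalancingData.rightHit_antipode_sq (h : BalancingData α β g l) (x : A) :
    rightHit β.toLinearMap (antipode D (antipode D x)) =
      antipode D (antipode D (rightHit β.toLinearMap x)) := by
  rw [rightHit_antipode, leftHit_antipode]
  have : (β.toLinearMap ∘ₗ antipode D) ∘ₗ antipode D = β.toLinearMap :=
    LinearMap.ext h.apply_antipode_sq
  rw [this]

lemma BalancingData.leftHit_antipode_sq (h : BalancingData α β g l) (x : A) :
    leftHit β.toLinearMap (antipode D (antipode D x)) =
      antipode D (antipode D (leftHit β.toLinearMap x)) := by
  rw [leftHit_antipode, rightHit_antipode]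
  have : (β.toLinearMap ∘ₗ antipode D) ∘ₗ antipode D = β.toLinearMap :=
    LinearMap.ext h.apply_antipode_sq
  rw [this]

variable [Module.Finite D A] [Module.Projective D A]

lemma BalancingData.antipode_sq_rightHit (h : BalancingData α β g l) (x : A) :
    antipode D (antipode D (rightHit β.toLinearMap x)) * l = l * leftHit β.toLinearMap x := by
  rw [h.antipode_sq, mul_assoc, h.isGroupLikeElem.antipode_mul_cancel, mul_one, leftHit_rightHit,
    ← rightHit_convL, convL_algHom_antipode, rightHit_counit]

/-- Radford's formula. The balancing identity is applied twice, using that `S²` commutes with the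
actions of `β`; the squares `β² = α` and `l² = g` then appear. -/
lemma BalancingData.antipode_pow_four (h : BalancingData α β g l) (x : A) :
    antipode D (antipode D (antipode D (antipode D (rightHit α.toLinearMap x)))) * g =
      g * leftHit α.toLinearMap x := by
  rw [← h.sq_left, rightHit_convL, leftHit_convL, ← h.sq_right, ← mul_assoc,
    ← h.rightHit_antipode_sq, h.antipode_sq_rightHit, h.leftHit_antipode_sq, leftHit_rightHit,
    mul_assoc, h.antipode_sq_rightHit, mul_assoc]

variable [IsDomain D]

/-- The Nakayama automorphism of a right integral. -/
lemma BalancingData.apply_mul_comm (h : BalancingData α β g l) {lam : Dual D A}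
    (hl : IsRightIntegral lam) (x y : A) :
    lam (x * y) = lam (antipode D (antipode D (rightHit α.toLinearMap y)) * x) := by
  have hg := h.integralModulus
  have hgg := hg.1
  obtain ⟨lam0, L, hl0, hL, h0, h1, h2⟩ := hg.exists_basic
  have h3 : lam0 (antipode D L) = lam0 L := by
    rw [h1, hL, hgg.counit_eq_one, one_smul]
  have key : ∀ x y, lam0 (x * y) =
      lam0 (antipode D (antipode D (rightHit α.toLinearMap y)) * x) := by
    intro x y
    obtain ⟨w, rfl⟩ := (antipode_bijective (D := D) (A := A)).2 y
    rw [h3] at h0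
    have h4 := mul_left_cancel₀ h0 (hl0.apply_mul_antipode (hg.2 _ hl0) hL
      (α := α.toLinearMap) (fun x => h.cointegralModulus L hL x) x w)
    rw [h4]
    -- With `v` so chosen, `lam0(S(x) S(v)) = lam0(S(vx)) = lam0(g v x)`, and Radford's formula
    -- identifies `g v` with `S²(S(w) ↼ α)`.
    obtain ⟨v, hv⟩ := (antipode_bijective (D := D) (A := A)).2
      (g * rightHit (α.toLinearMap ∘ₗ antipode D) w)
    rw [mul_assoc, ← hv, ← antipode_mul_antidistrib, h1, ← mul_assoc]
    congr 2
    apply (antipode_bijective (D := D) (A := A)).1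
    apply (antipode_bijective (D := D) (A := A)).1
    rw [antipode_mul_antidistrib, antipode_mul_antidistrib, hv, hgg.antipode_antipode,
      antipode_mul_antidistrib, ← leftHit_antipode, ← mul_assoc, ← h.antipode_pow_four,
      mul_assoc, hgg.mul_antipode_cancel, mul_one]
  apply mul_right_cancel₀ h0
  rw [h2 _ hl, h2 _ hl, key]

/-- The Nakayama automorphism of a left cointegral, in the dual algebra. -/
lemma BalancingData.comul_comm (h : BalancingData α β g l) {L : A} (hL : IsLeftCointegral D L)
    (q : Dual D A) :
    slice₁ q (comul L) =
      slice₂ (q ∘ₗ antipode D ∘ₗ antipode D ∘ₗ LinearMap.mulRight D g) (comul L) := by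
  have hg := h.integralModulus
  obtain ⟨lam, L0, hl, hL0, h0, -⟩ := hg.exists_basic
  rw [← sub_eq_zero]
  have key : lam (antipode D L0) • (slice₁ q (comul L) - slice₂ (q ∘ₗ antipode D ∘ₗ antipode D ∘ₗ
      LinearMap.mulRight D g) (comul L)) = 0 := by
    -- Nondegeneracy of `lam` reduces the equality to values of `lam(S(w) ·)`; by the Frobenius
    -- property both sides become `lam(L) q(S²(w) g)`.
    refine hl.smul_eq_zero (hL0.antipode antipode_bijective) fun y => ?_
    obtain ⟨w, rfl⟩ := (antipode_bijective (D := D) (A := A)).2 y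
    have h1 := apply_slice q (lam ∘ₗ LinearMap.mulLeft D (antipode D w)) (comul L)
    have h2 := apply_slice (lam ∘ₗ LinearMap.mulLeft D (antipode D w))
      (q ∘ₗ antipode D ∘ₗ antipode D ∘ₗ LinearMap.mulRight D g) (comul L)
    rw [slice₂_comul_of_modulus (hg.2 _ hl) hL] at h1
    rw [hl.slice₁_comul hL] at h2
    simp only [LinearMap.comp_apply, LinearMap.mulLeft_apply, LinearMap.mulRight_apply,
      map_smul, antipode_mul_antidistrib, hg.1.antipode_antipode] at h1 h2
    rw [mul_sub, map_sub, h1, ← h2, sub_self]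
  refine ext_dual (D := D) fun p => ?_
  have := congrArg p key
  rw [map_smul, map_zero, smul_eq_mul] at this
  rw [map_zero]
  exact (mul_eq_zero.1 this).resolve_left h0

/-- For a left cointegral `lam(S(Λ)) = lam(gΛ) = lam(Λ)`, so the antipode in the general
normalization can be dropped. -/
lemma BalancingData.exists_integral_pairs (h : BalancingData α β g l) :
    ∃ (n : ℕ) (lam : Fin n → Dual D A) (Lam : Fin n → A), (∀ i, IsRightIntegral (lam i)) ∧
      (∀ i, IsLeftCointegral D (Lam i)) ∧ ∑ i, lam i (Lam i) = 1 := by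
  obtain ⟨n, lam, Lam, h1, h2, h3⟩ := HopfIntegral.exists_integral_pairs (D := D) (A := A)
  refine ⟨n, lam, Lam, h1, h2, ?_⟩
  rw [← h3]
  refine Finset.sum_congr rfl fun i _ => ?_
  rw [h.integralModulus.apply_antipode (h1 i), h2 i, h.integralModulus.1.counit_eq_one, one_smul]

end DoubleBalanced
end HopfIntegral

namespace DrinfeldDouble

open Module (Dual)
open HopfIntegral

universe u v

/-! ### Generators of the double and its identification with `End(H)`. -/

section Generators

variable {D : Type u} {H : Type v} [CommRing D] [Ring H] [HopfAlgebra D H]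
variable (hS : Function.Bijective (antipode D : H →ₗ[D] H))

@[elab_as_elim]
lemma induction_on {motive : DrinfeldDouble D H hS → Prop} (v : DrinfeldDouble D H hS)
    (mk : ∀ p x, motive (mk hS p x)) (zero : motive 0)
    (add : ∀ a b, motive a → motive b → motive (a + b)) : motive v :=
  TensorProduct.induction_on (motive := motive) v zero mk add

lemma one_def : (1 : DrinfeldDouble D H hS) = mk hS counit 1 := rfl

lemma mk_one_mul (p : Dual D H) (v : DrinfeldDouble D H hS) :
    mk hS p 1 * v = lmulL D H p v := by
  change lmulL D H p (lmulR hS 1 v) = _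
  rw [map_one]; rfl

lemma mk_counit_mul (x : H) (v : DrinfeldDouble D H hS) :
    mk hS counit x * v = lmulR hS x v := by
  change lmulL D H counit (lmulR hS x v) = _
  generalize lmulR hS x v = w
  induction w with
  | zero => simp
  | add a b ha hb => simp only [map_add, ha, hb]
  | tmul a b => simp [counit_convL]

lemma mk_one_mul_mk (p q : Dual D H) (x : H) :
    mk hS p 1 * mk hS q x = mk hS (convL D H p q) x := by
  rw [mk_one_mul]; rfl

lemma mk_mul_mk_counit (p : Dual D H) (x y : H) :
    mk hS p x * mk hS counit y = mk hS p (x * y) := by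
  change lmulL D H p (lmulR hS x (counit ⊗ₜ y)) = _
  have h := lmulR_rmul hS x (counit ⊗ₜ 1) y
  rw [LinearMap.lTensor_tmul, lmulR_one, LinearMap.lTensor_tmul] at h
  simp only [LinearMap.mulRight_apply, one_mul] at h
  rw [h, lmulL_tmul, convL_counit]
  rfl

lemma mk_one_mul_mk_counit (p : Dual D H) (x : H) :
    mk hS p 1 * mk hS counit x = mk hS p x := by
  rw [mk_mul_mk_counit, one_mul]

/-- The linear map of `H` that corresponds to an element of the double: `p ⊗ x` is sent to
`s ↦ p(s) x`. -/
noncomputable def hat : DrinfeldDouble D H hS →ₗ[D] H →ₗ[D] H := dualTensorHom D H H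

@[simp] lemma hat_mk (p : Dual D H) (x s : H) : hat hS (mk hS p x) s = p s • x := rfl

lemma hat_mk_one_mul (p : Dual D H) (v : DrinfeldDouble D H hS) (s : H) :
    hat hS (mk hS p 1 * v) s = hat hS v (rightHit p s) := by
  induction v using induction_on with
  | mk q x => rw [mk_one_mul_mk, hat_mk, hat_mk, convL_eq_rightHit]
  | zero => simp
  | add a b ha hb => simp only [mul_add, map_add, LinearMap.add_apply, ha, hb]

lemma hat_mul_mk_counit (v : DrinfeldDouble D H hS) (y s : H) :
    hat hS (v * mk hS counit y) s = hat hS v s * y := by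
  induction v using induction_on with
  | mk q x => rw [mk_mul_mk_counit, hat_mk, hat_mk, smul_mul_assoc]
  | zero => simp
  | add a b ha hb => simp only [add_mul, map_add, LinearMap.add_apply, ha, hb]

/-- `a ⊗ b ⊗ c ↦ b T(S⁻¹(c) s a)`. -/
noncomputable def conjMap (T : H →ₗ[D] H) (s : H) : H ⊗[D] (H ⊗[D] H) →ₗ[D] H :=
  LinearMap.mul' D H ∘ₗ (T ∘ₗ LinearMap.mul' D H ∘ₗ TensorProduct.comm D H H ∘ₗ
    TensorProduct.map (LinearMap.mulLeft D s) (antipodeInv hS)).lTensor H ∘ₗ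
    (TensorProduct.leftComm D H H H).toLinearMap

@[simp] lemma conjMap_tmul (T : H →ₗ[D] H) (s a b c : H) :
    conjMap hS T s (a ⊗ₜ (b ⊗ₜ c)) = b * T (antipodeInv hS c * (s * a)) := rfl

lemma dualTensorHom_act₃ (t : H ⊗[D] (H ⊗[D] H)) (v : Dual D H ⊗[D] H) (s : H) :
    dualTensorHom D H H (act₃ hS t v) s = conjMap hS (dualTensorHom D H H v) s t := by
  have h0 : conjMap hS 0 s = 0 := by ext; simp
  have h1 : ∀ T T', conjMap hS (T + T') s = conjMap hS T s + conjMap hS T' s := by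
    intro T T'; ext; simp [mul_add]
  induction v with
  | zero => simp [h0]
  | add a b ha hb => simp only [map_add, LinearMap.add_apply, h1, ha, hb]
  | tmul q x =>
  induction t with
  | zero => simp
  | add a b ha hb => simp only [map_add, LinearMap.add_apply, ha, hb]
  | tmul a t =>
  induction t with
  | zero => simp
  | add a b ha hb => simp only [tmul_add, map_add, LinearMap.add_apply, ha, hb]
  | tmul b c =>
    rw [act₃_eq, conjMap_tmul, dualTensorHom_apply, dualTensorHom_apply, actPair_tmul_apply,
      mul_smul_comm, mul_assoc]

/-- Reordering in the double turns into a formula in `H`: the element `ε ⊗ x` sends an endomorphism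
`T` to `s ↦ ∑ x'' T(S⁻¹(x''') s x')`. -/
lemma hat_mk_counit_mul (x : H) (v : DrinfeldDouble D H hS) (s : H) :
    hat hS (mk hS counit x * v) s =
      conjMap hS (hat hS v) s (comul.lTensor H (comul x)) := by
  rw [mk_counit_mul]
  exact dualTensorHom_act₃ hS _ v s

variable [Module.Finite D H] [Module.Projective D H]

lemma hat_injective : Function.Injective (hat hS) :=
  (dualTensorHom_bijective (R := D) (M := H) (N := H)).1

lemma hat_ext {v w : DrinfeldDouble D H hS} (h : ∀ s, hat hS v s = hat hS w s) : v = w :=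
  hat_injective hS (LinearMap.ext h)

instance : Module.Finite D (DrinfeldDouble D H hS) :=
  inferInstanceAs (Module.Finite D (Dual D H ⊗[D] H))

instance : Module.Projective D (DrinfeldDouble D H hS) :=
  inferInstanceAs (Module.Projective D (Dual D H ⊗[D] H))

lemma comul_mk (p : Dual D H) (x : H) : comul (R := D) (mk hS p x) =
    TensorProduct.map₂ (mk hS) (mk hS) (dualComul D H p) (comul x) := by
  change TensorProduct.tensorTensorTensorComm D _ _ _ _ (dualComul D H p ⊗ₜ comul x) = _
  induction dualComul D H p with
  | zero => simp; rfl
  | add a b ha hb => simp only [add_tmul, map_add, LinearMap.add_apply, ha, hb]; rfl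
  | tmul p₁ p₂ =>
  induction comul (R := D) x with
  | zero => simp; rfl
  | add a b ha hb => simp only [tmul_add, map_add, ha, hb]; rfl
  | tmul x₁ x₂ => rfl

lemma dualComul_counit : dualComul D H counit = counit ⊗ₜ counit := by
  refine dualTensor_ext fun s => LinearMap.ext fun t => ?_
  rw [dualTensorHom_dualComul]
  simp [mul_comm]

lemma comul_mk_counit (x : H) : comul (R := D) (mk hS counit x) =
    TensorProduct.map (mk hS counit) (mk hS counit) (comul x) := by
  rw [comul_mk, dualComul_counit]
  induction comul (R := D) x with
  | zero => simp
  | add a b ha hb => simp only [map_add, ha, hb]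
  | tmul x₁ x₂ => rfl

lemma comul_mk_one (p : Dual D H) : comul (R := D) (mk hS p 1) =
    TensorProduct.map ((mk hS).flip 1) ((mk hS).flip 1) (dualComul D H p) := by
  rw [comul_mk, comul_one, Algebra.TensorProduct.one_def]
  induction dualComul D H p with
  | zero => simp
  | add a b ha hb => simp only [map_add, LinearMap.add_apply, ha, hb]
  | tmul x₁ x₂ => rfl

lemma counit_mk (p : Dual D H) (x : H) : counit (R := D) (mk hS p x) = p 1 * counit x :=
  counit_tmul' p x

lemma antipode_mk (p : Dual D H) (x : H) : antipode D (mk hS p x) =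
    mk hS counit (antipode D x) * mk hS (p ∘ₗ antipodeInv hS) 1 := by
  rw [mk_counit_mul]; rfl

lemma antipode_mk_one (p : Dual D H) :
    antipode D (mk hS p 1) = mk hS (p ∘ₗ antipodeInv hS) 1 := by
  rw [antipode_mk, antipode_one, ← one_def, one_mul]

lemma antipode_mk_counit (x : H) : antipode D (mk hS counit x) = mk hS counit (antipode D x) := by
  have : counit (R := D) ∘ₗ antipodeInv hS = counit := by
    ext y
    obtain ⟨z, rfl⟩ := hS.2 y
    simp
  rw [antipode_mk, this, ← one_def, mul_one]

end Generators
end DrinfeldDouble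

namespace DrinfeldDouble

open Module (Dual)
open HopfIntegral

universe u v

/-! ### The canonical R-matrix: hexagons, inverse, intertwining and modularity. -/

section RMatrix

variable {D : Type u} {H : Type v} [CommRing D] [Ring H] [HopfAlgebra D H]
variable (hS : Function.Bijective (antipode D : H →ₗ[D] H))

section
variable {ι : Type*} [Fintype ι] {e : ι → H} {f : ι → Dual D H}

/-- The canonical element corresponds to the identity, so an endomorphism may be moved from one leg
to the other as its transpose. -/
lemma sum_transpose {M : Type*} [AddCommGroup M] [Module D M] (he : ∀ x, ∑ i, f i x • e i = x)
    (B : H →ₗ[D] Dual D H →ₗ[D] M) (T : H →ₗ[D] H) :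
    ∑ i, B (e i) (f i ∘ₗ T) = ∑ i, B (T (e i)) (f i) := by
  have h1 : ∀ i, f i ∘ₗ T = ∑ k, f i (T (e k)) • f k := fun i =>
    (sum_apply_smul_dual he (f i ∘ₗ T)).symm
  have h2 : ∀ k, B (T (e k)) (f k) = ∑ i, f i (T (e k)) • B (e i) (f k) := by
    intro k
    conv_lhs => rw [← he (T (e k))]
    simp only [map_sum, map_smul, LinearMap.sum_apply, LinearMap.smul_apply]
  simp only [h1, h2, map_sum, map_smul]
  exact Finset.sum_comm

variable [Module.Finite D H] [Module.Projective D H]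

lemma sum_dualComul {M : Type*} [AddCommGroup M] [Module D M] (he : ∀ x, ∑ i, f i x • e i = x)
    (C : H →ₗ[D] Dual D H ⊗[D] Dual D H →ₗ[D] M) :
    ∑ i, C (e i) (dualComul D H (f i)) = ∑ a, ∑ b, C (e a * e b) (f b ⊗ₜ f a) := by
  have h1 : ∀ q : Dual D H, dualComul D H q = ∑ a, ∑ b, q (e a * e b) • (f b ⊗ₜ f a) := by
    intro q
    refine dualTensor_ext fun s => LinearMap.ext fun t => ?_
    rw [dualTensorHom_dualComul, lactHom_apply]
    conv_lhs => rw [← he s, ← he t]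
    simp only [Finset.sum_mul, Finset.mul_sum, map_sum, LinearMap.sum_apply, map_smul,
      LinearMap.smul_apply, dualTensorHom_apply, smul_mul_smul_comm, smul_eq_mul]
    rw [Finset.sum_comm]
    refine Finset.sum_congr rfl fun a _ => Finset.sum_congr rfl fun b _ => ?_
    ring
  have h2 : ∀ y, C y = ∑ i, f i y • C (e i) := by
    intro y
    conv_lhs => rw [← he y]
    simp only [map_sum, map_smul]
  have h3 : ∀ a b, C (e a * e b) (f b ⊗ₜ f a) =
      ∑ i, f i (e a * e b) • C (e i) (f b ⊗ₜ f a) := by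
    intro a b
    rw [h2 (e a * e b)]
    simp only [LinearMap.sum_apply, LinearMap.smul_apply]
  simp only [h1, h3, map_sum, map_smul]
  rw [Finset.sum_comm]
  exact Finset.sum_congr rfl fun a _ => Finset.sum_comm

lemma canonicalRMatrix_eq (he : ∀ x, ∑ i, f i x • e i = x) :
    canonicalRMatrix hS = ∑ i, mk hS counit (e i) ⊗ₜ[D] mk hS (f i) 1 := by
  have : (dualTensorHomEquiv D H H).symm LinearMap.id = ∑ i, f i ⊗ₜ[D] e i := by
    rw [LinearEquiv.symm_apply_eq]
    ext x
    simp [he]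
  rw [canonicalRMatrix, this]
  simp

lemma comul_left_canonicalRMatrix :
    TensorProduct.assoc D _ _ _ (comul.rTensor _ (canonicalRMatrix hS)) =
      Algebra.TensorProduct.map (.id D _) (Algebra.TensorProduct.includeRight (R := D))
        (canonicalRMatrix hS) * (1 : DrinfeldDouble D H hS) ⊗ₜ[D] canonicalRMatrix hS := by
  obtain ⟨n, e, f, he⟩ := exists_dualBasis D H
  rw [canonicalRMatrix_eq hS he]
  simp only [map_sum, LinearMap.rTensor_tmul, Algebra.TensorProduct.map_tmul, AlgHom.id_apply,
    Algebra.TensorProduct.includeRight_apply, tmul_sum, Finset.sum_mul, Finset.mul_sum,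
    Algebra.TensorProduct.tmul_mul_tmul, one_mul, mul_one, mk_one_mul_mk, comul_mk_counit]
  let B : H ⊗[D] H →ₗ[D] Dual D H →ₗ[D] DrinfeldDouble D H hS ⊗[D]
      (DrinfeldDouble D H hS ⊗[D] DrinfeldDouble D H hS) :=
    LinearMap.compr₂ ((TensorProduct.mk D _ _).compl₁₂
      (TensorProduct.map (mk hS counit) (mk hS counit)) ((mk hS).flip 1))
      (TensorProduct.assoc D _ _ _).toLinearMap
  refine Eq.trans (sum_convL he B).symm ?_
  exact Finset.sum_comm

lemma comul_right_canonicalRMatrix :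
    comul.lTensor _ (canonicalRMatrix hS) =
      Algebra.TensorProduct.map (.id D _) (Algebra.TensorProduct.includeRight (R := D))
        (canonicalRMatrix hS) *
      Algebra.TensorProduct.map (.id D (DrinfeldDouble D H hS))
        (Algebra.TensorProduct.includeLeft (S := D)) (canonicalRMatrix hS) := by
  obtain ⟨n, e, f, he⟩ := exists_dualBasis D H
  rw [canonicalRMatrix_eq hS he]
  simp only [map_sum, LinearMap.lTensor_tmul, Algebra.TensorProduct.map_tmul, AlgHom.id_apply,
    Algebra.TensorProduct.includeRight_apply, Algebra.TensorProduct.includeLeft_apply,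
    Finset.sum_mul, Finset.mul_sum,
    Algebra.TensorProduct.tmul_mul_tmul, one_mul, mul_one, mk_mul_mk_counit, comul_mk_one]
  let C : H →ₗ[D] Dual D H ⊗[D] Dual D H →ₗ[D] DrinfeldDouble D H hS ⊗[D]
      (DrinfeldDouble D H hS ⊗[D] DrinfeldDouble D H hS) :=
    (TensorProduct.mk D _ _).compl₁₂ (mk hS counit)
      (TensorProduct.map ((mk hS).flip 1) ((mk hS).flip 1))
  refine Eq.trans (sum_dualComul he C) ?_
  exact Finset.sum_comm

/-- `∑ e_a S(e_b) ⊗ f_a f_b` becomes `∑ e' S(e'') ⊗ f` by duality, and the antipode axiom finishes.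
This identity and `map_antipode_canonicalRMatrix` are the extra input for the general theory of the
Drinfeld element. -/
lemma canonicalRMatrix_mul_antipode :
    canonicalRMatrix hS * (antipode D).rTensor _ (canonicalRMatrix hS) = 1 := by
  obtain ⟨n, e, f, he⟩ := exists_dualBasis D H
  rw [canonicalRMatrix_eq hS he]
  simp only [map_sum, LinearMap.rTensor_tmul, Finset.sum_mul, Finset.mul_sum,
    Algebra.TensorProduct.tmul_mul_tmul, antipode_mk_counit, mk_mul_mk_counit, mk_one_mul_mk]
  let B : H ⊗[D] H →ₗ[D] Dual D H →ₗ[D] DrinfeldDouble D H hS ⊗[D] DrinfeldDouble D H hS :=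
    (TensorProduct.mk D _ _).compl₁₂
      (mk hS counit ∘ₗ LinearMap.mul' D H ∘ₗ (antipode D).lTensor H) ((mk hS).flip 1)
  refine Eq.trans Finset.sum_comm (Eq.trans (sum_convL he B) ?_)
  have h1 : ∀ k, B (comul (e k)) (f k) =
      mk hS counit 1 ⊗ₜ mk hS (counit (R := D) (e k) • f k) 1 := by
    intro k
    have : B (comul (e k)) (f k) = mk hS counit (LinearMap.mul' D H
      ((antipode D).lTensor H (comul (e k)))) ⊗ₜ mk hS (f k) 1 := rfl
    rw [this]
    simp [Algebra.algebraMap_eq_smul_one, smul_tmul]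
  simp only [h1]
  rw [← tmul_sum, ← LinearMap.sum_apply, ← map_sum, sum_apply_smul_dual he]
  rfl

lemma antipode_mul_canonicalRMatrix :
    (antipode D).rTensor _ (canonicalRMatrix hS) * canonicalRMatrix hS = 1 := by
  obtain ⟨n, e, f, he⟩ := exists_dualBasis D H
  rw [canonicalRMatrix_eq hS he]
  simp only [map_sum, LinearMap.rTensor_tmul, Finset.sum_mul, Finset.mul_sum,
    Algebra.TensorProduct.tmul_mul_tmul, antipode_mk_counit, mk_mul_mk_counit, mk_one_mul_mk]
  let B : H ⊗[D] H →ₗ[D] Dual D H →ₗ[D] DrinfeldDouble D H hS ⊗[D] DrinfeldDouble D H hS :=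
    (TensorProduct.mk D _ _).compl₁₂
      (mk hS counit ∘ₗ LinearMap.mul' D H ∘ₗ (antipode D).rTensor H) ((mk hS).flip 1)
  refine Eq.trans Finset.sum_comm (Eq.trans (sum_convL he B) ?_)
  have h1 : ∀ k, B (comul (e k)) (f k) =
      mk hS counit 1 ⊗ₜ mk hS (counit (R := D) (e k) • f k) 1 := by
    intro k
    have : B (comul (e k)) (f k) = mk hS counit (LinearMap.mul' D H
      ((antipode D).rTensor H (comul (e k)))) ⊗ₜ mk hS (f k) 1 := rfl
    rw [this]
    simp [Algebra.algebraMap_eq_smul_one, smul_tmul]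
  simp only [h1]
  rw [← tmul_sum, ← LinearMap.sum_apply, ← map_sum, sum_apply_smul_dual he]
  rfl

/-- The antipode acts by `S` on the first leg and by the transpose of `S⁻¹` on the second, and these
cancel in the canonical element. -/
lemma map_antipode_canonicalRMatrix :
    TensorProduct.map (antipode D) (antipode D) (canonicalRMatrix hS) = canonicalRMatrix hS := by
  obtain ⟨n, e, f, he⟩ := exists_dualBasis D H
  rw [canonicalRMatrix_eq hS he]
  simp only [map_sum, map_tmul, antipode_mk_counit, antipode_mk_one]
  let B : H →ₗ[D] Dual D H →ₗ[D] DrinfeldDouble D H hS ⊗[D] DrinfeldDouble D H hS :=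
    (TensorProduct.mk D _ _).compl₁₂ (mk hS counit) ((mk hS).flip 1)
  refine Eq.trans (sum_transpose he (B ∘ₗ antipode D) (antipodeInv hS)) ?_
  refine Finset.sum_congr rfl fun i _ => ?_
  rw [LinearMap.comp_apply, antipode_antipodeInv]
  rfl

end

/-- `(a₁ ⊗ a₂ ⊗ a₃) ⊗ b ↦ a₁ ⊗ a₂ ⊗ b S⁻¹(a₃)`. -/
noncomputable def foldInv : (H ⊗[D] (H ⊗[D] H)) ⊗[D] H →ₗ[D] H ⊗[D] (H ⊗[D] H) :=
  ((mulInv hS).lTensor H).lTensor H ∘ₗ (TensorProduct.assoc D H H H).toLinearMap.lTensor H ∘ₗ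
    (TensorProduct.assoc D H (H ⊗[D] H) H).toLinearMap

@[simp] lemma foldInv_tmul (a₁ a₂ a₃ b : H) : foldInv hS ((a₁ ⊗ₜ (a₂ ⊗ₜ a₃)) ⊗ₜ b) =
    a₁ ⊗ₜ (a₂ ⊗ₜ (b * antipodeInv hS a₃)) := rfl

lemma comul_four : (TensorProduct.assoc D H H H).toLinearMap.lTensor H ∘ₗ
    (TensorProduct.assoc D H (H ⊗[D] H) H).toLinearMap ∘ₗ
    (comul.lTensor H ∘ₗ comul).rTensor H ∘ₗ comul (R := D) (A := H) =
    (comul.lTensor H).lTensor H ∘ₗ comul.lTensor H ∘ₗ comul (R := D) (A := H) := by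
  simp only [coassoc_simps]

/-- `a ⊗ b ⊗ c ↦ (a ⇀ q ↼ S⁻¹(c)) ⊗ b`. -/
noncomputable def actMk (q : Dual D H) : H ⊗[D] (H ⊗[D] H) →ₗ[D] DrinfeldDouble D H hS :=
  (LinearMap.applyₗ (q ⊗ₜ[D] (1 : H)) ∘ₗ (act₃ hS).toLinearMap :
    H ⊗[D] (H ⊗[D] H) →ₗ[D] Dual D H ⊗[D] H)

lemma actMk_tmul (q : Dual D H) (a b c : H) : actMk hS q (a ⊗ₜ (b ⊗ₜ c)) =
    mk hS (q ∘ₗ LinearMap.mulRight D a ∘ₗ LinearMap.mulLeft D (antipodeInv hS c)) b := by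
  change act₃ hS (a ⊗ₜ (b ⊗ₜ c)) (q ⊗ₜ 1) = _
  rw [act₃_eq, mul_one]
  change mk hS _ b = _
  congr 2
  ext z
  simp

lemma mk_counit_mul_mk_one (x : H) (q : Dual D H) :
    mk hS counit x * mk hS q 1 = actMk hS q (comul.lTensor H (comul x)) := by
  rw [mk_counit_mul]; rfl

/-- Evaluation of `a ⊗ b` at `s ⊗ t`. -/
noncomputable def hatPair (s t : H) :
    DrinfeldDouble D H hS ⊗[D] DrinfeldDouble D H hS →ₗ[D] H ⊗[D] H :=
  TensorProduct.map ((hat hS).flip s) ((hat hS).flip t)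

@[simp] lemma hatPair_tmul (s t : H) (v w : DrinfeldDouble D H hS) :
    hatPair hS s t (v ⊗ₜ w) = hat hS v s ⊗ₜ hat hS w t := rfl

variable [Module.Finite D H] [Module.Projective D H]

lemma foldInv_comul (x : H) :
    foldInv hS ((comul.lTensor H ∘ₗ comul).rTensor H (comul x)) =
      ((TensorProduct.mk D H H).flip 1).lTensor H (comul x) := by
  have h1 : mulInv hS ∘ₗ comul = Algebra.linearMap D H ∘ₗ counit := by
    ext x; simp [mulInv_comul]
  have h2 : (mulInv hS).lTensor H ∘ₗ comul.lTensor H ∘ₗ comul =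
      (TensorProduct.mk D H H).flip 1 := by
    rw [← LinearMap.comp_assoc, ← LinearMap.lTensor_comp, h1, LinearMap.lTensor_comp,
      LinearMap.comp_assoc, lTensor_counit_comp_comul]
    ext z
    simp
  have h3 := LinearMap.congr_fun (comul_four (D := D) (H := H)) x
  simp only [LinearMap.comp_apply] at h3
  simp only [foldInv, LinearMap.comp_apply]
  rw [← h2, LinearMap.lTensor_comp, LinearMap.lTensor_comp]
  exact congrArg _ h3

/-- On the right side the cross relation produces `fᵢ` acted on by outer legs of `x`. Transposed to
`eᵢ`, these legs give `x'''' S⁻¹(x''') eᵢ x'`, where the first product collapses to a counit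
(`foldInv_comul`) and leaves the left side. -/
lemma canonicalRMatrix_mul_comul_mk_counit (x : H) :
    canonicalRMatrix hS * comul (mk hS counit x) =
      TensorProduct.comm D _ _ (comul (mk hS counit x)) * canonicalRMatrix hS := by
  obtain ⟨n, e, f, he⟩ := exists_dualBasis D H
  rw [canonicalRMatrix_eq hS he, comul_mk_counit]
  let N : H ⊗[D] (H ⊗[D] H) →ₗ[D] DrinfeldDouble D H hS ⊗[D] DrinfeldDouble D H hS :=
    ∑ i, TensorProduct.map (mk hS counit ∘ₗ LinearMap.mul' D H ∘ₗ
      (LinearMap.mulLeft D (e i)).lTensor H ∘ₗ (TensorProduct.comm D H H).toLinearMap) (mk hS (f i))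
      ∘ₗ (TensorProduct.comm D H (H ⊗[D] H)).toLinearMap ∘ₗ
      (TensorProduct.leftComm D H H H).toLinearMap
  have hN : ∀ a b c, N (a ⊗ₜ (b ⊗ₜ c)) =
      ∑ i, mk hS counit (c * (e i * a)) ⊗ₜ[D] mk hS (f i) b := by
    intro a b c
    simp [N]
  have h1 : ∀ w : H ⊗[D] H, (∑ i, mk hS counit (e i) ⊗ₜ[D] mk hS (f i) 1) *
      TensorProduct.map (mk hS counit) (mk hS counit) w =
        N (((TensorProduct.mk D H H).flip 1).lTensor H w) := by
    intro w
    induction w with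
    | zero => simp
    | add a b ha hb => simp only [map_add, mul_add, ha, hb]
    | tmul a b =>
      rw [LinearMap.lTensor_tmul, LinearMap.flip_apply, mk_apply, hN]
      simp [Finset.sum_mul, Algebra.TensorProduct.tmul_mul_tmul, mk_mul_mk_counit]
  have h2 : ∀ (b : H) (t : H ⊗[D] (H ⊗[D] H)), ∑ i, mk hS counit (b * e i) ⊗ₜ[D]
      actMk hS (f i) t = N (foldInv hS (t ⊗ₜ b)) := by
    intro b t
    induction t with
    | zero => simp
    | add x y hx hy =>
      simp only [add_tmul, map_add, tmul_add, Finset.sum_add_distrib, hx, hy]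
    | tmul a t =>
    induction t with
    | zero => simp
    | add x y hx hy =>
      simp only [add_tmul, map_add, tmul_add, Finset.sum_add_distrib, hx, hy]
    | tmul c d =>
      rw [foldInv_tmul, hN]
      let B : H →ₗ[D] Dual D H →ₗ[D] DrinfeldDouble D H hS ⊗[D] DrinfeldDouble D H hS :=
        (TensorProduct.mk D _ _).compl₁₂ (mk hS counit ∘ₗ LinearMap.mulLeft D b) ((mk hS).flip c)
      simp only [actMk_tmul]
      refine Eq.trans (sum_transpose he B _) (Finset.sum_congr rfl fun i _ => ?_)
      change mk hS counit (b * (antipodeInv hS d * e i * a)) ⊗ₜ[D] mk hS (f i) c = _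
      simp only [mul_assoc]
  have h4 : ∀ w : H ⊗[D] H, TensorProduct.comm D _ _
      (TensorProduct.map (mk hS counit) (mk hS counit) w) *
        (∑ i, mk hS counit (e i) ⊗ₜ[D] mk hS (f i) 1) =
          N (foldInv hS ((comul.lTensor H ∘ₗ comul).rTensor H w)) := by
    intro w
    induction w with
    | zero => simp
    | add a b ha hb => simp only [map_add, add_mul, ha, hb]
    | tmul a b =>
      rw [LinearMap.rTensor_tmul, LinearMap.comp_apply, ← h2]
      simp only [map_tmul, comm_tmul, Finset.mul_sum, Algebra.TensorProduct.tmul_mul_tmul,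
        mk_mul_mk_counit, mk_counit_mul_mk_one]
  rw [h1, h4, foldInv_comul]

lemma hatPair_ext {v w : DrinfeldDouble D H hS ⊗[D] DrinfeldDouble D H hS}
    (h : ∀ s t, hatPair hS s t v = hatPair hS s t w) : v = w := by
  obtain ⟨n, e, f, he⟩ := exists_dualBasis D H
  have h1 : ∀ v : DrinfeldDouble D H hS, ∑ i, mk hS (f i) (hat hS v (e i)) = v := by
    intro v
    refine hat_ext hS fun s => ?_
    conv_rhs => rw [← he s]
    simp
  have h2 : ∀ v : DrinfeldDouble D H hS ⊗[D] DrinfeldDouble D H hS,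
      ∑ i, ∑ j, TensorProduct.map (mk hS (f i)) (mk hS (f j)) (hatPair hS (e i) (e j) v) = v := by
    intro v
    induction v with
    | zero => simp
    | add a b ha hb => simp only [map_add, Finset.sum_add_distrib, ha, hb]
    | tmul a b =>
      conv_rhs => rw [← h1 a, ← h1 b]
      simp only [hatPair_tmul, map_tmul, tmul_sum, sum_tmul]
      exact Finset.sum_comm
  rw [← h2 v, ← h2 w]
  simp only [h]

/-- Both sides are compared as elements of `End(H) ⊗ End(H)`, evaluated at `s ⊗ t`. There the two
legs of `p` recombine to `p(t s)`, and the same collapse by `foldInv_comul` matches the two sides.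
-/
lemma canonicalRMatrix_mul_comul_mk_one (p : Dual D H) :
    canonicalRMatrix hS * comul (mk hS p 1) =
      TensorProduct.comm D _ _ (comul (mk hS p 1)) * canonicalRMatrix hS := by
  obtain ⟨n, e, f, he⟩ := exists_dualBasis D H
  obtain ⟨P, hP⟩ := TensorProduct.exists_finset (dualComul D H p)
  have hpq : ∀ s t, ∑ r ∈ P, r.1 s * r.2 t = p (t * s) := by
    intro s t
    have := LinearMap.congr_fun (dualTensorHom_dualComul p s) t
    rw [hP] at this
    simpa using this
  rw [canonicalRMatrix_eq hS he, comul_mk_one, hP]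
  refine hatPair_ext hS fun s t => ?_
  let K : H ⊗[D] (H ⊗[D] H) →ₗ[D] H := LinearMap.mul' D H ∘ₗ (Algebra.linearMap D H ∘ₗ p ∘ₗ
    LinearMap.mul' D H ∘ₗ TensorProduct.comm D H H).lTensor H ∘ₗ
      ((LinearMap.mulLeft D s).rTensor H).lTensor H ∘ₗ (TensorProduct.leftComm D H H H).toLinearMap
  have hK : ∀ a b c, K (a ⊗ₜ (b ⊗ₜ c)) = p (c * (s * a)) • b := by
    intro a b c
    simp [K, Algebra.algebraMap_eq_smul_one]
  let C : Dual D H × Dual D H → (H ⊗[D] (H ⊗[D] H)) ⊗[D] H →ₗ[D] H := fun r =>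
    (TensorProduct.rid D H).toLinearMap ∘ₗ
      TensorProduct.map (conjMap hS (hat hS (mk hS r.1 1)) s) r.2
  have h1 : ∀ r : Dual D H × Dual D H, ∀ w : H ⊗[D] H,
      conjMap hS (hat hS (mk hS r.1 1)) s (comul.lTensor H (comul (slice₂ r.2 w))) =
        C r ((comul.lTensor H ∘ₗ comul).rTensor H w) := by
    intro r w
    induction w with
    | zero => simp
    | add a b ha hb => simp only [map_add, ha, hb]
    | tmul a b => simp [C]
  have h2 : ∑ r ∈ P, C r = K ∘ₗ foldInv hS := by
    ext a b c d
    have := hpq (antipodeInv hS c * (s * a)) d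
    simp only [AlgebraTensorModule.curry_apply, LinearMap.restrictScalars_self, curry_apply,
      LinearMap.sum_apply, LinearMap.comp_apply, foldInv_tmul, hK, C, map_tmul, conjMap_tmul,
      hat_mk, LinearEquiv.coe_coe, rid_tmul, mul_smul_comm, mul_one, smul_smul]
    rw [← Finset.sum_smul, mul_assoc d, ← this]
    simp only [mul_comm]
  have h3 : ∀ w : H ⊗[D] H, K (((TensorProduct.mk D H H).flip 1).lTensor H w) =
      ∑ r ∈ P, r.2 s • slice₁ r.1 w := by
    intro w
    induction w with
    | zero => simp
    | add a b ha hb => simp only [map_add, smul_add, Finset.sum_add_distrib, ha, hb]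
    | tmul a b =>
      rw [LinearMap.lTensor_tmul, LinearMap.flip_apply, mk_apply, hK, one_mul, ← hpq]
      simp only [Finset.sum_smul, slice₁_tmul, smul_smul, mul_comm]
  have h4 : ∑ r ∈ P, conjMap hS (hat hS (mk hS r.1 1)) s
      (comul.lTensor H (comul (leftHit r.2 t))) = ∑ r ∈ P, r.2 s • rightHit r.1 t := by
    simp only [leftHit_eq_slice, h1, rightHit_eq_slice]
    rw [← h3, ← foldInv_comul hS, ← LinearMap.sum_apply, h2]
    rfl
  have h5 : ∀ r : Dual D H × Dual D H, hatPair hS s t (∑ i, (mk hS counit (e i) ⊗ₜ[D]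
      mk hS (f i) 1) * (mk hS r.1 1 ⊗ₜ mk hS r.2 1)) = conjMap hS (hat hS (mk hS r.1 1)) s
      (comul.lTensor H (comul (leftHit r.2 t))) ⊗ₜ 1 := by
    intro r
    conv_rhs => rw [← he (leftHit r.2 t)]
    simp only [Algebra.TensorProduct.tmul_mul_tmul, map_sum, hatPair_tmul, hat_mk_counit_mul,
      mk_one_mul_mk, hat_mk, convL_eq_leftHit, map_smul, tmul_smul, sum_tmul, smul_tmul']
  have h6 : ∀ r : Dual D H × Dual D H, hatPair hS s t (∑ i, (mk hS r.2 1 ⊗ₜ mk hS r.1 1) *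
      (mk hS counit (e i) ⊗ₜ[D] mk hS (f i) 1)) = (r.2 s • rightHit r.1 t) ⊗ₜ 1 := by
    intro r
    conv_rhs => rw [← he (rightHit r.1 t)]
    simp only [Algebra.TensorProduct.tmul_mul_tmul, map_sum, hatPair_tmul, mk_one_mul_mk_counit]
    simp only [mk_one_mul_mk, hat_mk, convL_eq_rightHit, Finset.smul_sum, tmul_smul,
      sum_tmul, smul_tmul', smul_comm (r.2 s)]
  have h7 : ∀ r : Dual D H × Dual D H, TensorProduct.map ((mk hS).flip 1) ((mk hS).flip 1)
      (r.1 ⊗ₜ[D] r.2) = mk hS r.1 1 ⊗ₜ mk hS r.2 1 := fun r => rfl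
  simp only [map_sum, h7, comm_tmul]
  rw [Finset.mul_sum, Finset.sum_mul]
  simp only [Finset.sum_mul, Finset.mul_sum, map_sum] at h5 h6 ⊢
  simp only [h5, h6, ← sum_tmul, h4]

lemma isUniversalRMatrix_canonicalRMatrix : IsUniversalRMatrix (canonicalRMatrix hS) where
  isUnit := ⟨⟨_, _, canonicalRMatrix_mul_antipode hS, antipode_mul_canonicalRMatrix hS⟩, rfl⟩
  comul_left := comul_left_canonicalRMatrix hS
  comul_right := comul_right_canonicalRMatrix hS
  intertwine := by
    have hc : ∀ s t : DrinfeldDouble D H hS ⊗[D] DrinfeldDouble D H hS,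
        TensorProduct.comm D _ _ (s * t) =
          TensorProduct.comm D _ _ s * TensorProduct.comm D _ _ t :=
      fun s t => map_mul (Algebra.TensorProduct.comm D _ _) s t
    intro v
    induction v using induction_on with
    | mk p x =>
      rw [← mk_one_mul_mk_counit, comul_mul, ← mul_assoc, canonicalRMatrix_mul_comul_mk_one,
        mul_assoc, canonicalRMatrix_mul_comul_mk_counit, hc, mul_assoc]
    | zero => simp
    | add a b ha hb => simp only [map_add, mul_add, add_mul, ha, hb]

/-- `x ⊗ p ↦ (ε ⊗ x)(p ⊗ 1)` is bijective. -/
lemma bijective_mk_counit_mul_mk_one :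
    Function.Bijective (LinearMap.mul' D (DrinfeldDouble D H hS) ∘ₗ
      TensorProduct.map (mk hS counit) ((mk hS).flip 1)) := by
  let T : H ⊗[D] Dual D H ≃ₗ[D] DrinfeldDouble D H hS :=
    (TensorProduct.congr (LinearEquiv.ofBijective (antipode D) hS)
      (LinearEquiv.ofBijective (antipode D) hS).symm.dualMap).symm ≪≫ₗ
        (TensorProduct.comm D H (Dual D H) : H ⊗[D] Dual D H ≃ₗ[D] Dual D H ⊗[D] H)
  have h : LinearMap.mul' D (DrinfeldDouble D H hS) ∘ₗ
      TensorProduct.map (mk hS counit) ((mk hS).flip 1) = antipode D ∘ₗ T.toLinearMap := by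
    apply TensorProduct.ext'
    intro x p
    obtain ⟨y, rfl⟩ := hS.2 x
    obtain ⟨q, rfl⟩ := (LinearEquiv.ofBijective (antipode D) hS).symm.dualMap.surjective p
    have : T (antipode D y ⊗ₜ (LinearEquiv.ofBijective (antipode D) hS).symm.dualMap q) =
        mk hS q y := by
      change TensorProduct.comm D H (Dual D H) ((TensorProduct.congr _ _).symm
        (TensorProduct.congr (LinearEquiv.ofBijective (antipode D) hS)
          (LinearEquiv.ofBijective (antipode D) hS).symm.dualMap (y ⊗ₜ q))) = _
      rw [LinearEquiv.symm_apply_apply]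
      rfl
    rw [LinearMap.comp_apply, LinearMap.comp_apply, LinearEquiv.coe_coe, this, antipode_mk]
    rfl
  rw [h]
  exact (antipode_bijective (D := D) (A := DrinfeldDouble D H hS)).comp T.bijective

/-- Since `R₂₁R = ∑ (fᵢ ⊗ e_j) ⊗ (ε ⊗ eᵢ)(f_j ⊗ 1)`, the map factors as the duality isomorphism `(H*
⊗ H)* → H ⊗ H*` followed by the bijection `x ⊗ p ↦ (ε ⊗ x)(p ⊗ 1)`. -/
lemma bijective_modularMap : Function.Bijective (modularMap (canonicalRMatrix hS)) := by
  obtain ⟨n, e, f, he⟩ := exists_dualBasis D H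
  let T : Dual D (DrinfeldDouble D H hS) →ₗ[D] H ⊗[D] Dual D H :=
    ∑ i, ∑ j, (LinearMap.toSpanSingleton D _ (e i ⊗ₜ[D] f j)) ∘ₗ
      LinearMap.applyₗ (mk hS (f i) (e j))
  have hT : ∀ F, T F = ∑ i, ∑ j, F (mk hS (f i) (e j)) • (e i ⊗ₜ[D] f j) := by
    intro F; simp [T]
  have h1 : modularMap (canonicalRMatrix hS) = (LinearMap.mul' D (DrinfeldDouble D H hS) ∘ₗ
      TensorProduct.map (mk hS counit) ((mk hS).flip 1)) ∘ₗ T := by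
    ext1 F
    rw [LinearMap.comp_apply, hT]
    change TensorProduct.lid D _ (F.rTensor _ (monodromy _)) = _
    rw [monodromy, canonicalRMatrix_eq hS he]
    simp only [map_sum, comm_tmul, Finset.sum_mul, Finset.mul_sum,
      Algebra.TensorProduct.tmul_mul_tmul, mk_one_mul_mk_counit, LinearMap.rTensor_tmul,
      lid_tmul, map_smul]
    exact Finset.sum_comm
  have h2 : Function.Injective T := by
    rw [← LinearMap.ker_eq_bot, LinearMap.ker_eq_bot']
    intro F hF
    ext v
    induction v using induction_on with
    | mk p x =>
      have h3 := congrArg (TensorProduct.lid D D ∘ TensorProduct.map p (Dual.eval D H x)) hF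
      rw [hT] at h3
      simp only [Function.comp_apply, map_sum, map_smul, map_tmul, map_zero, lid_tmul,
        Dual.eval_apply, smul_eq_mul] at h3
      have h4 : mk hS p x = ∑ i, ∑ j, (p (e i) * f j x) • mk hS (f i) (e j) := by
        conv_lhs => rw [← sum_apply_smul_dual he p, ← he x]
        simp only [map_sum, map_smul, LinearMap.sum_apply, LinearMap.smul_apply, Finset.smul_sum,
          smul_smul, mul_comm]
        exact Finset.sum_comm
      rw [h4, LinearMap.zero_apply, ← h3]
      simp only [map_sum, map_smul, smul_eq_mul]
      exact Finset.sum_congr rfl fun i _ => Finset.sum_congr rfl fun j _ => mul_comm _ _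
    | zero => simp
    | add a b ha hb => simp only [map_add, ha, hb]
  have h3 : Function.Surjective T := by
    intro w
    induction w with
    | zero => exact ⟨0, map_zero _⟩
    | add a b ha hb =>
      obtain ⟨F, rfl⟩ := ha
      obtain ⟨G, rfl⟩ := hb
      exact ⟨F + G, map_add _ _ _⟩
    | tmul x q =>
      let F : Dual D (DrinfeldDouble D H hS) :=
        (TensorProduct.lift ((LinearMap.mul D D).compl₁₂ (Dual.eval D H x) q) :
          Dual D H ⊗[D] H →ₗ[D] D)
      refine ⟨F, ?_⟩
      have hF : ∀ p y, F (mk hS p y) = p x * q y := fun p y => rfl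
      rw [hT]
      simp only [hF]
      conv_rhs => rw [← he x, ← sum_apply_smul_dual he q]
      simp only [tmul_sum, sum_tmul, smul_tmul_smul]
      exact Finset.sum_comm
  rw [h1]
  exact (bijective_mk_counit_mul_mk_one hS).comp ⟨h2, h3⟩

end RMatrix
end DrinfeldDouble

namespace HopfIntegral

open Module (Dual)
open DrinfeldDouble

universe u v

/-! ### The Drinfeld element of a quasi-triangular Hopf algebra and ribbon elements. -/

section Quasitriangular

variable {D : Type u} {A : Type v} [CommRing D] [Ring A] [HopfAlgebra D A]

variable (D A) in
/-- `a ⊗ b ↦ S(b) a`. -/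
def antipodeFold : A ⊗[D] A →ₗ[D] A :=
  LinearMap.mul' D A ∘ₗ (antipode D).rTensor A ∘ₗ (TensorProduct.comm D A A).toLinearMap

lemma antipodeFold_tmul (a b : A) : antipodeFold D A (a ⊗ₜ b) = antipode D b * a := rfl

lemma drinfeldElement_eq (R : A ⊗[D] A) : drinfeldElement R = antipodeFold D A R := rfl

lemma antipodeFold_mul_tmul (R : A ⊗[D] A) (a b : A) :
    antipodeFold D A (R * (a ⊗ₜ b)) = antipode D b * antipodeFold D A R * a := by
  induction R with
  | zero => simp
  | add s t hs ht => simp only [add_mul, mul_add, map_add, hs, ht]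
  | tmul x y => simp [antipodeFold_tmul, antipode_mul_antidistrib, mul_assoc]

lemma antipodeFold_comm_comul_mul (R : A ⊗[D] A) (x : A) :
    antipodeFold D A (TensorProduct.comm D A A (comul x) * R) =
      counit (R := D) x • antipodeFold D A R := by
  have h : ∀ (t : A ⊗[D] A) (a b : A), antipodeFold D A (TensorProduct.comm D A A t * (a ⊗ₜ b)) =
      antipode D b * LinearMap.mul' D A ((antipode D).rTensor A t) * a := by
    intro t a b
    induction t with
    | zero => simp
    | add s t hs ht => simp only [add_mul, mul_add, map_add, hs, ht]
    | tmul x y => simp [antipodeFold_tmul, antipode_mul_antidistrib, mul_assoc]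
  induction R with
  | zero => simp
  | add s t hs ht => simp only [mul_add, map_add, hs, ht, smul_add]
  | tmul a b =>
    rw [h, mul_antipode_rTensor_comul_apply, antipodeFold_tmul, Algebra.algebraMap_eq_smul_one]
    simp

variable {R : A ⊗[D] A}

/-- Folding `a ⊗ b` to `S(b) a` turns `RΔ(x)` into the left side and `Δᵒᵖ(x)R` into the right side.
-/
lemma _root_.IsUniversalRMatrix.sum_antipode_mul_drinfeldElement_mul (hR : IsUniversalRMatrix R)
    {x : A} {I : Type*} (r : Repr D x I) :
    ∑ i ∈ r.index, antipode D (r.right i) * drinfeldElement R * r.left i =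
      counit (R := D) x • drinfeldElement R := by
  rw [drinfeldElement_eq, ← antipodeFold_comm_comul_mul, ← hR.intertwine, ← r.eq, Finset.mul_sum,
    map_sum]
  simp only [antipodeFold_mul_tmul]

/-- The square of the antipode of a quasi-triangular Hopf algebra is inner. -/
lemma _root_.IsUniversalRMatrix.antipode_sq_mul (hR : IsUniversalRMatrix R) (x : A) :
    antipode D (antipode D x) * drinfeldElement R = drinfeldElement R * x := by
  set u := drinfeldElement R with hu
  -- In `∑ S(x'') u x'` the factors stand in the order opposite to that of the legs of `x`, so the
  -- identity is a convolution product in the opposite algebra, where it is multiplied by the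
  -- convolution inverse of `S`.
  let o : A →ₗ[D] Aᵐᵒᵖ := (MulOpposite.opLinearEquiv D).toLinearMap
  have ho : ∀ a, o a = MulOpposite.op a := fun _ => rfl
  let F : WithConv (A →ₗ[D] Aᵐᵒᵖ) := WithConv.toConv (o ∘ₗ LinearMap.mulLeft D u)
  let G : WithConv (A →ₗ[D] Aᵐᵒᵖ) := WithConv.toConv (o ∘ₗ antipode D)
  let K : WithConv (A →ₗ[D] Aᵐᵒᵖ) := WithConv.toConv (o ∘ₗ antipode D ∘ₗ antipode D)
  let C : WithConv (A →ₗ[D] Aᵐᵒᵖ) :=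
    WithConv.toConv (LinearMap.toSpanSingleton D Aᵐᵒᵖ (o u) ∘ₗ counit)
  have hFG : F * G = C := convMul_ext fun x r => by
    have := congrArg o (hR.sum_antipode_mul_drinfeldElement_mul r)
    simpa [F, G, C, ho, ← MulOpposite.op_mul, ← hu, mul_assoc] using this
  have hGK : G * K = 1 := convMul_ext fun x r => by
    have := congrArg (fun y => o (antipode D y)) (sum_mul_antipode_eq_smul (R := D) r)
    simpa [G, K, ho, antipode_mul_antidistrib, LinearMap.convOne_def,
      Algebra.algebraMap_eq_smul_one] using this
  have hCK : C * K =
      WithConv.toConv (o ∘ₗ LinearMap.mulRight D u ∘ₗ antipode D ∘ₗ antipode D) :=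
    convMul_ext fun x r => by
      have := congrArg (fun y => o (antipode D (antipode D y) * u)) (sum_counit_smul r)
      simpa [C, K, ho, Finset.sum_mul] using this
  have h := congrArg WithConv.ofConv
    (((mul_one F).symm.trans (congrArg (F * ·) hGK.symm)).trans
      ((mul_assoc F G K).symm.trans ((congrArg (· * K) hFG).trans hCK)))
  exact MulOpposite.op_injective (LinearMap.congr_fun h x).symm

/-- `∑ fᵢ S²(eᵢ)`, the inverse of the Drinfeld element. -/
def drinfeldInv (R : A ⊗[D] A) : A :=
  LinearMap.mul' D A ((antipode D ∘ₗ antipode D).lTensor A (TensorProduct.comm D A A R))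

lemma exists_sum_tmul (R : A ⊗[D] A) :
    ∃ (n : ℕ) (e f : Fin n → A), R = ∑ i, e i ⊗ₜ f i := by
  obtain ⟨s, hs⟩ := TensorProduct.exists_finset R
  refine ⟨s.card, fun i => (s.equivFin.symm i).1.1, fun i => (s.equivFin.symm i).1.2, ?_⟩
  rw [hs, ← Finset.sum_coe_sort]
  exact (Equiv.sum_comp s.equivFin.symm fun i : s => i.1.1 ⊗ₜ[D] i.1.2).symm

/-- This says `∑ fᵢ u eᵢ = 1`. Folding `h₁` gives `∑ S(fᵢ) u S(eᵢ) = 1`, and `h₂` removes both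
antipodes. Moving `u` past `eᵢ` by `S²` then shows that `∑ fᵢ S²(eᵢ)` inverts `u`. -/
lemma sum_mul_drinfeldElement_mul (h₁ : R * (antipode D).rTensor A R = 1)
    (h₂ : TensorProduct.map (antipode D) (antipode D) R = R) :
    LinearMap.mul' D A ((LinearMap.mulRight D (drinfeldElement R)).rTensor A
      (TensorProduct.comm D A A R)) = 1 := by
  have h3 := congrArg (antipodeFold D A) h₁
  rw [Algebra.TensorProduct.one_def, antipodeFold_tmul, antipode_one, mul_one] at h3
  have h4 : ∀ t : A ⊗[D] A, LinearMap.mul' D A ((LinearMap.mulRight D (drinfeldElement R)).rTensor A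
      (TensorProduct.comm D A A (TensorProduct.map (antipode D) (antipode D) t))) =
        antipodeFold D A (R * (antipode D).rTensor A t) := by
    intro t
    induction t with
    | zero => simp
    | add s t hs ht => simp only [mul_add, map_add, hs, ht]
    | tmul a b => simp [antipodeFold_mul_tmul, drinfeldElement_eq]
  rw [← h3, ← h4, h₂]

lemma drinfeldInv_mul (hR : IsUniversalRMatrix R) (h₁ : R * (antipode D).rTensor A R = 1)
    (h₂ : TensorProduct.map (antipode D) (antipode D) R = R) :
    drinfeldInv R * drinfeldElement R = 1 := by
  have h : ∀ t : A ⊗[D] A, LinearMap.mul' D A ((antipode D ∘ₗ antipode D).lTensor A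
      (TensorProduct.comm D A A t)) * drinfeldElement R =
        LinearMap.mul' D A ((LinearMap.mulRight D (drinfeldElement R)).rTensor A
          (TensorProduct.comm D A A t)) := by
    intro t
    induction t with
    | zero => simp
    | add s t hs ht => simp only [add_mul, map_add, hs, ht]
    | tmul a b => simp [mul_assoc, hR.antipode_sq_mul]
  rw [← sum_mul_drinfeldElement_mul h₁ h₂, ← h, drinfeldInv]

lemma mul_drinfeldInv (hR : IsUniversalRMatrix R) (h₁ : R * (antipode D).rTensor A R = 1)
    (h₂ : TensorProduct.map (antipode D) (antipode D) R = R) :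
    drinfeldElement R * drinfeldInv R = 1 := by
  have h : ∀ t : A ⊗[D] A, drinfeldElement R * LinearMap.mul' D A
      ((antipode D ∘ₗ antipode D).lTensor A (TensorProduct.comm D A A t)) =
        LinearMap.mul' D A ((LinearMap.mulRight D (drinfeldElement R)).rTensor A
          (TensorProduct.comm D A A (TensorProduct.map (antipode D) (antipode D)
            (TensorProduct.map (antipode D) (antipode D) t)))) := by
    intro t
    induction t with
    | zero => simp
    | add s t hs ht => simp only [mul_add, map_add, hs, ht]
    | tmul a b => simp [← mul_assoc, hR.antipode_sq_mul]
  rw [← sum_mul_drinfeldElement_mul h₁ h₂, drinfeldInv, h, h₂, h₂]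

lemma drinfeldInv_mul_antipode_sq (hR : IsUniversalRMatrix R)
    (h₁ : R * (antipode D).rTensor A R = 1)
    (h₂ : TensorProduct.map (antipode D) (antipode D) R = R) (x : A) :
    drinfeldInv R * antipode D (antipode D x) = x * drinfeldInv R := by
  rw [← mul_one (drinfeldInv R * _), ← mul_drinfeldInv hR h₁ h₂, mul_assoc,
    ← mul_assoc _ (drinfeldElement R), hR.antipode_sq_mul, ← mul_assoc, ← mul_assoc,
    drinfeldInv_mul hR h₁ h₂, one_mul]

variable {ι : Type*} [Fintype ι] {e f : ι → A}

lemma drinfeldInv_eq (he : R = ∑ i, e i ⊗ₜ f i) :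
    drinfeldInv R = ∑ i, f i * antipode D (antipode D (e i)) := by
  simp [drinfeldInv, he]

lemma _root_.IsUniversalRMatrix.sum_comul_left {M : Type*} [AddCommGroup M] [Module D M]
    (hR : IsUniversalRMatrix R) (he : R = ∑ i, e i ⊗ₜ f i) (B : A ⊗[D] A →ₗ[D] A →ₗ[D] M) :
    ∑ i, B (comul (e i)) (f i) = ∑ a, ∑ b, B (e a ⊗ₜ e b) (f a * f b) := by
  have h := congrArg (TensorProduct.lift B ∘ (TensorProduct.assoc D A A A).symm) hR.comul_left
  simp only [Function.comp_apply, LinearEquiv.symm_apply_apply, he, map_sum,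
    LinearMap.rTensor_tmul, lift.tmul, Algebra.TensorProduct.map_tmul, Finset.sum_mul, tmul_sum,
    Finset.mul_sum, Algebra.TensorProduct.tmul_mul_tmul,
    Algebra.TensorProduct.includeRight_apply, AlgHom.id_apply, mul_one, one_mul] at h
  exact h.trans Finset.sum_comm

lemma _root_.IsUniversalRMatrix.sum_comul_right {M : Type*} [AddCommGroup M] [Module D M]
    (hR : IsUniversalRMatrix R) (he : R = ∑ i, e i ⊗ₜ f i) (B : A →ₗ[D] A ⊗[D] A →ₗ[D] M) :
    ∑ i, B (e i) (comul (f i)) = ∑ a, ∑ b, B (e a * e b) (f b ⊗ₜ f a) := by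
  have h := congrArg (TensorProduct.lift B) hR.comul_right
  simp only [he, map_sum,
    LinearMap.lTensor_tmul, lift.tmul, Algebra.TensorProduct.map_tmul, Finset.sum_mul,
    Finset.mul_sum, Algebra.TensorProduct.tmul_mul_tmul, Algebra.TensorProduct.includeLeft_apply,
    Algebra.TensorProduct.includeRight_apply, AlgHom.id_apply, mul_one, one_mul] at h
  exact h.trans Finset.sum_comm

lemma comul_antipode_sq (x : A) : comul (R := D) (antipode D (antipode D x)) =
    TensorProduct.map (antipode D ∘ₗ antipode D) (antipode D ∘ₗ antipode D) (comul x) := by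
  rw [comul_antipode, comul_antipode]
  induction comul (R := D) x with
  | zero => simp
  | add s t hs ht => simp only [map_add, hs, ht]
  | tmul a b => simp

/-- Expanding `Δ(∑ fᵢ S²(eᵢ))` by the hexagons leaves inner sums equal to the inverse Drinfeld
element `v`, which passes to the right of the other factors because `v S²(x) = x v`. The first
contraction produces `R₂₁`, the second `R`. -/
lemma comul_drinfeldInv (hR : IsUniversalRMatrix R) (h₁ : R * (antipode D).rTensor A R = 1)
    (h₂ : TensorProduct.map (antipode D) (antipode D) R = R) :
    comul (drinfeldInv R) = monodromy R * (drinfeldInv R ⊗ₜ[D] drinfeldInv R) := by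
  obtain ⟨n, e, f, he⟩ := exists_sum_tmul R
  set v := drinfeldInv R with hv
  have hve := drinfeldInv_eq he
  let s : A →ₗ[D] A := antipode D ∘ₗ antipode D
  have hs : ∀ x, antipode D (antipode D x) = s x := fun _ => rfl
  have hsm : ∀ x y, s (x * y) = s x * s y := fun x y => by simp [s, antipode_mul_antidistrib]
  let M : A ⊗[D] A →ₗ[D] A ⊗[D] A →ₗ[D] A ⊗[D] A := LinearMap.mul D (A ⊗[D] A)
  have h3 := hR.sum_comul_left he (M.flip.compl₁₂ (TensorProduct.map s s) comul)
  have h4 : ∀ a, _ := fun a => hR.sum_comul_right he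
    (M.flip.compl₁₂ (TensorProduct.mk D A A (s (e a)) ∘ₗ s) .id)
  have h5 := hR.sum_comul_right he
    (M.flip.compl₁₂ ((TensorProduct.mk D A A).flip 1 ∘ₗ s) (TensorProduct.comm D A A).toLinearMap)
  -- The flipped intertwining relation; it moves `R₂₁`, which arises in the middle of the product,
  -- to the far left.
  have h6 : ∀ x : A, comul x * TensorProduct.comm D A A R =
      TensorProduct.comm D A A R * TensorProduct.comm D A A (comul x) := by
    intro x
    have := congrArg (Algebra.TensorProduct.comm D A A) (hR.intertwine x)
    rw [map_mul, map_mul] at this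
    refine Eq.trans ?_ this.symm
    congr 1
    exact ((TensorProduct.comm D A A).symm_apply_apply (comul x)).symm
  simp only [LinearMap.compl₁₂_apply, LinearMap.flip_apply, LinearMap.mul_apply', M, comul_mul,
    map_tmul, LinearMap.comp_apply, mk_apply, LinearMap.id_apply, hsm, LinearEquiv.coe_coe,
    comm_tmul, Algebra.TensorProduct.tmul_mul_tmul, mul_one] at h3 h4 h5
  have h7 : comul (R := D) v = ∑ i, comul (f i) * TensorProduct.map s s (comul (e i)) := by
    rw [hv, hve, map_sum]
    simp only [comul_mul, comul_antipode_sq, s]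
  have h8 : ∀ b, ∑ x, f x * (s (e x) * s (e b)) = e b * v := by
    intro b
    simp only [← mul_assoc, ← Finset.sum_mul]
    rw [← drinfeldInv_mul_antipode_sq hR h₁ h₂, hve]
    rfl
  have h9 : ∀ a, ∑ x, ∑ b, (f b * s (e a)) ⊗ₜ[D] (f x * (s (e x) * s (e b))) =
      TensorProduct.comm D A A R * ((s (e a) ⊗ₜ[D] 1) * (1 ⊗ₜ[D] v)) := by
    intro a
    rw [Finset.sum_comm]
    simp only [← tmul_sum, h8, he, map_sum, comm_tmul, Finset.sum_mul,
      Algebra.TensorProduct.tmul_mul_tmul, mul_one, one_mul]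
  have h10 : ∑ x, ∑ b, (f x * (s (e x) * s (e b))) ⊗ₜ[D] f b = R * (v ⊗ₜ[D] 1) := by
    rw [Finset.sum_comm]
    simp only [← sum_tmul, h8, he, Finset.sum_mul, Algebra.TensorProduct.tmul_mul_tmul, mul_one]
  rw [h7, h3]
  simp only [mul_assoc, ← Finset.mul_sum, h4, h9]
  simp only [← mul_assoc, h6, ← Finset.sum_mul]
  simp only [mul_assoc (TensorProduct.comm D A A R), ← Finset.mul_sum, h5, h10]
  rw [monodromy]
  simp only [mul_assoc, Algebra.TensorProduct.tmul_mul_tmul, mul_one, one_mul]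

/-- With `r = uκ⁻¹`, centrality holds because `u` and `κ` implement the same automorphism `S²`.
`S(r) = κ S(u)` equals `r` by the formula for `κ²`, and group-likeness of `κ` carries the coproduct
formula for `u⁻¹` over to `r⁻¹ = u⁻¹κ`. -/
lemma _root_.IsBalancingElement.exists_ribbon (hR : IsUniversalRMatrix R)
    (h₁ : R * (antipode D).rTensor A R = 1)
    (h₂ : TensorProduct.map (antipode D) (antipode D) R = R) {κ : A}
    (hκ : IsBalancingElement R κ) :
    ∃ r : Aˣ, (r : A) = drinfeldElement R * antipode D κ ∧
      (↑r⁻¹ : A) = drinfeldInv R * κ ∧ IsRibbonElement R r ∧ r * κ = drinfeldElement R := by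
  have hk := hκ.isGroupLikeElem
  have hl : antipode D κ * κ = 1 := hk.antipode_mul_cancel
  have hr : κ * antipode D κ = 1 := hk.mul_antipode_cancel
  have hvu := drinfeldInv_mul hR h₁ h₂
  have huv := mul_drinfeldInv hR h₁ h₂
  have hsq := hR.antipode_sq_mul κ
  rw [hk.antipode_antipode] at hsq
  have hsq' : antipode D κ * drinfeldElement R = drinfeldElement R * antipode D κ := by
    have := congrArg (fun x => antipode D κ * x * antipode D κ) hsq
    simp only [mul_assoc, hr, mul_one] at this
    rw [← this, ← mul_assoc, hl, one_mul]
  have hvk : κ * drinfeldInv R = drinfeldInv R * κ := by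
    have := congrArg (fun x => drinfeldInv R * x * drinfeldInv R) hsq
    simp only [mul_assoc, huv, mul_one] at this
    rw [this, ← mul_assoc, hvu, one_mul]
  let r : Aˣ := ⟨drinfeldElement R * antipode D κ, drinfeldInv R * κ,
    by rw [← hvk, mul_assoc, ← mul_assoc (antipode D κ), hl, one_mul, huv],
    by rw [← hsq', mul_assoc, ← mul_assoc κ, hr, one_mul, hvu]⟩
  have hc : ∀ x : A, (r : A) * x = x * r := by
    intro x
    change drinfeldElement R * antipode D κ * x = x * (drinfeldElement R * antipode D κ)
    have := congrArg (fun y => antipode D κ * y * antipode D κ) (hκ.antipode_sq x)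
    simp only [mul_assoc, hr, mul_one] at this
    rw [← mul_assoc (antipode D κ), hl, one_mul] at this
    rw [← hsq', ← mul_assoc x, ← this, mul_assoc, ← hR.antipode_sq_mul]
    simp only [mul_assoc]
  refine ⟨r, rfl, rfl, ⟨hc, ?_, ?_⟩, ?_⟩
  · change antipode D (drinfeldElement R * antipode D κ) = drinfeldElement R * antipode D κ
    have := congrArg (antipode D κ * ·) hκ.sq_mul
    simp only [← mul_assoc, hl, one_mul] at this
    rw [antipode_mul_antidistrib, hk.antipode_antipode, this, hsq']
  · have hcc : ∀ t : A ⊗[D] A, ((r : A) ⊗ₜ[D] (r : A)) * t = t * ((r : A) ⊗ₜ[D] (r : A)) := by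
      intro t
      induction t with
      | zero => simp
      | add s t hs ht => rw [mul_add, add_mul, hs, ht]
      | tmul a b => rw [Algebra.TensorProduct.tmul_mul_tmul, hc, hc,
          Algebra.TensorProduct.tmul_mul_tmul]
    rw [hcc]
    change _ = comul (drinfeldInv R * κ) * _
    rw [comul_mul, comul_drinfeldInv hR h₁ h₂, hk.comul_eq_tmul_self, mul_assoc, mul_assoc,
      Algebra.TensorProduct.tmul_mul_tmul, Algebra.TensorProduct.tmul_mul_tmul, ← mul_assoc]
    have : drinfeldInv R * κ * (r : A) = 1 := r.inv_mul
    rw [this, ← Algebra.TensorProduct.one_def, mul_one]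
  · change drinfeldElement R * antipode D κ * κ = _
    rw [mul_assoc, hl, mul_one]

end Quasitriangular
end HopfIntegral

namespace DrinfeldDouble

open Module (Dual)
open HopfIntegral

universe u v

/-! ### The balancing element `β ⊗ l` of the double. -/

section Balancing

variable {D : Type u} {H : Type v} [CommRing D] [Ring H] [HopfAlgebra D H]
variable (hS : Function.Bijective (antipode D : H →ₗ[D] H))

lemma _root_.IsGroupLikeElem.antipodeInv_eq {l : H} (hl : IsGroupLikeElem D l) :
    antipodeInv hS l = antipode D l := by
  apply hS.1
  rw [antipode_antipodeInv, hl.antipode_antipode]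

lemma antipodeInv_groupLike_mul {g : H} (hg : IsGroupLikeElem D g) (x : H) :
    antipodeInv hS (g * x) = antipodeInv hS x * antipode D g := by
  rw [antipodeInv_mul, hg.antipodeInv_eq]

lemma hat_groupLike_mul {l : H} (hl : IsGroupLikeElem D l) (v : DrinfeldDouble D H hS) (s : H) :
    hat hS (mk hS counit l * v) s = l * hat hS v (antipode D l * (s * l)) := by
  rw [hat_mk_counit_mul, hl.comul_eq_tmul_self, LinearMap.lTensor_tmul, hl.comul_eq_tmul_self,
    conjMap_tmul, hl.antipodeInv_eq]

lemma _root_.HopfIntegral.BalancingData.comp_antipodeInv {α β : H →ₐ[D] D} {g l : H}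
    (h : BalancingData α β g l) :
    β.toLinearMap ∘ₗ antipodeInv hS = β.toLinearMap ∘ₗ antipode D := by
  ext x
  obtain ⟨y, rfl⟩ := hS.2 x
  simp [h.apply_antipode_sq]

lemma conjMap_algHom (β : H →ₐ[D] D) (y s : H) (t : H ⊗[D] (H ⊗[D] H)) :
    conjMap hS (hat hS (mk hS β.toLinearMap y)) s t = β s • (slice₁ β.toLinearMap
      ((slice₂ (β.toLinearMap ∘ₗ antipodeInv hS)).lTensor H t) * y) := by
  induction t with
  | zero => simp
  | add a b ha hb => simp only [map_add, add_mul, smul_add, ha, hb]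
  | tmul a t =>
  induction t with
  | zero => simp
  | add a b ha hb => simp only [tmul_add, map_add, add_mul, smul_add, ha, hb]
  | tmul b c =>
    simp only [conjMap_tmul, hat_mk, AlgHom.toLinearMap_apply, map_mul, LinearMap.lTensor_tmul,
      slice₂_tmul, slice₁_tmul, LinearMap.comp_apply, mul_smul_comm, smul_mul_assoc, smul_smul]
    congr 1
    ring

lemma slice₁_lTensor (p : Dual D H) (T : H →ₗ[D] H) (t : H ⊗[D] H) :
    slice₁ p (T.lTensor H t) = T (slice₁ p t) := by
  induction t with
  | zero => simp
  | add a b ha hb => simp only [map_add, ha, hb]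
  | tmul a t => simp

lemma hat_mk_counit_mul_mk_algHom (β : H →ₐ[D] D) (x y s : H) :
    hat hS (mk hS counit x * mk hS β.toLinearMap y) s =
      β s • (leftHit (β.toLinearMap ∘ₗ antipodeInv hS) (rightHit β.toLinearMap x) * y) := by
  rw [hat_mk_counit_mul, conjMap_algHom, ← LinearMap.comp_apply (LinearMap.lTensor H _),
    ← LinearMap.lTensor_comp, slice₁_lTensor, rightHit_eq_slice]
  rfl

/-- `(a₁ ⊗ a₂ ⊗ a₃) ⊗ b ↦ a₁ ⊗ a₂ ⊗ a₃ S(α ⇀ b)`. -/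
def foldHit (α : H →ₐ[D] D) : (H ⊗[D] (H ⊗[D] H)) ⊗[D] H →ₗ[D] H ⊗[D] (H ⊗[D] H) :=
  ((LinearMap.mul' D H ∘ₗ (antipode D ∘ₗ leftHit α.toLinearMap).lTensor H).lTensor H).lTensor H ∘ₗ
    (TensorProduct.assoc D H H H).toLinearMap.lTensor H ∘ₗ
    (TensorProduct.assoc D H (H ⊗[D] H) H).toLinearMap

lemma foldHit_tmul (α : H →ₐ[D] D) (a₁ a₂ a₃ b : H) : foldHit α ((a₁ ⊗ₜ (a₂ ⊗ₜ a₃)) ⊗ₜ b) =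
    a₁ ⊗ₜ (a₂ ⊗ₜ (a₃ * antipode D (leftHit α.toLinearMap b))) := rfl

lemma comul_leftHit (p : Dual D H) (x : H) :
    comul (R := D) (leftHit p x) = (leftHit p).lTensor H (comul x) := by
  have h1 : ∀ t : H ⊗[D] H, comul (R := D) (slice₂ p t) =
      (slice₂ p).lTensor H (TensorProduct.assoc D H H H (comul.rTensor H t)) := by
    intro t
    induction t with
    | zero => simp
    | add a b ha hb => simp only [map_add, ha, hb]
    | tmul a b =>
      rw [slice₂_tmul, map_smul, LinearMap.rTensor_tmul]
      induction comul (R := D) a with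
      | zero => simp
      | add a b ha hb => simp only [add_tmul, map_add, smul_add, ha, hb]
      | tmul a b => simp
  rw [leftHit_eq_slice, h1, coassoc_apply, ← LinearMap.comp_apply, ← LinearMap.lTensor_comp]
  rfl

/-- The antipode axiom cancels the third leg against the fourth, leaving only the action of `α`.
This collapse finishes the reordering in the computation of `S_D(u)`. -/
lemma foldHit_comul (α : H →ₐ[D] D) (x : H) :
    foldHit α ((comul.lTensor H ∘ₗ comul).rTensor H (comul x)) =
      ((TensorProduct.mk D H H).flip 1).lTensor H (comul (leftHit α.toLinearMap x)) := by
  have h1 : (LinearMap.mul' D H ∘ₗ (antipode D ∘ₗ leftHit α.toLinearMap).lTensor H) ∘ₗ comul =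
      LinearMap.toSpanSingleton D H 1 ∘ₗ α.toLinearMap := by
    ext x
    rw [LinearMap.comp_apply, LinearMap.comp_apply, LinearMap.lTensor_comp, LinearMap.comp_apply,
      ← comul_leftHit, mul_antipode_lTensor_comul_apply, Algebra.algebraMap_eq_smul_one]
    have := convL_eq_leftHit counit α.toLinearMap x
    rw [counit_convL] at this
    rw [← this]
    rfl
  have h2 : (LinearMap.mul' D H ∘ₗ (antipode D ∘ₗ leftHit α.toLinearMap).lTensor H).lTensor H ∘ₗ
      comul.lTensor H ∘ₗ comul = (TensorProduct.mk D H H).flip 1 ∘ₗ leftHit α.toLinearMap := by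
    rw [← LinearMap.comp_assoc, ← LinearMap.lTensor_comp, h1]
    ext z
    rw [LinearMap.comp_apply, LinearMap.comp_apply, leftHit_eq_slice]
    induction comul (R := D) z with
    | zero => simp
    | add a b ha hb => simp only [map_add, ha, hb]
    | tmul a b => simp
  have h3 := LinearMap.congr_fun (comul_four (D := D) (H := H)) x
  simp only [LinearMap.comp_apply] at h3
  rw [foldHit]
  generalize LinearMap.mul' D H ∘ₗ (antipode D ∘ₗ leftHit α.toLinearMap).lTensor H = E at *
  simp only [LinearMap.comp_apply]
  rw [comul_leftHit, ← LinearMap.comp_apply (LinearMap.lTensor H ((TensorProduct.mk D H H).flip 1)),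
    ← LinearMap.lTensor_comp, ← h2, LinearMap.lTensor_comp, LinearMap.lTensor_comp]
  exact congrArg _ h3

variable [Module.Finite D H] [Module.Projective D H]

lemma dualComul_algHom (β : H →ₐ[D] D) :
    dualComul D H β.toLinearMap = β.toLinearMap ⊗ₜ β.toLinearMap := by
  refine dualTensor_ext fun s => LinearMap.ext fun t => ?_
  rw [dualTensorHom_dualComul]
  simp [mul_comm]

lemma isGroupLikeElem_mk (β : H →ₐ[D] D) {l : H} (hl : IsGroupLikeElem D l) :
    IsGroupLikeElem D (mk hS β.toLinearMap l) where
  counit_eq_one := by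
    rw [counit_mk, hl.counit_eq_one]
    simp
  comul_eq_tmul_self := by
    rw [comul_mk, dualComul_algHom, hl.comul_eq_tmul_self]
    rfl

/-- The terms of `u` are `(fᵢ ∘ S⁻¹) ⊗ eᵢ`, already in the standard order, so the dual-basis sum is
evaluated at once. For `S_D(u)` the factors come in the other order, which is why it needs
integrals. -/
lemma hat_drinfeldElement (s : H) :
    hat hS (drinfeldElement (canonicalRMatrix hS)) s = antipodeInv hS s := by
  obtain ⟨n, e, f, he⟩ := exists_dualBasis D H
  rw [drinfeldElement_eq, canonicalRMatrix_eq hS he]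
  simp only [map_sum, antipodeFold_tmul, antipode_mk_one, mk_one_mul_mk_counit, LinearMap.sum_apply,
    hat_mk, LinearMap.comp_apply]
  exact he _

lemma hat_drinfeldInv (s : H) :
    hat hS (drinfeldInv (canonicalRMatrix hS)) s = antipode D (antipode D s) := by
  obtain ⟨n, e, f, he⟩ := exists_dualBasis D H
  rw [drinfeldInv_eq (canonicalRMatrix_eq hS he)]
  simp only [map_sum, antipode_mk_counit, mk_one_mul_mk_counit, LinearMap.sum_apply, hat_mk,
    ← map_smul]
  simp only [← map_sum, he]

variable {α β : H →ₐ[D] D} {g l : H}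

lemma mk_mul_mk_self (h : BalancingData α β g l) :
    mk hS β.toLinearMap l * mk hS β.toLinearMap l = mk hS α.toLinearMap g := by
  refine hat_ext hS fun s => ?_
  conv_lhs => rw [← mk_one_mul_mk_counit hS β.toLinearMap l, mul_assoc, mk_one_mul_mk_counit]
  have hl : β (antipode D l) * β l = 1 := by
    rw [← map_mul, h.isGroupLikeElem.antipode_mul_cancel, map_one]
  rw [hat_mk_one_mul, hat_groupLike_mul hS h.isGroupLikeElem, hat_mk, hat_mk, mul_smul_comm,
    h.sq_right, ← h.sq_left, convL_eq_rightHit]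
  congr 1
  simp only [AlgHom.toLinearMap_apply, map_mul]
  rw [mul_left_comm, hl, mul_one]

/-- The square of the antipode of the double is conjugation by `β ⊗ l`. -/
lemma antipode_sq_mul_mk (h : BalancingData α β g l) (a : DrinfeldDouble D H hS) :
    antipode D (antipode D a) * mk hS β.toLinearMap l = mk hS β.toLinearMap l * a := by
  have hl := h.isGroupLikeElem
  -- Both maps being multiplicative, it suffices to treat the two kinds of generators; in each case
  -- the claim reduces to `S²(x ↼ β) l = l (β ⇀ x)`.
  have h1 : ∀ x, antipode D (antipode D (mk hS counit x)) * mk hS β.toLinearMap l =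
      mk hS β.toLinearMap l * mk hS counit x := by
    intro x
    refine hat_ext hS fun s => ?_
    rw [antipode_mk_counit, antipode_mk_counit, hat_mk_counit_mul_mk_algHom, hat_mul_mk_counit,
      hat_mk, smul_mul_assoc]
    congr 1
    have hx : leftHit β.toLinearMap (leftHit (β.toLinearMap ∘ₗ antipode D) x) = x := by
      rw [← leftHit_convL, convL_algHom_antipode, leftHit_counit]
    have hx' : ∀ y, leftHit (β.toLinearMap ∘ₗ antipode D) (leftHit β.toLinearMap y) = y := by
      intro y
      rw [← leftHit_convL, convL_algHom_antipode', leftHit_counit]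
    conv_lhs => rw [← hx]
    rw [h.comp_antipodeInv hS, ← h.leftHit_antipode_sq, ← leftHit_rightHit, hx',
      h.rightHit_antipode_sq, h.antipode_sq_rightHit, hx]
  have h2 : ∀ p, antipode D (antipode D (mk hS p 1)) * mk hS β.toLinearMap l =
      mk hS β.toLinearMap l * mk hS p 1 := by
    intro p
    refine hat_ext hS fun s => ?_
    conv_rhs => rw [← mk_one_mul_mk_counit hS β.toLinearMap l, mul_assoc]
    rw [antipode_mk_one, antipode_mk_one, mk_one_mul_mk, hat_mk, hat_mk_one_mul,
      hat_groupLike_mul hS hl, hat_mk, mul_smul_comm, mul_one, convL_eq_leftHit]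
    congr 1
    change p (antipodeInv hS (antipodeInv hS _)) = _
    congr 1
    apply hS.1
    apply hS.1
    rw [antipode_antipodeInv, antipode_antipodeInv, antipode_mul_antidistrib,
      antipode_mul_antidistrib, antipode_mul_antidistrib, antipode_mul_antidistrib,
      hl.antipode_antipode, h.antipode_sq_rightHit, ← mul_assoc,
      hl.antipode_mul_cancel, one_mul]
  induction a using induction_on with
  | mk p x =>
    rw [← mk_one_mul_mk_counit, antipode_mul_antidistrib, antipode_mul_antidistrib, mul_assoc, h1,
      ← mul_assoc, h2, mul_assoc]
  | zero => simp
  | add a b ha hb => simp only [map_add, add_mul, mul_add, ha, hb]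

/-- The sum over a dual basis, in terms of integrals and cointegrals. -/
lemma sum_eq_lift_comul {ι : Type*} [Fintype ι] {e : ι → H} {f : ι → Dual D H}
    (he : ∀ x, ∑ i, f i x • e i = x) {M : Type*} [AddCommGroup M] [Module D M]
    (B : H →ₗ[D] Dual D H →ₗ[D] M) (hg : IsIntegralModulus D g) {lam : Dual D H}
    (hl : IsRightIntegral lam) {L : H} (hL : IsLeftCointegral D L) :
    TensorProduct.lift (B.compl₂ ((antipodeInv hS).dualMap ∘ₗ (LinearMap.mulLeft D g).dualMap ∘ₗ
      (lactHom D H).toLinearMap.flip lam)) (comul L) = lam L • ∑ i, B (e i) (f i) := by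
  have h1 : ∀ w : H ⊗[D] H, TensorProduct.lift (B.compl₂ ((antipodeInv hS).dualMap ∘ₗ
      (LinearMap.mulLeft D g).dualMap ∘ₗ (lactHom D H).toLinearMap.flip lam)) w =
        ∑ i, B (slice₂ (lam ∘ₗ LinearMap.mulLeft D (g * antipodeInv hS (e i))) w) (f i) := by
    intro w
    induction w with
    | zero => simp
    | add a b ha hb => simp only [map_add, LinearMap.add_apply, Finset.sum_add_distrib, ha, hb]
    | tmul a b =>
      rw [lift.tmul, LinearMap.compl₂_apply, ← sum_apply_smul_dual he (LinearMap.comp _ _ b)]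
      simp [mul_assoc]
  rw [h1, Finset.smul_sum]
  refine Finset.sum_congr rfl fun i _ => ?_
  rw [slice₂_comul_of_modulus (hg.2 _ hl) hL, antipode_mul_antidistrib, antipode_antipodeInv,
    mul_assoc, hg.1.antipode_mul_cancel, mul_one, map_smul, LinearMap.smul_apply]

lemma antipode_drinfeldElement {ι : Type*} [Fintype ι] {e : ι → H} {f : ι → Dual D H}
    (he : ∀ x, ∑ i, f i x • e i = x) :
    antipode D (drinfeldElement (canonicalRMatrix hS)) =
      ∑ i, mk hS counit (e i) * mk hS (f i ∘ₗ antipodeInv hS) 1 := by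
  rw [drinfeldElement_eq, canonicalRMatrix_eq hS he]
  simp only [map_sum, antipodeFold_tmul, antipode_mul_antidistrib, antipode_mk_one,
    antipode_mk_counit]
  let B : H →ₗ[D] Dual D H →ₗ[D] DrinfeldDouble D H hS :=
    (LinearMap.mul D (DrinfeldDouble D H hS)).compl₁₂ (mk hS counit ∘ₗ antipode D)
      ((mk hS).flip 1 ∘ₗ (antipodeInv hS).dualMap)
  refine Eq.trans (sum_transpose he B (antipodeInv hS)) ?_
  refine Finset.sum_congr rfl fun i _ => ?_
  change mk hS counit (antipode D (antipodeInv hS (e i))) * _ = _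
  rw [antipode_antipodeInv]
  rfl

/-- Radford's formula shifted by `S⁻²`, the form in which it meets the Nakayama automorphism below.
-/
lemma _root_.HopfIntegral.BalancingData.antipodeInv_sq_leftHit (h : BalancingData α β g l) (x : H) :
    antipode D (antipode D (rightHit α.toLinearMap x)) * g =
      g * antipodeInv hS (antipodeInv hS (leftHit α.toLinearMap x)) := by
  have hg := h.integralModulus.1
  apply hS.1
  apply hS.1
  rw [antipode_mul_antidistrib, antipode_mul_antidistrib, antipode_mul_antidistrib,
    antipode_mul_antidistrib, hg.antipode_antipode, h.antipode_pow_four]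
  simp

lemma _root_.HopfIntegral.BalancingData.apply_mul_antipodeInv_sq [IsDomain D]
    (h : BalancingData α β g l) {lam : Dual D H} (hl : IsRightIntegral lam) (x : H) :
    lam (g * antipodeInv hS (antipodeInv hS x)) = α g * lam (g * x) := by
  have hg := h.integralModulus.1
  rw [← h.integralModulus.apply_antipode hl, antipode_antipodeInv]
  have h1 := h.apply_mul_comm hl x g
  rw [hg.rightHit_eq, map_smul, map_smul, smul_mul_assoc, map_smul, hg.antipode_antipode] at h1
  refine Eq.trans ?_ h1
  rw [← antipode_antipodeInv hS (x * g), h.integralModulus.apply_antipode hl, antipodeInv_mul,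
    hg.antipodeInv_eq, ← mul_assoc, hg.mul_antipode_cancel, one_mul]

/-- Evaluating `∑ eᵢ · (fᵢ ∘ S⁻¹)` needs the threefold coproduct of `eᵢ`, which is not controlled
for a dual basis. Times `lam(L)`, the canonical element is `∑ L' ⊗ lam(g S⁻¹(·) L'')`, whose
iterated coproducts all come from `L` and collapse. Summing over the normalized pairs gives the
formula itself. -/
lemma hat_antipode_drinfeldElement [IsDomain D] (h : BalancingData α β g l) (s : H) :
    hat hS (antipode D (drinfeldElement (canonicalRMatrix hS))) s =
      leftHit α.toLinearMap (antipodeInv hS s) * antipode D g := by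
  obtain ⟨n, e, f, he⟩ := exists_dualBasis D H
  obtain ⟨m, lam, Lam, hl, hL, h1⟩ := h.exists_integral_pairs
  have hg := h.integralModulus.1
  let B : H →ₗ[D] Dual D H →ₗ[D] DrinfeldDouble D H hS :=
    (LinearMap.mul D (DrinfeldDouble D H hS)).compl₁₂ (mk hS counit)
      ((mk hS).flip 1 ∘ₗ (antipodeInv hS).dualMap)
  have hB : ∀ x p, B x p = mk hS counit x * mk hS (p ∘ₗ antipodeInv hS) 1 := fun _ _ => rfl
  have key : ∀ k, hat hS (lam k (Lam k) • ∑ i, B (e i) (f i)) s =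
      lam k (Lam k) • (leftHit α.toLinearMap (antipodeInv hS s) * antipode D g) := by
    intro k
    rw [← sum_eq_lift_comul hS he B h.integralModulus (hl k) (hL k)]
    let ψ : Dual D H := lam k ∘ₗ LinearMap.mulLeft D g ∘ₗ antipodeInv hS ∘ₗ antipodeInv hS
    have h2 : ∀ (b : H) (t : H ⊗[D] (H ⊗[D] H)), conjMap hS (hat hS (mk hS
        (((antipodeInv hS).dualMap ∘ₗ (LinearMap.mulLeft D g).dualMap ∘ₗ
          (lactHom D H).toLinearMap.flip (lam k)) b ∘ₗ antipodeInv hS) 1)) s t =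
        conjMap hS (hat hS (mk hS ψ 1)) s (foldHit α (t ⊗ₜ b)) := by
      intro b t
      induction t with
      | zero => simp
      | add a b ha hb => simp only [add_tmul, map_add, ha, hb]
      | tmul a t =>
      induction t with
      | zero => simp
      | add a b ha hb => simp only [tmul_add, add_tmul, map_add, ha, hb]
      | tmul c d =>
        rw [foldHit_tmul, conjMap_tmul, conjMap_tmul, hat_mk, hat_mk]
        congr 2
        change lam k (g * antipodeInv hS (antipodeInv hS _) * b) = lam k (g * _)
        -- The Nakayama automorphism brings the second leg of `Lam k` to the front and Radford's
        -- formula carries it past `g`, next to `S⁻¹` of the preceding leg.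
        rw [h.apply_mul_comm (hl k), ← mul_assoc, h.antipodeInv_sq_leftHit hS, mul_assoc]
        simp only [LinearMap.comp_apply, antipodeInv_mul, antipodeInv_antipode, mul_assoc]
    have h3 : ∀ w : H ⊗[D] H, hat hS (TensorProduct.lift (B.compl₂ ((antipodeInv hS).dualMap ∘ₗ
        (LinearMap.mulLeft D g).dualMap ∘ₗ (lactHom D H).toLinearMap.flip (lam k))) w) s =
        conjMap hS (hat hS (mk hS ψ 1)) s
          (foldHit α ((comul.lTensor H ∘ₗ comul).rTensor H w)) := by
      intro w
      induction w with
      | zero => simp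
      | add a b ha hb => simp only [map_add, LinearMap.add_apply, ha, hb]
      | tmul a b =>
        rw [LinearMap.rTensor_tmul, ← h2, lift.tmul, LinearMap.compl₂_apply, hB, hat_mk_counit_mul]
        rfl
    have h4 : ∀ w : H ⊗[D] H, conjMap hS (hat hS (mk hS ψ 1)) s
        (((TensorProduct.mk D H H).flip 1).lTensor H w) =
          slice₁ (ψ ∘ₗ LinearMap.mulLeft D s) w := by
      intro w
      induction w with
      | zero => simp
      | add a b ha hb => simp only [map_add, ha, hb]
      | tmul a b => simp [antipodeInv_one]
    have h5 : ψ ∘ₗ LinearMap.mulLeft D s =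
        α g • (lam k ∘ₗ LinearMap.mulLeft D (antipode D (antipodeInv hS (g * s)))) := by
      ext z
      rw [antipode_antipodeInv]
      exact (h.apply_mul_antipodeInv_sq hS (hl k) (s * z)).trans (by simp)
    have h6 : ∀ (c : D) (p : Dual D H), slice₁ (c • p) = c • slice₁ p := by
      intro c p; ext; simp [smul_smul]
    rw [h3, foldHit_comul, h4, comul_leftHit, slice₁_lTensor, h5, h6, LinearMap.smul_apply,
      (hl k).slice₁_comul (hL k), antipodeInv_groupLike_mul hS hg, map_smul, map_smul,
      leftHit_algHom_mul, hg.antipode.leftHit_eq, mul_smul_comm]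
    -- The factor `α(g)` from commuting `S⁻²` past `lam` cancels the one from letting `α` act on
    -- `g⁻¹`.
    have : α g * α (antipode D g) = 1 := by
      rw [← map_mul, hg.mul_antipode_cancel, map_one]
    rw [smul_smul, smul_smul, AlgHom.toLinearMap_apply, mul_right_comm, this, one_mul]
  rw [antipode_drinfeldElement hS he]
  change hat hS (∑ i, B (e i) (f i)) s = _
  have := Finset.sum_congr (rfl : Finset.univ = Finset.univ) fun k _ => key k
  simp only [map_smul, LinearMap.smul_apply, ← Finset.sum_smul, h1, one_smul] at this
  exact this

/-- In `End(H)`, multiplication by `α ⊗ g` twists the argument by `α`, conjugates it by `g` and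
multiplies by `g`; this undoes the twist by `α` and the factor `g⁻¹` that separate `S_D(u)` from `u
= S⁻¹`. -/
lemma groupLike_mul_antipode_drinfeldElement [IsDomain D] (h : BalancingData α β g l) :
    mk hS α.toLinearMap g * antipode D (drinfeldElement (canonicalRMatrix hS)) =
      drinfeldElement (canonicalRMatrix hS) := by
  refine hat_ext hS fun s => ?_
  have hg := h.integralModulus.1
  rw [← mk_one_mul_mk_counit, mul_assoc, hat_mk_one_mul, hat_groupLike_mul hS hg,
    hat_antipode_drinfeldElement hS h, hat_drinfeldElement, antipodeInv_mul, antipodeInv_mul,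
    hg.antipode.antipodeInv_eq, hg.antipode_antipode, hg.antipodeInv_eq, leftHit_algHom_mul,
    leftHit_algHom_mul, hg.leftHit_eq, hg.antipode.leftHit_eq]
  obtain ⟨z, rfl⟩ := hS.2 s
  rw [rightHit_antipode, antipodeInv_antipode, antipodeInv_antipode, ← leftHit_convL,
    convL_algHom_antipode, leftHit_counit]
  have h1 : α g * α (antipode D g) = 1 := by
    rw [← map_mul, hg.mul_antipode_cancel, map_one]
  simp only [smul_mul_assoc, mul_smul_comm, smul_smul, AlgHom.toLinearMap_apply, h1, one_smul]
  rw [mul_assoc, mul_assoc, ← mul_assoc g, hg.mul_antipode_cancel, one_mul,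
    mul_one]

lemma isBalancingElement_mk [IsDomain D] (h : BalancingData α β g l) :
    IsBalancingElement (canonicalRMatrix hS) (mk hS β.toLinearMap l) where
  isGroupLikeElem := isGroupLikeElem_mk hS β h.isGroupLikeElem
  isUnit_drinfeldElement := ⟨⟨_, _, mul_drinfeldInv (isUniversalRMatrix_canonicalRMatrix hS)
    (canonicalRMatrix_mul_antipode hS) (map_antipode_canonicalRMatrix hS),
    drinfeldInv_mul (isUniversalRMatrix_canonicalRMatrix hS)
    (canonicalRMatrix_mul_antipode hS) (map_antipode_canonicalRMatrix hS)⟩, rfl⟩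
  sq_mul := by
    rw [mk_mul_mk_self hS h, groupLike_mul_antipode_drinfeldElement hS h]
  mul_sq := by
    set u := drinfeldElement (canonicalRMatrix hS) with hu
    -- `S²` is conjugation by `u`, hence fixes `u`; therefore `κ` commutes with `S(u)` and the
    -- second form of the relation follows from the first.
    have h1 : antipode D (antipode D u) = u := by
      have h2 := mul_drinfeldInv (isUniversalRMatrix_canonicalRMatrix hS)
        (canonicalRMatrix_mul_antipode hS) (map_antipode_canonicalRMatrix hS)
      have := congrArg (· * drinfeldInv (canonicalRMatrix hS))
        ((isUniversalRMatrix_canonicalRMatrix hS).antipode_sq_mul u)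
      rw [← hu] at h2 this
      simpa only [mul_assoc, h2, mul_one] using this
    have h3 := antipode_sq_mul_mk hS h (antipode D u)
    rw [h1] at h3
    rw [← mul_assoc, h3, mul_assoc, h3, ← mul_assoc, mk_mul_mk_self hS h,
      groupLike_mul_antipode_drinfeldElement hS h]
  antipode_sq := antipode_sq_mul_mk hS h

end Balancing
end DrinfeldDouble

namespace DrinfeldDouble

open Module (Dual)
open HopfIntegral

universe u v

/-! ### Integrals of the double and their values at the ribbon element. -/

section Integrals

variable {D : Type u} {H : Type v} [CommRing D] [Ring H] [HopfAlgebra D H]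
variable (hS : Function.Bijective (antipode D : H →ₗ[D] H))

/-- The linear form `p ⊗ x ↦ p(L) lam(x)` on the double. -/
noncomputable def prodForm (lam : Dual D H) (L : H) : Dual D (DrinfeldDouble D H hS) :=
  lam ∘ₗ (hat hS).flip L

variable (lam : Dual D H) (L : H)

lemma prodForm_apply (v : DrinfeldDouble D H hS) : prodForm hS lam L v = lam (hat hS v L) := rfl

lemma prodForm_mk (p : Dual D H) (x : H) : prodForm hS lam L (mk hS p x) = p L * lam x := by
  rw [prodForm_apply, hat_mk, map_smul, smul_eq_mul]

variable {lam : Dual D H} {L : H}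

/-- In `S⁻¹(c) L a` the cointegral absorbs both outer factors, as the scalars `ε(c)` and `α(a)`. -/
lemma conjMap_cointegral {α : H →ₐ[D] D} (hL : IsLeftCointegral D L) (hα : ∀ x, L * x = α x • L)
    (T : H →ₗ[D] H) (t : H ⊗[D] (H ⊗[D] H)) :
    conjMap hS T L t = slice₁ α.toLinearMap ((slice₂ counit).lTensor H t) * T L := by
  have hc : ∀ x, counit (R := D) (antipodeInv hS x) = counit x := by
    intro x
    obtain ⟨y, rfl⟩ := hS.2 x
    simp
  induction t with
  | zero => simp
  | add a b ha hb => simp only [map_add, add_mul, ha, hb]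
  | tmul a t =>
  induction t with
  | zero => simp
  | add a b ha hb => simp only [tmul_add, map_add, add_mul, ha, hb]
  | tmul b c =>
    simp [hα, hL _, hc, smul_smul, mul_comm (α a)]

variable [Module.Finite D H] [Module.Projective D H]

/-- As a coalgebra the double is a tensor product, so an integral is the product of one on each
factor; on `H*` with the opposite coproduct it is evaluation at a left cointegral. -/
lemma isRightIntegral_prodForm (hl : IsRightIntegral lam) (hL : IsLeftCointegral D L) :
    IsRightIntegral (prodForm hS lam L) := by
  intro f
  ext v
  induction v using induction_on with
  | zero => simp
  | add a b ha hb => simp only [map_add, ha, hb]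
  | mk p x =>
    have h1 : ∀ (w : Dual D H ⊗[D] Dual D H) (t : H ⊗[D] H), slice₁ (prodForm hS lam L)
        (TensorProduct.map₂ (mk hS) (mk hS) w t) =
          mk hS (dualTensorHom D H (Dual D H) w L) (slice₁ lam t) := by
      intro w t
      induction w with
      | zero => simp
      | add a b ha hb => simp only [map_add, LinearMap.add_apply, ha, hb]
      | tmul p q =>
      induction t with
      | zero => simp
      | add a b ha hb => simp only [map_add, ha, hb]
      | tmul a b =>
        rw [map₂_apply_tmul, map_tmul, slice₁_tmul, slice₁_tmul, prodForm_mk, dualTensorHom_apply]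
        simp [smul_smul, mul_comm (p L)]
    have h2 : lactHom D H L p = p L • counit := by
      ext z
      simp [hL z, mul_comm]
    rw [convL_eq_rightHit, rightHit_eq_slice, comul_mk, h1, dualTensorHom_dualComul, h2,
      ← rightHit_eq_slice, hl.rightHit_eq]
    simp [prodForm_mk, ← one_def]
    ring

/-- On the other side the two factors contribute their moduli, so the modulus of the double is `α ⊗
g`, which is `κ²`. -/
lemma convL_prodForm {α : H →ₐ[D] D} {g : H} (hg : ∀ p : Dual D H, convL D H p lam = p g • lam)
    (hα : ∀ x, L * x = α x • L) (f : Dual D (DrinfeldDouble D H hS)) :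
    convL D _ f (prodForm hS lam L) = f (mk hS α.toLinearMap g) • prodForm hS lam L := by
  ext v
  induction v using induction_on with
  | zero => simp
  | add a b ha hb => simp only [map_add, ha, hb]
  | mk p x =>
    have h1 : ∀ (w : Dual D H ⊗[D] Dual D H) (t : H ⊗[D] H), slice₂ (prodForm hS lam L)
        (TensorProduct.map₂ (mk hS) (mk hS) w t) =
          mk hS (dualTensorHom D H (Dual D H) (TensorProduct.comm D _ _ w) L) (slice₂ lam t) := by
      intro w t
      induction w with
      | zero => simp
      | add a b ha hb => simp only [map_add, LinearMap.add_apply, ha, hb]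
      | tmul p q =>
      induction t with
      | zero => simp
      | add a b ha hb => simp only [map_add, ha, hb]
      | tmul a b =>
        rw [map₂_apply_tmul, map_tmul, slice₂_tmul, slice₂_tmul, prodForm_mk, comm_tmul,
          dualTensorHom_apply]
        simp [smul_smul, mul_comm (q L)]
    have h2 : dualTensorHom D H (Dual D H) (TensorProduct.comm D _ _ (dualComul D H p)) L =
        p L • α.toLinearMap := by
      ext z
      have h3 : ∀ w : Dual D H ⊗[D] Dual D H,
          dualTensorHom D H (Dual D H) (TensorProduct.comm D _ _ w) L z =
            dualTensorHom D H (Dual D H) w z L := by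
        intro w
        induction w with
        | zero => simp
        | add a b ha hb => simp only [map_add, LinearMap.add_apply, ha, hb]
        | tmul p q => simp [mul_comm]
      rw [h3, dualTensorHom_dualComul, lactHom_apply, hα]
      simp [mul_comm]
    rw [convL_eq_leftHit, leftHit_eq_slice, comul_mk, h1, h2, ← leftHit_eq_slice,
      leftHit_eq_of_modulus hg]
    simp [prodForm_mk]
    ring

variable {α β : H →ₐ[D] D} {g l : H}

/-- The argument is `κu⁻¹ = r⁻¹`. Its endomorphism sends `L` to `l (β ⇀ L)`; letting `β` act on `lL
= L` turns the factor `l` into `β(l)⁻¹`, and `lam` ignores the remaining action of `β`. -/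
lemma prodForm_drinfeldInv (h : BalancingData α β g l) (hl : IsRightIntegral lam)
    (hL : IsLeftCointegral D L) :
    prodForm hS lam L (mk hS β.toLinearMap l * drinfeldInv (canonicalRMatrix hS)) =
      β (antipode D l) * lam L := by
  have hl' := h.isGroupLikeElem
  rw [prodForm_apply, ← mk_one_mul_mk_counit, mul_assoc, hat_mk_one_mul, hat_groupLike_mul hS hl',
    hat_drinfeldInv, antipode_mul_antidistrib, antipode_mul_antidistrib, antipode_mul_antidistrib,
    antipode_mul_antidistrib, hl'.antipode_antipode, ← mul_assoc, ← mul_assoc,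
    hl'.mul_antipode_cancel, one_mul, h.antipode_sq_rightHit]
  have h1 : β l • (l * leftHit β.toLinearMap L) = leftHit β.toLinearMap L := by
    have := leftHit_algHom_mul β l L
    rw [hL, hl'.counit_eq_one, one_smul, hl'.leftHit_eq, smul_mul_assoc] at this
    exact this.symm
  have h2 : lam (leftHit β.toLinearMap L) = lam L := by
    rw [← convL_eq_leftHit, hl]
    simp
  have h3 : β (antipode D l) * β l = 1 := by
    rw [← map_mul, hl'.antipode_mul_cancel, map_one]
  rw [← h2]
  conv_rhs => rw [← h1]
  rw [map_smul, smul_eq_mul, ← mul_assoc, h3, one_mul]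

variable [IsDomain D]

/-- For `b = ε ⊗ y` this is the Nakayama automorphism of `lam`, the twist by `α` being supplied by
`L`. For `b = q ⊗ 1` it is the Nakayama automorphism of `L`, the factor `g` being supplied by `lam`.
The moduli of `H` thus cancel in the double. -/
lemma prodForm_mul_comm (h : BalancingData α β g l) (hl : IsRightIntegral lam)
    (hL : IsLeftCointegral D L) (a b : DrinfeldDouble D H hS) :
    prodForm hS lam L (a * b) = prodForm hS lam L (antipode D (antipode D b) * a) := by
  have hα := h.cointegralModulus L hL
  have h1 : ∀ a y, prodForm hS lam L (a * mk hS counit y) =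
      prodForm hS lam L (antipode D (antipode D (mk hS counit y)) * a) := by
    intro a y
    rw [antipode_mk_counit, antipode_mk_counit, prodForm_apply, prodForm_apply, hat_mul_mk_counit,
      hat_mk_counit_mul, conjMap_cointegral hS hL hα, h.apply_mul_comm hl]
    congr 2
    rw [← LinearMap.comp_apply (LinearMap.lTensor H _), ← LinearMap.lTensor_comp]
    have h2 : slice₂ (D := D) counit ∘ₗ comul (R := D) (A := H) = .id :=
      LinearMap.ext leftHit_counit
    rw [h2, LinearMap.lTensor_id, LinearMap.id_apply, ← rightHit_eq_slice, ← h.sq_left,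
      rightHit_convL, rightHit_convL, h.rightHit_antipode_sq, h.rightHit_antipode_sq]
  have h2 : ∀ a q, prodForm hS lam L (a * mk hS q 1) =
      prodForm hS lam L (antipode D (antipode D (mk hS q 1)) * a) := by
    intro a q
    have h3 : ∀ (s : H) (t : H ⊗[D] H), lam (conjMap hS (hat hS (mk hS q 1)) s
        (comul.lTensor H t)) = q (s * slice₂ lam t) := by
      intro s t
      induction t with
      | zero => simp
      | add a b ha hb => simp only [map_add, mul_add, ha, hb]
      | tmul a b =>
        have h4 : ∀ w : H ⊗[D] H, lam (conjMap hS (hat hS (mk hS q 1)) s (a ⊗ₜ w)) =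
            q (antipodeInv hS (slice₁ lam w) * (s * a)) := by
          intro w
          induction w with
          | zero => simp
          | add a b ha hb => simp only [tmul_add, map_add, add_mul, ha, hb]
          | tmul c d => simp [mul_comm]
        rw [LinearMap.lTensor_tmul, h4, ← rightHit_eq_slice, hl.rightHit_eq]
        simp [antipodeInv_one]
    induction a using induction_on with
    | zero => simp
    | add a b ha hb => simp only [map_add, add_mul, mul_add, ha, hb]
    | mk p x =>
      rw [antipode_mk_one, antipode_mk_one, prodForm_apply, prodForm_apply, hat_mk_one_mul,
        ← mk_one_mul_mk_counit hS p x, mul_assoc, hat_mk_one_mul, hat_mk_counit_mul, h3,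
        mk_one_mul_mk_counit, hat_mk, ← leftHit_eq_slice,
        leftHit_eq_of_modulus (h.integralModulus.2 _ hl), mul_smul_comm, map_smul, map_smul,
        smul_eq_mul, smul_eq_mul, mul_comm]
      congr 1
      rw [rightHit_eq_slice ((q ∘ₗ antipodeInv hS) ∘ₗ antipodeInv hS), h.comul_comm hL]
      have h5 : ((q ∘ₗ antipodeInv hS) ∘ₗ antipodeInv hS) ∘ₗ antipode D ∘ₗ antipode D ∘ₗ
          LinearMap.mulRight D g = q ∘ₗ LinearMap.mulRight D g := by
        ext z; simp
      rw [h5, ← apply_slice]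
      rfl
  induction b using induction_on with
  | zero => simp
  | add x y hx hy => simp only [map_add, add_mul, mul_add, hx, hy]
  | mk p x =>
    rw [← mk_one_mul_mk_counit, ← mul_assoc, h1, ← mul_assoc, h2, antipode_mul_antidistrib,
      antipode_mul_antidistrib, mul_assoc]

/-- The argument is `κ S_D(u) = r`, whose endomorphism sends `L` to `(β ⇀ S⁻¹(L)) l⁻¹`. Moving `l⁻¹`
to the left under `lam` contributes `β(l)⁻²`, absorbing it into `S⁻¹(L)` contributes `β(l)³`, and
comparing `lam(S⁻¹(L))` with `lam(L)` contributes `β(l)⁴`. -/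
lemma prodForm_antipode_drinfeldElement (h : BalancingData α β g l) (hl : IsRightIntegral lam)
    (hL : IsLeftCointegral D L) :
    prodForm hS lam L (mk hS β.toLinearMap l * antipode D (drinfeldElement (canonicalRMatrix hS))) =
      β l ^ 5 * lam L := by
  have hl' := h.isGroupLikeElem
  have hg := h.integralModulus.1
  have hb : β l * β (antipode D l) = 1 := by
    rw [← map_mul, hl'.mul_antipode_cancel, map_one]
  have hα : ∀ {y : H}, IsGroupLikeElem D y → α y = β y * β y := by
    intro y hy
    have := LinearMap.congr_fun h.sq_left y
    rw [convL_eq_rightHit, hy.rightHit_eq, map_smul] at this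
    exact this.symm
  have hαl : α (antipode D l) * α l = 1 := by
    rw [← map_mul, hl'.antipode_mul_cancel, map_one]
  have h1 : hat hS (mk hS β.toLinearMap l *
      antipode D (drinfeldElement (canonicalRMatrix hS))) L =
        leftHit β.toLinearMap (antipodeInv hS L) * antipode D l := by
    obtain ⟨z, rfl⟩ := hS.2 L
    rw [← mk_one_mul_mk_counit, mul_assoc, hat_mk_one_mul, hat_groupLike_mul hS hl',
      hat_antipode_drinfeldElement hS h, antipodeInv_mul, antipodeInv_mul, hl'.antipodeInv_eq,
      hl'.antipode.antipodeInv_eq, hl'.antipode_antipode, leftHit_algHom_mul, leftHit_algHom_mul,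
      hl'.leftHit_eq, hl'.antipode.leftHit_eq, rightHit_antipode, antipodeInv_antipode,
      antipodeInv_antipode, ← h.sq_left, leftHit_convL, ← leftHit_convL β.toLinearMap (_ ∘ₗ _),
      convL_algHom_antipode, leftHit_counit, h.sq_left, ← h.sq_right, antipode_mul_antidistrib]
    simp only [smul_mul_assoc, mul_smul_comm, smul_smul, AlgHom.toLinearMap_apply]
    rw [mul_comm, hαl]
    simp only [one_smul, ← mul_assoc, hl'.mul_antipode_cancel, one_mul]
    rw [mul_assoc _ l, hl'.mul_antipode_cancel, mul_one]
  have h2 : antipode D l * antipodeInv hS L = α l • antipodeInv hS L := by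
    rw [← hl'.antipodeInv_eq hS, ← antipodeInv_mul, h.cointegralModulus L hL, map_smul]
  have h3 : ∀ x, lam (leftHit β.toLinearMap x) = lam x := by
    intro x
    rw [← convL_eq_leftHit, hl]
    simp
  have h4 : β (antipode D l) * lam (antipode D l * leftHit β.toLinearMap (antipodeInv hS L)) =
      α l * lam (antipodeInv hS L) := by
    have := leftHit_algHom_mul β (antipode D l) (antipodeInv hS L)
    rw [h2, hl'.antipode.leftHit_eq, map_smul, smul_mul_assoc] at this
    have := congrArg lam this
    simp only [map_smul, h3, smul_eq_mul] at this
    exact this.symm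
  have h5 : lam L = α (antipode D g) * lam (antipodeInv hS L) := by
    have : g * antipodeInv hS L = α (antipode D g) • antipodeInv hS L := by
      rw [← map_smul, ← h.cointegralModulus L hL, antipodeInv_mul, hg.antipode.antipodeInv_eq,
        hg.antipode_antipode]
    conv_lhs => rw [← antipode_antipodeInv hS L, h.integralModulus.apply_antipode hl, this]
    rw [map_smul, smul_eq_mul]
  rw [prodForm_apply, h1, h.apply_mul_comm hl, hl'.antipode.rightHit_eq, map_smul, map_smul,
    hl'.antipode_antipode, smul_mul_assoc, map_smul, smul_eq_mul, AlgHom.toLinearMap_apply, h5,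
    hα hl'.antipode, hα hg.antipode, ← h.sq_right, antipode_mul_antidistrib, map_mul β, mul_assoc,
    h4, hα hl']
  generalize lam (antipodeInv hS L) = t
  -- The two sides are `β(l) t` times the first and the fourth power of `β(l) β(l⁻¹) = 1`.
  trans (β l * β (antipode D l)) * (β l * t)
  · ring
  trans (β l * β (antipode D l)) ^ 4 * (β l * t)
  · rw [hb, one_pow]
  · ring

lemma exists_ribbon_integral (h : BalancingData α β g l) :
    ∃ F : Dual D (DrinfeldDouble D H hS), IsRightIntegral F ∧
      (∀ p, convL D _ p F = p (mk hS α.toLinearMap g) • F) ∧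
      (∀ a b, F (a * b) = F (antipode D (antipode D b) * a)) ∧
      F (mk hS β.toLinearMap l * antipode D (drinfeldElement (canonicalRMatrix hS))) *
        F (mk hS β.toLinearMap l * drinfeldInv (canonicalRMatrix hS)) = 1 := by
  obtain ⟨m, lam, Lam, hl, hL, h1⟩ := h.exists_integral_pairs
  have hb : β l * β (antipode D l) = 1 := by
    rw [← map_mul, h.isGroupLikeElem.mul_antipode_cancel, map_one]
  -- Since `∑ lam k (Lam k) = 1`, the bare sum takes the values `β(l)⁵` and `β(l)⁻¹`, with product
  -- `β(l)⁴`; the factor `β(l)⁻²` enters twice and cancels it.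
  refine ⟨β (antipode D l) ^ 2 • ∑ k, prodForm hS (lam k) (Lam k), fun f => ?_, fun f => ?_,
    fun a b => ?_, ?_⟩
  · simp only [map_smul, map_sum, LinearMap.smul_apply, LinearMap.sum_apply,
      fun k => isRightIntegral_prodForm hS (hl k) (hL k) f, ← Finset.smul_sum]
    rw [smul_comm]
  · simp only [map_smul, map_sum, fun k => convL_prodForm hS (h.integralModulus.2 _ (hl k))
      (h.cointegralModulus _ (hL k)) f, ← Finset.smul_sum]
    rw [smul_comm]
  · simp only [LinearMap.smul_apply, LinearMap.sum_apply,
      fun k => prodForm_mul_comm hS h (hl k) (hL k) a b]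
  · simp only [LinearMap.smul_apply, LinearMap.sum_apply,
      fun k => prodForm_drinfeldInv hS h (hl k) (hL k),
      fun k => prodForm_antipode_drinfeldElement hS h (hl k) (hL k), ← Finset.mul_sum, h1,
      mul_one, smul_eq_mul]
    rw [show β (antipode D l) ^ 2 * β l ^ 5 * (β (antipode D l) ^ 2 * β (antipode D l)) =
      (β l * β (antipode D l)) ^ 5 by ring, hb, one_pow]

end Integrals
end DrinfeldDouble

namespace HopfIntegral

open Module (Dual)
open DrinfeldDouble

universe u v

/-! ### Two-sided cointegrals. -/

section TwoSided

variable {D : Type u} {A : Type v} [CommRing D] [Ring A] [HopfAlgebra D A]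
  [Module.Finite D A] [Module.Projective D A]

/-- A right integral with invertible values on some element is normalized by a two-sided
cointegral, if it is a trace up to the square of the antipode. -/
lemma exists_twoSided_cointegral {F : Dual D A} (hF : IsRightIntegral F) {G : A}
    (hG : IsGroupLikeElem D G) (hm : ∀ p, convL D A p F = p G • F)
    (ht : ∀ a b, F (a * b) = F (antipode D (antipode D b) * a)) {r : A} {c : D}
    (hr : F (antipode D r) * c = 1) :
    ∃ L : A, IsLeftCointegral D L ∧ IsRightCointegral D L ∧ F L = 1 ∧ F (antipode D L) = 1 := by
  obtain ⟨n, mu, M, h1, h2, h3⟩ := exists_integral_pairs (D := D) (A := A)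
  have h4 : ∀ j, IsRightCointegral D (antipode D (M j)) :=
    fun j => (h2 j).antipode antipode_bijective
  -- The coefficients come from comparing `F` with each `mu j`: `F(S(r)) = ∑ F(S(M j)) mu j (G r)`,
  -- so multiplying by `c` makes `F(L) = 1`.
  let L : A := ∑ j, (mu j (G * r) * c) • antipode D (M j)
  have hL : IsRightCointegral D L := by
    intro x
    simp only [L, Finset.sum_mul, smul_mul_assoc, h4 _ x, Finset.smul_sum]
    exact Finset.sum_congr rfl fun j _ => smul_comm _ _ _
  have hFL : F L = 1 := by
    have h5 : F (antipode D r) = ∑ j, F (antipode D (M j)) * mu j (G * r) := by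
      rw [← mul_one (F (antipode D r)), ← h3, Finset.mul_sum]
      exact Finset.sum_congr rfl fun j _ => (h1 j).apply_antipode_mul hm (h4 j) r
    rw [← hr, h5, Finset.sum_mul, map_sum]
    refine Finset.sum_congr rfl fun j _ => ?_
    rw [map_smul, smul_eq_mul]
    ring
  have hL' : IsLeftCointegral D L := by
    intro x
    rw [← sub_eq_zero]
    have h5 : IsRightCointegral D (antipode D (antipode D L)) := by
      intro y
      obtain ⟨z, rfl⟩ := (antipode_bijective (D := D) (A := A)).2 y
      obtain ⟨w, rfl⟩ := (antipode_bijective (D := D) (A := A)).2 z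
      rw [← antipode_mul_antidistrib, ← antipode_mul_antidistrib, hL, map_smul, map_smul,
        counit_antipode, counit_antipode]
    -- As `F(L) = 1`, nondegeneracy of `F` suffices. The trace property moves `L` to the front as
    -- `S²(L)`, again a right cointegral, so `F(yxL)` and `ε(x) F(yL)` agree.
    have h6 := hF.smul_eq_zero hL (x := x * L - counit (R := D) x • L) fun y => by
      rw [mul_sub, map_sub, ← mul_assoc, ht, h5, mul_smul_comm, map_smul, map_smul,
        ht y, h5, map_smul, counit_mul, smul_eq_mul, smul_eq_mul, smul_eq_mul, mul_left_comm,
        mul_assoc, sub_self]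
    rwa [hFL, one_smul] at h6
  refine ⟨L, hL', hL, hFL, ?_⟩
  have := hF.apply_antipode_mul hm hL L
  rwa [hFL, mul_one, one_mul, hL', map_smul, hG.counit_eq_one, one_smul, hFL] at this

end TwoSided
end HopfIntegral

theorem mainTheorem11 {D : Type*} {H : Type*} [CommRing D] [IsDedekindDomain D] [Ring H]
    [HopfAlgebra D H] [Module.Finite D H] [Module.Projective D H]
    (hH : IsDoubleBalanced D H) :
    ∃ hS : Function.Bijective (HopfAlgebra.antipode D : H →ₗ[D] H),
      IsTopogenic (D := D) (A := DrinfeldDouble D H hS) (DrinfeldDouble.canonicalRMatrix hS) := by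
  obtain ⟨α, β, g, l, h1, h2, h3, h4, h5, h6⟩ := hH
  have h : HopfIntegral.BalancingData α β g l := ⟨h1, h2, h3, h4, h5, h6⟩
  have hS : Function.Bijective (HopfAlgebra.antipode D : H →ₗ[D] H) :=
    HopfIntegral.antipode_bijective
  refine ⟨hS, ⟨inferInstance, HopfIntegral.antipode_bijective,
    DrinfeldDouble.isUniversalRMatrix_canonicalRMatrix hS,
    DrinfeldDouble.bijective_modularMap hS, ?_⟩⟩
  have hκ := DrinfeldDouble.isBalancingElement_mk hS h
  obtain ⟨r, hr, hr', hrib, hrκ⟩ := hκ.exists_ribbon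
    (DrinfeldDouble.isUniversalRMatrix_canonicalRMatrix hS)
    (DrinfeldDouble.canonicalRMatrix_mul_antipode hS)
    (DrinfeldDouble.map_antipode_canonicalRMatrix hS)
  obtain ⟨F, hF, hm, ht, hn⟩ := DrinfeldDouble.exists_ribbon_integral hS h
  -- The integral was evaluated at `κ S(u)`, which is `S(uκ⁻¹) = S(r) = r`.
  have hr₁ : DrinfeldDouble.mk hS β.toLinearMap l *
      antipode D (drinfeldElement (DrinfeldDouble.canonicalRMatrix hS)) = r := by
    rw [← hrib.antipode_eq, hr, antipode_mul_antidistrib, hκ.isGroupLikeElem.antipode_antipode]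
  have hr₂ : DrinfeldDouble.mk hS β.toLinearMap l *
      HopfIntegral.drinfeldInv (DrinfeldDouble.canonicalRMatrix hS) = ↑r⁻¹ := by
    apply r.isUnit.mul_left_cancel
    rw [← mul_assoc, hrκ, r.mul_inv]
    exact HopfIntegral.mul_drinfeldInv (DrinfeldDouble.isUniversalRMatrix_canonicalRMatrix hS)
      (DrinfeldDouble.canonicalRMatrix_mul_antipode hS)
      (DrinfeldDouble.map_antipode_canonicalRMatrix hS)
  rw [hr₁, hr₂] at hn
  -- Because `S(r) = r`, the normalization `F(r) F(r⁻¹) = 1` says that `F(r⁻¹)` inverts the value of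
  -- `F` at `S(r)`.
  obtain ⟨L, hL, hL', hFL, hFL'⟩ := HopfIntegral.exists_twoSided_cointegral hF
    (DrinfeldDouble.isGroupLikeElem_mk hS α h2.1) hm ht (r := r) (c := F ↑r⁻¹)
    (by rw [hrib.antipode_eq, hn])
  exact ⟨r, _, F, L, hrib, hκ, hrκ, hF, hn, hL, hL', hFL, hFL'⟩
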